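/- Let $\Bbbk$ be an algebraically closed field, $n\ge 0$, and let $Q$ be a quiver of type $\mathbb{A}_{n+2}$ with vertices $1,\dots,n+2$; for $\ell\in[n+1]=\{1,\dots,n+1\}$ let $\alpha_\ell$ be the arrow between $\ell$ and $\ell+1$. Call $\ell\in[n+1]$ upper-barred ($\ell\in\overline{[n+1]}$) if $\alpha_\ell\colon\ell\to\ell+1$, and lower-barred ($\ell\in\underline{[n+1]}$) if $\alpha_\ell\colon\ell\leftarrow\ell+1$. Representations of $Q$ are finite dimensional over $\Bbbk$. Let $P(Q)$ be a convex $(n+3)$-gon in the plane with vertices $0,1,\dots,n+2$ drawn from left to right, where $0$ and $n+2$ lie on a horizontal line $L$, the upper-barred vertices lie above $L$ and the lower-barred ones below $L$. For $0\le i<j\le n+2$ let $\gamma(i,j)$ be the line segment between $i$ and $j$. A triangulation (including the boundary edges) is a maximal set of pairwise non-crossing line segments. For $\pi=\pi_1\dots\pi_{n+1}\in S_{n+1}$ let $\lambda_0(\pi)$ be the path from $0$ to $n+2$ through all lower-barred vertices in increasing order; obtain $\lambda_{i}(\pi)$ from $\lambda_{i-1}(\pi)$ by adding the vertex $\pi_i$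 if $\pi_i$ is upper-barred, and deleting it if $\pi_i$ is lower-barred (keeping the vertices in increasing order). Let $\eta_Q(\pi)$ be the set of all line segments of the paths $\lambda_0(\pi),\dots,\lambda_{n+1}(\pi)$. For $1\le i\le j\le n+2$ let $M(i,j)$ be the representation with $\Bbbk$ at the vertices $i,\dots,j$, zero elsewhere, and identity maps between the copies of $\Bbbk$. Put $F(\gamma(i,j))=M(i+1,j)$, and for a set $\mathcal T$ of line segments $F(\mathcal T)=\bigoplus_{\gamma\in\mathcal T}F(\gamma)$. Let $\eta_Q^{\mathrm{rep}}(\pi)=F(\eta_Q(\pi))$. A representation $T$ is almost rigid if it has no repeated indecomposable direct summands and, for all indecomposable summands $A,B$ of $T$, either $\mathrm{Ext}^1(A,B)=0$, or $\mathrm{Ext}^1(A,B)$ is one-dimensional and generated by a short exact sequence $0\to B\to E\to A\to 0$ with $E$ indecomposable. It is maximal almost rigid if it is almost rigid and $T\oplus M$ is not almost rigid for any nonzero representation $M$. A representation $M$ is an extension of $N$ if there is a non-split short exact sequence $0\to N_1\to M\to N_2\to 0$ with $N\cong N_1\oplus N_2$. It is a degeneration of $N$ if it lies in the Zariski closure of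 the isomorphism class of $N$ (in the affine space of representations of a fixed dimension vector). Define representations $\lambda^{\mathrm{rep}}_0(\pi),\dots,\lambda^{\mathrm{rep}}_{n+1}(\pi)$ of dimension vector $(1,\dots,1)$ as follows: $\lambda_0^{\mathrm{rep}}(\pi)$ has the zero map on $\alpha_\ell$ for $\ell$ lower-barred and the identity map on all other arrows; $\lambda_i^{\mathrm{rep}}(\pi)$ is obtained from $\lambda_{i-1}^{\mathrm{rep}}(\pi)$ by putting on the arrow $\alpha_{\pi_i}$ the zero map if $\pi_i\in\overline{[n+1]}$, and the identity map if $\pi_i\in\underline{[n+1]}$. Then the following hold for every $\pi\in S_{n+1}$. 1. $\eta_Q(\pi)$ is a triangulation of $P(Q)$. 2. If $\pi_i$ is upper-barred, then $\lambda_{i-1}^{\mathrm{rep}}(\pi)$ has the identity map on $\alpha_{\pi_i}$ and $\lambda_i^{\mathrm{rep}}(\pi)$ is a degeneration of $\lambda_{i-1}^{\mathrm{rep}}(\pi)$. If $\pi_i$ is lower-barred, then $\lambda_{i-1}^{\mathrm{rep}}(\pi)$ has the zero map on $\alpha_{\pi_i}$ and $\lambda_i^{\mathrm{rep}}(\pi)$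 is an extension of $\lambda_{i-1}^{\mathrm{rep}}(\pi)$. The last representation $\lambda_{n+1}^{\mathrm{rep}}(\pi)$ has the zero map on $\alpha_\ell$ for $\ell$ upper-barred and the identity map on all other arrows. 3. $\eta_Q^{\mathrm{rep}}(\pi)$ is a maximal almost rigid representation, and an indecomposable representation is (up to isomorphism) a direct summand of $\eta_Q^{\mathrm{rep}}(\pi)$ if and only if it is a direct summand of $\lambda_i^{\mathrm{rep}}(\pi)$ for some $i\in\{0,\dots,n+1\}$. Up to isomorphism, $\eta_Q^{\mathrm{rep}}(\pi)$ is the only maximal almost rigid representation with this property. -/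

import Mathlib

universe u v w

/-! ## Representations of quivers -/

/-- A finite dimensional representation over `k` of a quiver with vertex set `V`. -/
structure QuiverRep (k : Type u) [Field k] (V : Type v) [Quiver.{w} V] where
  space : V → Type u
  [addCommGroup : ∀ x, AddCommGroup (space x)]
  [module : ∀ x, Module k (space x)]
  [finiteDimensional : ∀ x, FiniteDimensional k (space x)]
  map : ∀ {x y : V}, (x ⟶ y) → (space x →ₗ[k] space y)

attribute [instance] QuiverRep.addCommGroup QuiverRep.module QuiverRep.finiteDimensional

namespace QuiverRep

variable {k : Type u} [Field k] {V : Type v} [Quiver.{w} V]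

/-- Morphisms of representations. -/
structure Hom (M N : QuiverRep k V) where
  app : ∀ x, M.space x →ₗ[k] N.space x
  comm : ∀ {x y : V} (a : x ⟶ y), N.map a ∘ₗ app x = app y ∘ₗ M.map a

/-- Isomorphisms of representations. -/
structure Iso (M N : QuiverRep k V) where
  app : ∀ x, M.space x ≃ₗ[k] N.space x
  comm : ∀ {x y : V} (a : x ⟶ y) (m : M.space x), N.map a (app x m) = app y (M.map a m)

/-- `M ≅ N`. -/
def Isomorphic (M N : QuiverRep k V) : Prop := Nonempty (Iso M N)

/-- The zero representation (up to isomorphism). -/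
def IsZero (M : QuiverRep k V) : Prop := ∀ x, Subsingleton (M.space x)

/-- The direct sum `M ⊕ N`. -/
def sum (M N : QuiverRep k V) : QuiverRep k V where
  space x := M.space x × N.space x
  map a := (M.map a).prodMap (N.map a)

/-- The direct sum of a finite family of representations. -/
def directSum {ι : Type} [Finite ι] (M : ι → QuiverRep k V) : QuiverRep k V where
  space x := ∀ i, (M i).space x
  map a := LinearMap.pi fun i => (M i).map a ∘ₗ LinearMap.proj i

/-- `M` is nonzero and is not the direct sum of two nonzero representations. -/
def Indecomposable (M : QuiverRep k V) : Prop :=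
  ¬ M.IsZero ∧ ∀ A B : QuiverRep k V, M.Isomorphic (A.sum B) → A.IsZero ∨ B.IsZero

/-- `X` is (isomorphic to) a direct summand of `M`. -/
def IsSummand (X M : QuiverRep k V) : Prop := ∃ Y : QuiverRep k V, M.Isomorphic (X.sum Y)

/-- `X` is (isomorphic to) an indecomposable direct summand of `M`. -/
def IsIndecSummand (X M : QuiverRep k V) : Prop := X.Indecomposable ∧ X.IsSummand M

/-- `M` has no repeated indecomposable direct summands. -/
def Basic (M : QuiverRep k V) : Prop :=
  ∀ X : QuiverRep k V, X.Indecomposable → ¬ (X.sum X).IsSummand M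

/-- `0 → A → E → B → 0` is a short exact sequence. -/
def ShortExact {A E B : QuiverRep k V} (f : Hom A E) (g : Hom E B) : Prop :=
  ∀ x, Function.Injective (f.app x) ∧ Function.Surjective (g.app x) ∧
    LinearMap.range (f.app x) = LinearMap.ker (g.app x)

/-- The epimorphism `g` of a short exact sequence has a section, i.e. the sequence splits. -/
def Splits {E B : QuiverRep k V} (g : Hom E B) : Prop :=
  ∃ s : Hom B E, ∀ x, g.app x ∘ₗ s.app x = LinearMap.id

/-- The differential `∏ₓ Hom(Aₓ, Bₓ) → ∏_{a : x → y} Hom(Aₓ, B_y)`; its kernel is `Hom(A, B)` and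
its cokernel is `Ext¹(A, B)`. -/
def extDifferential (A B : QuiverRep k V) :
    (∀ x, A.space x →ₗ[k] B.space x) →ₗ[k]
      (∀ x y : V, (x ⟶ y) → (A.space x →ₗ[k] B.space y)) where
  toFun h := fun x y a => B.map a ∘ₗ h x - h y ∘ₗ A.map a
  map_add' h h' := by
    funext x y a
    ext m
    simp only [Pi.add_apply, LinearMap.sub_apply, LinearMap.comp_apply, LinearMap.add_apply,
      map_add]
    abel
  map_smul' c h := by
    funext x y a
    ext m
    simp [smul_sub]

/-- The vector space `Ext¹(A, B)` of extensions `0 → B → E → A → 0`. -/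
abbrev Ext (A B : QuiverRep k V) : Type (max u v w) :=
  (∀ x y : V, (x ⟶ y) → (A.space x →ₗ[k] B.space y)) ⧸ LinearMap.range (extDifferential A B)

/-- `ξ ∈ Ext¹(A, B)` is the class of the short exact sequence `0 → B → E → A → 0`: for linear
sections `s x` of `g` at the vertices, it is represented by the family of the maps
`f⁻¹ ∘ (E_a ∘ s x - s y ∘ A_a)`, where `a : x → y` runs over the arrows. -/
def IsExtClass {A B E : QuiverRep k V} (f : Hom B E) (g : Hom E A) (ξ : Ext A B) : Prop :=
  ShortExact f g ∧
    ∃ (s : ∀ x, A.space x →ₗ[k] E.space x)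
      (c : ∀ x y : V, (x ⟶ y) → (A.space x →ₗ[k] B.space y)),
      (∀ x, g.app x ∘ₗ s x = LinearMap.id) ∧
      (∀ (x y : V) (a : x ⟶ y), f.app y ∘ₗ c x y a = E.map a ∘ₗ s x - s y ∘ₗ A.map a) ∧
      ξ = Submodule.Quotient.mk c

/-- `T` is basic and, for all indecomposable summands `A, B` of `T`, either `Ext(A, B) = 0`, or
`Ext(A, B)` is one-dimensional and generated by a short exact sequence `0 → B → E → A → 0` whose
middle term `E` is indecomposable. -/
def AlmostRigid (T : QuiverRep k V) : Prop :=
  T.Basic ∧ ∀ A B : QuiverRep k V, A.IsIndecSummand T → B.IsIndecSummand T →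
    Subsingleton (Ext A B) ∨
      (Module.finrank k (Ext A B) = 1 ∧
        ∃ (E : QuiverRep k V) (f : Hom B E) (g : Hom E A) (ξ : Ext A B),
          IsExtClass f g ξ ∧ Submodule.span k {ξ} = ⊤ ∧ E.Indecomposable)

/-- `T` is almost rigid and `T ⊕ M` is not almost rigid for any nonzero `M`. -/
def MaximalAlmostRigid (T : QuiverRep k V) : Prop :=
  T.AlmostRigid ∧ ∀ M : QuiverRep k V, ¬ M.IsZero → ¬ (T.sum M).AlmostRigid

/-- `M` is an extension of `N`: there is a non-split short exact sequence `0 → N₁ → M → N₂ → 0`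
with `N ≅ N₁ ⊕ N₂`. -/
def IsExtensionOf (M N : QuiverRep k V) : Prop :=
  ∃ (N₁ N₂ : QuiverRep k V) (f : Hom N₁ M) (g : Hom M N₂),
    N.Isomorphic (N₁.sum N₂) ∧ ShortExact f g ∧ ¬ Splits g

/-- The representation with the vector spaces of `M` and with the linear maps `w`. -/
def withMaps (M : QuiverRep k V) (w : ∀ x y : V, (x ⟶ y) → (M.space x →ₗ[k] M.space y)) :
    QuiverRep k V where
  space := M.space
  map {x y} a := w x y a

/-- `M` is a degeneration of `N`: in the affine space `∏_{a : x → y} Hom(Mₓ, M_y)` of all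
representations on the vector spaces of `M`, the point `M` lies in the Zariski closure of the set
of those isomorphic to `N`, i.e. every polynomial function that vanishes on this set vanishes
at `M`. A polynomial function is a polynomial in linear forms. -/
def IsDegenerationOf (M N : QuiverRep k V) : Prop :=
  ∀ p : MvPolynomial
      (Module.Dual k (∀ x y : V, (x ⟶ y) → (M.space x →ₗ[k] M.space y))) k,
    (∀ w : ∀ x y : V, (x ⟶ y) → (M.space x →ₗ[k] M.space y),
      (M.withMaps w).Isomorphic N → MvPolynomial.eval (fun φ => φ w) p = 0) →
    MvPolynomial.eval (fun φ => φ (fun _ _ a => M.map a)) p = 0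

end QuiverRep

/-! ## Quivers of type `A` -/

/-- A quiver of type `A_{n+2}`. Its vertices `1, …, n+2` are the elements `0, …, n+1` of
`Fin (n + 2)` (the label of `v` is `v + 1`), and the labels `ℓ ∈ [n+1]` of its arrows are the
elements of `Fin (n + 1)` in the same way. The arrow `α_ℓ` points from `ℓ` to `ℓ + 1` if
`forward ℓ` holds, and from `ℓ + 1` to `ℓ` otherwise. -/
structure TypeAQuiver (n : ℕ) where
  forward : Fin (n + 1) → Bool

namespace TypeAQuiver

variable {n : ℕ}

/-- The vertices of `Q`. -/
def Vertex (_Q : TypeAQuiver n) : Type := Fin (n + 2)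

/-- The arrows of `Q`. -/
inductive Arrow (Q : TypeAQuiver n) : Fin (n + 2) → Fin (n + 2) → Type
  | right (l : Fin (n + 1)) (h : Q.forward l = true) : Arrow Q l.castSucc l.succ
  | left (l : Fin (n + 1)) (h : Q.forward l = false) : Arrow Q l.succ l.castSucc

/-- The index `ℓ` of the arrow `α_ℓ`. -/
def Arrow.index {Q : TypeAQuiver n} : {x y : Fin (n + 2)} → Arrow Q x y → Fin (n + 1)
  | _, _, .right l _ => l
  | _, _, .left l _ => l

instance (Q : TypeAQuiver n) : Quiver Q.Vertex where
  Hom x y := Arrow Q x y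

/-- The index `ℓ` of the arrow `α_ℓ`. -/
def arrowIndex (Q : TypeAQuiver n) {x y : Q.Vertex} (a : x ⟶ y) : Fin (n + 1) := Arrow.index a

/-- The upper-barred elements of `[n+1]`. -/
def upper (Q : TypeAQuiver n) : Finset (Fin (n + 1)) :=
  Finset.univ.filter fun l => Q.forward l = true

/-- The lower-barred elements of `[n+1]`. -/
def lower (Q : TypeAQuiver n) : Finset (Fin (n + 1)) :=
  Finset.univ.filter fun l => Q.forward l = false

/-! ### The polygon `P(Q)` and the map `η_Q` -/

/-- The vertex `ℓ` of `P(Q)` belonging to `ℓ ∈ [n+1]`. The vertices `0, 1, …, n+2` of `P(Q)` are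
the elements of `Fin (n + 3)`. -/
def polygonVertex (l : Fin (n + 1)) : Fin (n + 3) := l.succ.castSucc

/-- The line segments `γ(i, j)`, `0 ≤ i < j ≤ n + 2`. -/
abbrev Segment (n : ℕ) : Type := {p : Fin (n + 3) × Fin (n + 3) // p.1 < p.2}

/-- A way to draw the convex `(n+3)`-gon `P(Q)` in the plane: the vertices `0, …, n+2` go from left
to right, `0` and `n+2` lie on one horizontal line, the upper-barred vertices lie above it and the
lower-barred ones below it. -/
structure Polygon (Q : TypeAQuiver n) where
  pt : Fin (n + 3) → ℝ × ℝ
  left_to_right : StrictMono fun i => (pt i).1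
  horizontal : (pt 0).2 = (pt (Fin.last (n + 2))).2
  above : ∀ l ∈ Q.upper, (pt 0).2 < (pt (polygonVertex l)).2
  below : ∀ l ∈ Q.lower, (pt (polygonVertex l)).2 < (pt 0).2
  convex : ConvexIndependent ℝ pt

/-- Two line segments do not cross, i.e. they have no common interior point. -/
def Polygon.NonCrossing {Q : TypeAQuiver n} (P : Q.Polygon) (γ δ : Segment n) : Prop :=
  Disjoint (openSegment ℝ (P.pt γ.1.1) (P.pt γ.1.2)) (openSegment ℝ (P.pt δ.1.1) (P.pt δ.1.2))

/-- A triangulation (including the boundary edges) is a maximal set of line segments that pairwise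
do not cross. -/
def Polygon.IsTriangulation {Q : TypeAQuiver n} (P : Q.Polygon) (T : Set (Segment n)) : Prop :=
  Maximal (fun S : Set (Segment n) => S.Pairwise P.NonCrossing) T

/-- The elements of `[n+1]` that the path `λ_i(π)` passes through, `0 ≤ i ≤ n+1`: at first the
lower-barred ones; then, in step `i + 1`, the entry `π_{i+1}` is added if it is upper-barred and
deleted if it is lower-barred. -/
def pathSupport (Q : TypeAQuiver n) (π : Equiv.Perm (Fin (n + 1))) :
    Fin (n + 2) → Finset (Fin (n + 1)) :=
  Fin.induction Q.lower fun i S => if π i ∈ Q.upper then insert (π i) S else S.erase (π i)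

/-- The vertices of `P(Q)` on the path `λ_i(π)` from `0` to `n+2`. -/
def pathVertices (Q : TypeAQuiver n) (π : Equiv.Perm (Fin (n + 1))) (i : Fin (n + 2)) :
    Finset (Fin (n + 3)) :=
  {0, Fin.last (n + 2)} ∪ (Q.pathSupport π i).image polygonVertex

/-- The line segments of the path `λ_i(π)`: they join consecutive vertices of the path. -/
def path (Q : TypeAQuiver n) (π : Equiv.Perm (Fin (n + 1))) (i : Fin (n + 2)) :
    Finset (Segment n) :=
  Finset.univ.filter fun γ =>
    γ.1.1 ∈ Q.pathVertices π i ∧ γ.1.2 ∈ Q.pathVertices π i ∧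
      ∀ c ∈ Q.pathVertices π i, ¬ (γ.1.1 < c ∧ c < γ.1.2)

/-- `η_Q(π)`, the union of the paths `λ_0(π), …, λ_{n+1}(π)`. -/
def eta (Q : TypeAQuiver n) (π : Equiv.Perm (Fin (n + 1))) : Finset (Segment n) :=
  Finset.univ.biUnion (Q.path π)

/-! ### The representations of `Q` -/

section Representations

variable (k : Type u) [Field k]

/-- The subspace `k` of `k` if `p` holds, and `0` otherwise. -/
def lineIf (p : Prop) : Submodule k k where
  carrier := {c | ¬ p → c = 0}
  add_mem' ha hb hp := by rw [ha hp, hb hp, add_zero]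
  zero_mem' _ := rfl
  smul_mem' c x hx hp := by rw [hx hp, smul_zero]

/-- The map `lineIf p → lineIf q` that is the identity if `p` and `q` hold, and `0` otherwise. -/
def lineMap (p q : Prop) [Decidable p] [Decidable q] : lineIf k p →ₗ[k] lineIf k q where
  toFun c := ⟨if p ∧ q then (c : k) else 0, fun hq => if_neg fun h => hq h.2⟩
  map_add' c d := by
    ext
    by_cases h : p ∧ q <;> simp [h]
  map_smul' r c := by
    ext
    by_cases h : p ∧ q <;> simp [h]

/-- The vertex of `Q` has a label in `{i, …, j}`; the label of `v : Fin (n + 2)` is `v + 1`. -/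
abbrev Between (Q : TypeAQuiver n) (i j : ℕ) (x : Q.Vertex) : Prop :=
  i ≤ Fin.val (n := n + 2) x + 1 ∧ Fin.val (n := n + 2) x + 1 ≤ j

/-- The representation `M(i, j)`, `1 ≤ i ≤ j ≤ n + 2`. -/
def M (Q : TypeAQuiver n) (i j : ℕ) : QuiverRep k Q.Vertex where
  space x := lineIf k (Q.Between i j x)
  map {x y} _ := lineMap k (Q.Between i j x) (Q.Between i j y)

/-- `F` on line segments: `F(γ(i, j)) = M(i + 1, j)`. -/
def F (Q : TypeAQuiver n) (γ : Segment n) : QuiverRep k Q.Vertex :=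
  M k Q (γ.1.1 + 1) γ.1.2

/-- `F` on sets of line segments: the direct sum of the `F(γ)`. -/
def FSet (Q : TypeAQuiver n) (T : Finset (Segment n)) : QuiverRep k Q.Vertex :=
  QuiverRep.directSum fun γ : T => F k Q γ

/-- `η_Q^rep = F ∘ η_Q`. -/
def etaRep (Q : TypeAQuiver n) (π : Equiv.Perm (Fin (n + 1))) : QuiverRep k Q.Vertex :=
  FSet k Q (Q.eta π)

/-- The representation with dimension vector `(1, …, 1)`, the identity map on the arrows `α_ℓ` with
`ℓ ∈ S`, and the zero map on all other arrows. -/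
def thinRep (Q : TypeAQuiver n) (S : Finset (Fin (n + 1))) : QuiverRep k Q.Vertex where
  space _ := k
  map a := if Q.arrowIndex a ∈ S then LinearMap.id else 0

/-- The `ℓ` for which `λ_i^rep(π)` has the identity map on `α_ℓ`: at first the `ℓ` that are not
lower-barred; then, in step `i + 1`, the map on the arrow of index `π_{i+1}` is replaced by the
zero map if `π_{i+1}` is upper-barred, and by the identity map if it is lower-barred. -/
def identityArrows (Q : TypeAQuiver n) (π : Equiv.Perm (Fin (n + 1))) :
    Fin (n + 2) → Finset (Fin (n + 1)) :=
  Fin.induction (Q.lower)ᶜ fun i S => if π i ∈ Q.upper then S.erase (π i) else insert (π i) S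

/-- The representation `λ_i^rep(π)`, `0 ≤ i ≤ n + 1`. -/
def lambdaRep (Q : TypeAQuiver n) (π : Equiv.Perm (Fin (n + 1))) (i : Fin (n + 2)) :
    QuiverRep k Q.Vertex :=
  thinRep k Q (Q.identityArrows π i)

end Representations

end TypeAQuiver

namespace QuiverRep

section General

variable {k : Type u} [Field k] {V : Type v} [Quiver.{w} V]

/-! ## Isomorphisms, direct sums and retracts -/

/-! All three statements reduce to one combinatorial relation on segments, `CrossUp γ δ`: they
cross, and `γ` is below `δ` to the left of the crossing point. It involves only the order of the end
points and which vertices are upper or lower.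

Geometry: over the x-range that two segments share, their heights are affine functions, and
convexity of the polygon places every upper (lower) vertex strictly above (below) each segment
passing over its x-coordinate. So two distinct segments meet in an interior point exactly when the
difference of heights changes sign, which is `CrossUp` in one of the two directions
(`not_nonCrossing_of_crossUp`, `nonCrossing_of_not_crossUp`).

Algebra: the condition on `Ext(F γ, F δ)` in the definition of almost rigidity fails exactly when
`CrossUp γ δ` holds. A cocycle on a type `A` quiver is the difference of a potential, and one
additive constant is free, so an obstruction survives only if both ends of the overlap impose a
boundary condition. If the supports overlap, the middle term of an extension has dimension 2 at a
common vertex and cannot be indecomposable; if they are adjacent, `Ext` is a line generated by an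
extension whose middle term is the merged interval (`extCompatible_of_not_crossUp`,
`not_extCompatible_of_crossUp`).

Combinatorics: each vertex changes status once, upper ones entering the path and lower ones leaving
it, so the paths sweep the polygon upwards and their segments never cross
(`not_crossUp_of_mem_eta`). Conversely, a segment on none of the paths is crossed by some path,
namely one that has already passed above it in one place while still below it in another
(`mem_eta_of_not_crossUp`). These two facts give both the triangulation and the maximal almost rigid
representation.

The passage between representations and sets of segments is the classification in type `A` together
with uniqueness of decompositions. Existence of interval summands comes from a sweep along the
quiver that keeps a basis of strings (`exists_M_isRetract`); uniqueness comes from the scalars by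
which morphisms act at a vertex. A thin representation breaks at the arrows that carry zero, and
these are the vertices of the path, so `lambdaRep` is the sum of `F γ` over the path
(`lambdaRep_isomorphic`). Adding an upper vertex scales an arrow to zero along a line of isomorphic
representations; deleting a lower vertex glues the subrepresentation to the left of the arrow to the
quotient on its right. -/

theorem Hom.comm_apply {M N : QuiverRep k V} (f : Hom M N) {x y : V} (a : x ⟶ y)
    (m : M.space x) : N.map a (f.app x m) = f.app y (M.map a m) :=
  LinearMap.congr_fun (f.comm a) m

/-- The composite of two morphisms. -/
def Hom.comp {M N L : QuiverRep k V} (g : Hom N L) (f : Hom M N) : Hom M L where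
  app x := g.app x ∘ₗ f.app x
  comm a := by
    ext m
    simp [Hom.comm_apply]

@[simp] theorem Hom.comp_app {M N L : QuiverRep k V} (g : Hom N L) (f : Hom M N) (x : V)
    (m : M.space x) : (g.comp f).app x m = g.app x (f.app x m) := rfl

/-- The morphism underlying an isomorphism. -/
def Iso.hom {M N : QuiverRep k V} (e : Iso M N) : Hom M N where
  app x := (e.app x).toLinearMap
  comm a := by
    ext m
    exact e.comm a m

@[simp] theorem Iso.hom_app {M N : QuiverRep k V} (e : Iso M N) (x : V) (m : M.space x) :
    e.hom.app x m = e.app x m := rfl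

/-- The inverse isomorphism. -/
def Iso.symm {M N : QuiverRep k V} (e : Iso M N) : Iso N M where
  app x := (e.app x).symm
  comm {x y} a m := by
    rw [LinearEquiv.eq_symm_apply, ← e.comm, LinearEquiv.apply_symm_apply]

@[simp] theorem Iso.symm_app {M N : QuiverRep k V} (e : Iso M N) (x : V) (n : N.space x) :
    e.symm.app x n = (e.app x).symm n := rfl

/-- The composite of two isomorphisms. -/
def Iso.trans {M N L : QuiverRep k V} (e : Iso M N) (e' : Iso N L) : Iso M L where
  app x := (e.app x).trans (e'.app x)
  comm a m := by simp [e.comm, e'.comm]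

/-- A morphism that is bijective at every vertex is an isomorphism. -/
noncomputable def Iso.ofBijective {M N : QuiverRep k V} (f : Hom M N)
    (h : ∀ x, Function.Bijective (f.app x)) : Iso M N where
  app x := LinearEquiv.ofBijective (f.app x) (h x)
  comm a m := f.comm_apply a m

theorem Isomorphic.refl (M : QuiverRep k V) : M.Isomorphic M :=
  ⟨⟨fun _ => LinearEquiv.refl k _, fun _ _ => rfl⟩⟩

theorem Isomorphic.symm {M N : QuiverRep k V} (h : M.Isomorphic N) : N.Isomorphic M :=
  h.map Iso.symm

theorem Isomorphic.trans {M N L : QuiverRep k V} (h : M.Isomorphic N) (h' : N.Isomorphic L) :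
    M.Isomorphic L :=
  ⟨h.some.trans h'.some⟩

theorem Isomorphic.sum {M N M' N' : QuiverRep k V} (h : M.Isomorphic M') (h' : N.Isomorphic N') :
    (M.sum N).Isomorphic (M'.sum N') := by
  obtain ⟨e⟩ := h
  obtain ⟨e'⟩ := h'
  exact ⟨⟨fun x => (e.app x).prodCongr (e'.app x),
    fun a m => Prod.ext (e.comm a m.1) (e'.comm a m.2)⟩⟩

theorem Isomorphic.isZero {M N : QuiverRep k V} (h : M.Isomorphic N) (hM : M.IsZero) :
    N.IsZero := by
  obtain ⟨e⟩ := h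
  intro x
  have := hM x
  exact (e.app x).symm.injective.subsingleton

theorem Isomorphic.indecomposable {M N : QuiverRep k V} (h : M.Isomorphic N)
    (hM : M.Indecomposable) : N.Indecomposable :=
  ⟨fun hN => hM.1 (h.symm.isZero hN), fun A B hAB => hM.2 A B (h.trans hAB)⟩

/-- The first inclusion into a direct sum. -/
def inl (M N : QuiverRep k V) : Hom M (M.sum N) where
  app x := LinearMap.inl k (M.space x) (N.space x)
  comm {x y} a := by
    apply LinearMap.ext
    intro m
    exact Prod.ext rfl (map_zero (N.map a))

/-- The second inclusion into a direct sum. -/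
def inr (M N : QuiverRep k V) : Hom N (M.sum N) where
  app x := LinearMap.inr k (M.space x) (N.space x)
  comm {x y} a := by
    apply LinearMap.ext
    intro m
    exact Prod.ext (map_zero (M.map a)) rfl

/-- The first projection from a direct sum. -/
def fst (M N : QuiverRep k V) : Hom (M.sum N) M where
  app x := LinearMap.fst k (M.space x) (N.space x)
  comm _ := rfl

/-- The second projection from a direct sum. -/
def snd (M N : QuiverRep k V) : Hom (M.sum N) N where
  app x := LinearMap.snd k (M.space x) (N.space x)
  comm _ := rfl

@[simp] theorem fst_app_inl (M N : QuiverRep k V) (x : V) (m : M.space x) :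
    (fst M N).app x ((inl M N).app x m) = m := rfl

@[simp] theorem snd_app_inl (M N : QuiverRep k V) (x : V) (m : M.space x) :
    (snd M N).app x ((inl M N).app x m) = 0 := rfl

@[simp] theorem fst_app_inr (M N : QuiverRep k V) (x : V) (m : N.space x) :
    (fst M N).app x ((inr M N).app x m) = 0 := rfl

@[simp] theorem snd_app_inr (M N : QuiverRep k V) (x : V) (m : N.space x) :
    (snd M N).app x ((inr M N).app x m) = m := rfl

/-- `X` is a retract of `M`. -/
def IsRetract (X M : QuiverRep k V) : Prop :=
  ∃ (f : Hom X M) (g : Hom M X), ∀ x m, g.app x (f.app x m) = m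

/-- The kernel of a morphism. -/
def ker {M X : QuiverRep k V} (g : Hom M X) : QuiverRep k V where
  space x := LinearMap.ker (g.app x)
  map {x y} a := (M.map a).restrict fun m hm => by
    rw [LinearMap.mem_ker] at hm ⊢
    rw [← g.comm_apply, hm, map_zero]

/-- The idempotent `f ∘ g` splits `M`: the map `m ↦ (g m, m - f (g m))` is bijective onto `X ⊕ ker
g`. -/
theorem IsRetract.isSummand {X M : QuiverRep k V} (h : X.IsRetract M) : X.IsSummand M := by
  obtain ⟨f, g, h⟩ := h
  have hr : ∀ x m, m - f.app x (g.app x m) ∈ LinearMap.ker (g.app x) := fun x m => by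
    simp [h]
  refine ⟨ker g, ⟨Iso.ofBijective (N := X.sum (ker g)) ⟨fun x => (g.app x).prod
    ((LinearMap.id - f.app x ∘ₗ g.app x).codRestrict _ (hr x)), fun {x y} a => ?_⟩
    fun x => ⟨?_, ?_⟩⟩⟩
  · apply LinearMap.ext
    intro m
    refine Prod.ext (g.comm_apply a m) (Subtype.ext ?_)
    change M.map a (m - f.app x (g.app x m)) = M.map a m - f.app y (g.app y (M.map a m))
    rw [map_sub, f.comm_apply, g.comm_apply]
  · intro m m' e
    have e1 : g.app x m = g.app x m' := congrArg Prod.fst e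
    have e2 : m - f.app x (g.app x m) = m' - f.app x (g.app x m') :=
      congrArg Subtype.val (congrArg Prod.snd e)
    rw [e1] at e2
    exact sub_left_injective e2
  · intro p
    obtain ⟨m, n, hn⟩ : ∃ (m : X.space x) (n : M.space x) (hn : n ∈ LinearMap.ker (g.app x)),
        p = (m, ⟨n, hn⟩) := ⟨p.1, p.2.1, p.2.2, rfl⟩
    obtain ⟨hn, rfl⟩ := hn
    have hn' := LinearMap.mem_ker.1 hn
    refine ⟨f.app x m + n, Prod.ext ?_ (Subtype.ext ?_)⟩
    · change g.app x (f.app x m + n) = m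
      simp [h, hn']
    · change f.app x m + n - f.app x (g.app x (f.app x m + n)) = n
      simp [h, hn']

theorem isRetract_sum_left (M N : QuiverRep k V) : M.IsRetract (M.sum N) :=
  ⟨inl M N, fst M N, fun _ _ => rfl⟩

theorem isRetract_sum_right (M N : QuiverRep k V) : N.IsRetract (M.sum N) :=
  ⟨inr M N, snd M N, fun _ _ => rfl⟩

theorem IsRetract.sum {X Y M N : QuiverRep k V} (h : X.IsRetract M) (h' : Y.IsRetract N) :
    (X.sum Y).IsRetract (M.sum N) := by
  obtain ⟨f, g, h⟩ := h
  obtain ⟨f', g', h'⟩ := h'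
  exact ⟨⟨fun x => (f.app x).prodMap (f'.app x), fun a => LinearMap.ext fun m =>
      Prod.ext (f.comm_apply a m.1) (f'.comm_apply a m.2)⟩,
    ⟨fun x => (g.app x).prodMap (g'.app x), fun a => LinearMap.ext fun m =>
      Prod.ext (g.comm_apply a m.1) (g'.comm_apply a m.2)⟩,
    fun x m => Prod.ext (h x m.1) (h' x m.2)⟩

theorem IsRetract.trans {X M N : QuiverRep k V} (h : X.IsRetract M) (h' : M.IsRetract N) :
    X.IsRetract N := by
  obtain ⟨f, g, h⟩ := h
  obtain ⟨f', g', h'⟩ := h'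
  exact ⟨f'.comp f, g.comp g', fun x m => by simp [h, h']⟩

theorem Isomorphic.isRetract {M N : QuiverRep k V} (h : M.Isomorphic N) : M.IsRetract N := by
  obtain ⟨e⟩ := h
  exact ⟨e.hom, e.symm.hom, fun x m => by simp⟩

/-- Retracts compose and transport along isomorphisms without naming a complement, so summands are
handled as retracts below. -/
theorem isSummand_iff_isRetract {X M : QuiverRep k V} : X.IsSummand M ↔ X.IsRetract M := by
  refine ⟨?_, IsRetract.isSummand⟩
  rintro ⟨Y, h⟩
  exact (isRetract_sum_left X Y).trans h.symm.isRetract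

theorem isomorphic_sum_of_isZero {M N : QuiverRep k V} (hN : N.IsZero) :
    M.Isomorphic (M.sum N) := by
  refine ⟨Iso.ofBijective (inl M N) fun x => ⟨LinearMap.inl_injective, ?_⟩⟩
  rintro ⟨m, n⟩
  have := hN x
  exact ⟨m, Prod.ext rfl (Subsingleton.elim _ _)⟩

/-- A nonzero retract of an indecomposable representation is isomorphic to it. -/
theorem IsRetract.isomorphic {X M : QuiverRep k V} (h : X.IsRetract M) (hX : ¬ X.IsZero)
    (hM : M.Indecomposable) : X.Isomorphic M := by
  obtain ⟨Y, hY⟩ := h.isSummand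
  rcases hM.2 X Y hY with h | h
  · exact absurd h hX
  · exact (isomorphic_sum_of_isZero h).trans hY.symm

theorem Basic.of_isRetract {M N : QuiverRep k V} (h : N.IsRetract M) (hM : M.Basic) : N.Basic :=
  fun X hX hXN => hM X hX
    (isSummand_iff_isRetract.2 ((isSummand_iff_isRetract.1 hXN).trans h))

theorem IsIndecSummand.of_isRetract {X M N : QuiverRep k V} (hX : X.IsIndecSummand N)
    (h : N.IsRetract M) : X.IsIndecSummand M :=
  ⟨hX.1, isSummand_iff_isRetract.2 ((isSummand_iff_isRetract.1 hX.2).trans h)⟩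

/-! ### Finite direct sums -/

section DirectSum

variable {ι : Type} [Finite ι]

open Classical in
/-- The inclusion of a summand of a direct sum. -/
noncomputable def directSumIncl (M : ι → QuiverRep k V) (i : ι) : Hom (M i) (directSum M) where
  app x := LinearMap.single k (fun i => (M i).space x) i
  comm {x y} a := by
    apply LinearMap.ext
    intro m
    funext j
    change (M j).map a (Pi.single (M := fun i => (M i).space x) i m j) =
      Pi.single (M := fun i => (M i).space y) i ((M i).map a m) j
    by_cases h : j = i
    · subst h
      simp
    · simp [h]

/-- The projection to a summand of a direct sum. -/
def directSumProj (M : ι → QuiverRep k V) (i : ι) : Hom (directSum M) (M i) where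
  app _ := LinearMap.proj i
  comm _ := rfl

theorem isRetract_directSum (M : ι → QuiverRep k V) (i : ι) : (M i).IsRetract (directSum M) := by
  refine ⟨directSumIncl M i, directSumProj M i, fun x m => ?_⟩
  classical
  exact Pi.single_eq_same (M := fun i => (M i).space x) i m

theorem sum_directSumIncl_proj [Fintype ι] (M : ι → QuiverRep k V) (x : V)
    (m : (directSum M).space x) :
    ∑ i, (directSumIncl M i).app x ((directSumProj M i).app x m) = m := by
  classical
  exact Finset.univ_sum_single (M := fun i => (M i).space x) m

theorem isZero_directSum_of_isEmpty [IsEmpty ι] (M : ι → QuiverRep k V) : (directSum M).IsZero :=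
  fun x => inferInstanceAs (Subsingleton (∀ i, (M i).space x))

/-- A direct sum over `Option ι` splits off the summand at `none`. -/
theorem isomorphic_directSum_option (M : Option ι → QuiverRep k V) :
    (directSum M).Isomorphic ((M none).sum (directSum fun i => M (some i))) := by
  refine ⟨Iso.ofBijective ⟨fun x => (LinearMap.proj none).prod
    (LinearMap.pi fun i => LinearMap.proj (some i)), fun _ => rfl⟩ fun x => ⟨?_, ?_⟩⟩
  · intro m m' h
    funext i
    rcases i with _ | i
    · exact congrArg Prod.fst h
    · exact congrFun (congrArg Prod.snd h) i
  · rintro ⟨m, n⟩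
    exact ⟨fun i => Option.rec m n i, rfl⟩

theorem directSum_isomorphic_of_equiv {κ : Type} [Finite κ] (e : ι ≃ κ) (M : ι → QuiverRep k V)
    (N : κ → QuiverRep k V) (h : ∀ i, M i = N (e i)) :
    (directSum M).Isomorphic (directSum N) := by
  obtain rfl : M = fun i => N (e i) := funext h
  refine Isomorphic.symm ⟨Iso.ofBijective ⟨fun x => LinearMap.pi fun i => LinearMap.proj (e i),
    fun _ => rfl⟩ fun x => ⟨?_, ?_⟩⟩
  · intro m m' h
    funext j
    obtain ⟨i, rfl⟩ := e.surjective j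
    exact congrFun h i
  · intro m
    exact ⟨Equiv.piCongrLeft (fun j => (N j).space x) e m,
      funext fun i => Equiv.piCongrLeft_apply_apply (fun j => (N j).space x) e m i⟩

end DirectSum

end General

end QuiverRep

namespace TypeAQuiver

open QuiverRep

variable {n : ℕ}

/-! ## Vertices and arrows -/

/-- The vertex `ℓ`, the left end of the arrow `α_ℓ`. -/
def before (Q : TypeAQuiver n) (l : Fin (n + 1)) : Q.Vertex := l.castSucc

/-- The vertex `ℓ + 1`, the right end of the arrow `α_ℓ`. -/
def after (Q : TypeAQuiver n) (l : Fin (n + 1)) : Q.Vertex := l.succ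

/-- The arrow `α_ℓ` if it points to the right. -/
def rightArrow (Q : TypeAQuiver n) (l : Fin (n + 1)) (h : Q.forward l = true) :
    Q.before l ⟶ Q.after l :=
  Arrow.right l h

/-- The arrow `α_ℓ` if it points to the left. -/
def leftArrow (Q : TypeAQuiver n) (l : Fin (n + 1)) (h : Q.forward l = false) :
    Q.after l ⟶ Q.before l :=
  Arrow.left l h

variable {Q : TypeAQuiver n}

/-- The motive ranges over the end points as well, since the end points of an arrow are determined
by its index and cannot be held fixed in a case split. -/
theorem arrow_cases {P : ∀ x y : Q.Vertex, (x ⟶ y) → Prop}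
    (right : ∀ l h, P _ _ (Q.rightArrow l h)) (left : ∀ l h, P _ _ (Q.leftArrow l h))
    (x y : Q.Vertex) (a : x ⟶ y) : P x y a := by
  change Arrow Q x y at a
  cases a with
  | right l h => exact right l h
  | left l h => exact left l h

@[simp] theorem arrowIndex_rightArrow (l : Fin (n + 1)) (h : Q.forward l = true) :
    Q.arrowIndex (Q.rightArrow l h) = l := rfl

@[simp] theorem arrowIndex_leftArrow (l : Fin (n + 1)) (h : Q.forward l = false) :
    Q.arrowIndex (Q.leftArrow l h) = l := rfl

theorem between_before {i j : ℕ} {l : Fin (n + 1)} :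
    Q.Between i j (Q.before l) ↔ i ≤ l.val + 1 ∧ l.val + 1 ≤ j := Iff.rfl

theorem between_after {i j : ℕ} {l : Fin (n + 1)} :
    Q.Between i j (Q.after l) ↔ i ≤ l.val + 2 ∧ l.val + 2 ≤ j := Iff.rfl

/-- The vertex with the label `m + 1`. -/
def vertex (Q : TypeAQuiver n) (m : ℕ) (hm : m < n + 2) : Q.Vertex := (⟨m, hm⟩ : Fin (n + 2))

theorem between_vertex {i j m : ℕ} {hm : m < n + 2} :
    Q.Between i j (Q.vertex m hm) ↔ i ≤ m + 1 ∧ m + 1 ≤ j := Iff.rfl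

/-- The position of a vertex, its label minus `1`. -/
def pos (x : Q.Vertex) : ℕ := Fin.val (n := n + 2) x

@[simp] theorem pos_before (l : Fin (n + 1)) : pos (Q.before l) = l.val := rfl

@[simp] theorem pos_after (l : Fin (n + 1)) : pos (Q.after l) = l.val + 1 := rfl

@[simp] theorem pos_vertex {m : ℕ} (hm : m < n + 2) : pos (Q.vertex m hm) = m := rfl

theorem pos_lt (x : Q.Vertex) : pos x < n + 2 := Fin.isLt (n := n + 2) x

theorem pos_injective {x y : Q.Vertex} (h : pos x = pos y) : x = y := Fin.ext (n := n + 2) h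

theorem between_iff {i j : ℕ} {x : Q.Vertex} :
    Q.Between i j x ↔ i ≤ pos x + 1 ∧ pos x + 1 ≤ j := Iff.rfl

theorem exists_eq_vertex (x : Q.Vertex) : ∃ m hm, x = Q.vertex m hm :=
  ⟨Fin.val (n := n + 2) x, Fin.isLt (n := n + 2) x, rfl⟩

/-- A property that adjacent vertices of an interval share is constant on the interval. -/
theorem between_induction {i j : ℕ} {P : Q.Vertex → Prop}
    (h : ∀ l, Q.Between i j (Q.before l) → Q.Between i j (Q.after l) →
      (P (Q.before l) ↔ P (Q.after l)))
    {x y : Q.Vertex} (hx : Q.Between i j x) (hy : Q.Between i j y) (hP : P x) : P y := by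
  -- Induction on the distance `d` between the two positions.
  have key : ∀ d m (hm : m + d < n + 2), i ≤ m + 1 → m + d + 1 ≤ j →
      (P (Q.vertex m (by omega)) ↔ P (Q.vertex (m + d) hm)) := by
    intro d
    induction d with
    | zero => intros; rfl
    | succ d ih =>
      intro m hm h1 h2
      rw [ih m (by omega) h1 (by omega)]
      exact h ⟨m + d, by omega⟩ (between_before.2 ⟨by simp; omega, by simp; omega⟩)
        (between_after.2 ⟨by simp; omega, by simp; omega⟩)
  obtain ⟨m, hm, rfl⟩ := exists_eq_vertex x
  obtain ⟨m', hm', rfl⟩ := exists_eq_vertex y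
  rw [between_vertex] at hx hy
  rcases le_total m m' with h | h
  · obtain ⟨d, rfl⟩ := Nat.exists_eq_add_of_le h
    exact (key d m hm' hx.1 hy.2).1 hP
  · obtain ⟨d, rfl⟩ := Nat.exists_eq_add_of_le h
    exact (key d m' hm hy.1 hx.2).2 hP

/-! ## The representations `M(i, j)` -/

variable {k : Type u} [Field k]

/-- The inclusion of `M(i, j)` into `k` at a vertex. -/
def val {i j : ℕ} {x : Q.Vertex} : (M k Q i j).space x →ₗ[k] k :=
  (lineIf k (Q.Between i j x)).subtype

/-- The element `1` of `M(i, j)` at a vertex in `{i, …, j}`. -/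
def gen (i j : ℕ) (x : Q.Vertex) : (M k Q i j).space x :=
  (⟨if Q.Between i j x then 1 else 0, fun h => if_neg h⟩ : lineIf k (Q.Between i j x))

section Interval

variable {i j a b : ℕ}

theorem val_gen {x : Q.Vertex} (h : Q.Between i j x) : val (gen (k := k) i j x) = 1 := if_pos h

theorem val_eq_zero {x : Q.Vertex} (c : (M k Q i j).space x) (h : ¬ Q.Between i j x) :
    val c = 0 :=
  c.2 h

theorem val_injective {x : Q.Vertex} {c d : (M k Q i j).space x} (h : val c = val d) : c = d :=
  Subtype.ext h

theorem eq_zero_of_not {x : Q.Vertex} (c : (M k Q i j).space x) (h : ¬ Q.Between i j x) : c = 0 :=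
  val_injective (by rw [val_eq_zero c h, map_zero])

theorem val_smul_gen {x : Q.Vertex} (c : (M k Q i j).space x) : val c • gen i j x = c := by
  apply val_injective
  by_cases h : Q.Between i j x
  · simp [val_gen h]
  · simp [val_eq_zero _ h]

theorem val_map {x y : Q.Vertex} (α : x ⟶ y) (c : (M k Q i j).space x) :
    val ((M k Q i j).map α c) = if Q.Between i j x ∧ Q.Between i j y then val c else 0 :=
  rfl

theorem map_gen {x y : Q.Vertex} (α : x ⟶ y) (h : Q.Between i j x) :
    (M k Q i j).map α (gen i j x) = gen i j y := by
  apply val_injective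
  rw [val_map, val_gen h]
  by_cases hy : Q.Between i j y
  · rw [if_pos ⟨h, hy⟩, val_gen hy]
  · rw [if_neg fun h => hy h.2, val_eq_zero _ hy]

theorem M_not_isZero {x : Q.Vertex} (h : Q.Between i j x) : ¬ (M k Q i j).IsZero := by
  intro h0
  have := h0 x
  have e := val_gen (k := k) h
  rw [Subsingleton.elim (gen i j x) 0, map_zero] at e
  exact zero_ne_one e

/-- A family of vectors that is compatible with the arrows defines a morphism from `M(i, j)`. -/
def homOfVectors {X : QuiverRep k Q.Vertex} (i j : ℕ) (e : ∀ x, X.space x)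
    (h0 : ∀ x, ¬ Q.Between i j x → e x = 0)
    (h : ∀ {x y : Q.Vertex} (α : x ⟶ y), Q.Between i j x → X.map α (e x) = e y) :
    Hom (M k Q i j) X where
  app x := (LinearMap.toSpanSingleton k _ (e x)) ∘ₗ val
  comm {x y} α := by
    apply LinearMap.ext
    intro c
    simp only [LinearMap.comp_apply, LinearMap.toSpanSingleton_apply, map_smul, val_map]
    by_cases hx : Q.Between i j x
    · rw [h α hx]
      by_cases hy : Q.Between i j y
      · rw [if_pos ⟨hx, hy⟩]
      · simp [h0 y hy]
    · simp [val_eq_zero _ hx]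

/-- A family of linear forms that is compatible with the arrows defines a morphism to `M(i, j)`. -/
def homOfForms {X : QuiverRep k Q.Vertex} (i j : ℕ) (φ : ∀ x, X.space x →ₗ[k] k)
    (h0 : ∀ x, ¬ Q.Between i j x → φ x = 0)
    (h : ∀ {x y : Q.Vertex} (α : x ⟶ y), Q.Between i j y → φ y ∘ₗ X.map α = φ x) :
    Hom X (M k Q i j) where
  app x := (φ x).codRestrict (lineIf k (Q.Between i j x)) fun m hx => by simp [h0 x hx]
  comm {x y} α := by
    apply LinearMap.ext
    intro m
    apply Subtype.ext
    change (if _ then φ x m else 0) = φ y (X.map α m)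
    by_cases hy : Q.Between i j y
    · have e := LinearMap.congr_fun (h α hy) m
      rw [LinearMap.comp_apply] at e
      rw [e]
      by_cases hx : Q.Between i j x
      · rw [if_pos ⟨hx, hy⟩]
      · simp [h0 x hx]
    · simp [h0 y hy, hy]

/-- The vectors give a morphism into `X`, the forms one out of it, and the composite acts at `x` by
the scalar `φ x (e x) = 1`. -/
theorem M_isRetract {X : QuiverRep k Q.Vertex} (e : ∀ x, X.space x)
    (he0 : ∀ x, ¬ Q.Between i j x → e x = 0)
    (he : ∀ {x y : Q.Vertex} (α : x ⟶ y), Q.Between i j x → X.map α (e x) = e y)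
    (φ : ∀ x, X.space x →ₗ[k] k)
    (hφ0 : ∀ x, ¬ Q.Between i j x → φ x = 0)
    (hφ : ∀ {x y : Q.Vertex} (α : x ⟶ y), Q.Between i j y → φ y ∘ₗ X.map α = φ x)
    (h1 : ∀ x, Q.Between i j x → φ x (e x) = 1) :
    (M k Q i j).IsRetract X := by
  refine ⟨homOfVectors i j e he0 he, homOfForms i j φ hφ0 hφ, fun x c => val_injective ?_⟩
  change φ x (val c • e x) = val c
  by_cases hx : Q.Between i j x
  · simp [h1 x hx]
  · simp [val_eq_zero _ hx]

/-! ### Morphisms between interval representations -/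

/-- The scalar by which a morphism `M(i, j) → M(a, b)` acts at a vertex. -/
def coef (f : Hom (M k Q i j) (M k Q a b)) (x : Q.Vertex) : k := val (f.app x (gen i j x))

theorem val_app (f : Hom (M k Q i j) (M k Q a b)) (x : Q.Vertex) (c : (M k Q i j).space x) :
    val (f.app x c) = val c * coef f x := by
  conv_lhs => rw [← val_smul_gen c]
  rw [map_smul, map_smul, smul_eq_mul, coef]

theorem coef_comp {c d : ℕ} (g : Hom (M k Q a b) (M k Q c d)) (f : Hom (M k Q i j) (M k Q a b))
    (x : Q.Vertex) : coef (g.comp f) x = coef f x * coef g x :=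
  val_app g x _

theorem coef_eq_zero_left (f : Hom (M k Q i j) (M k Q a b)) {x : Q.Vertex}
    (h : ¬ Q.Between i j x) : coef f x = 0 := by
  rw [coef, eq_zero_of_not (gen i j x) h, map_zero, map_zero]

theorem coef_eq_zero_right (f : Hom (M k Q i j) (M k Q a b)) {x : Q.Vertex}
    (h : ¬ Q.Between a b x) : coef f x = 0 :=
  val_eq_zero _ h

/-- This is the naturality square evaluated at the generator. Only two corners need to lie in the
supports: if `x` is missing in the target or `y` in the source, both scalars are zero. -/
theorem coef_map (f : Hom (M k Q i j) (M k Q a b)) {x y : Q.Vertex} (α : x ⟶ y)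
    (hx : Q.Between i j x) (hy : Q.Between a b y) : coef f x = coef f y := by
  have h := congrArg val (f.comm_apply α (gen i j x))
  rw [map_gen α hx, val_map] at h
  rw [coef, coef, ← h]
  by_cases hx' : Q.Between a b x
  · rw [if_pos ⟨hx', hy⟩]
  · rw [if_neg fun h => hx' h.1, val_eq_zero _ hx']

/-- The support is connected, so an endomorphism of an interval representation is a scalar. -/
theorem coef_const (f : Hom (M k Q i j) (M k Q i j)) {x y : Q.Vertex}
    (hx : Q.Between i j x) (hy : Q.Between i j y) : coef f x = coef f y := by
  refine Eq.symm (between_induction (i := i) (j := j) (P := fun y => coef f y = coef f x)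
    (fun l hb ha => ?_) hx hy rfl)
  have : coef f (Q.before l) = coef f (Q.after l) := by
    rcases hl : Q.forward l with _ | _
    · exact (coef_map f (Q.leftArrow l hl) ha hb).symm
    · exact coef_map f (Q.rightArrow l hl) hb ha
  rw [this]

/-- If `M(i, j) → M(a, b) → M(i, j)` has a nonzero composite, the intervals are equal. -/
theorem between_iff_of_coef_ne_zero (f : Hom (M k Q i j) (M k Q a b))
    (g : Hom (M k Q a b) (M k Q i j)) {x : Q.Vertex} (h : coef f x * coef g x ≠ 0)
    (y : Q.Vertex) : Q.Between i j y ↔ Q.Between a b y := by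
  have hx : Q.Between i j x := by
    by_contra hx
    exact h (by rw [coef_eq_zero_left f hx, zero_mul])
  have hx' : Q.Between a b x := by
    by_contra hx
    exact h (by rw [coef_eq_zero_right f hx, zero_mul])
  constructor
  · intro hy
    rw [← coef_comp, coef_const _ hx hy, coef_comp] at h
    by_contra hy'
    exact h (by rw [coef_eq_zero_right f hy', zero_mul])
  · intro hy
    rw [mul_comm, ← coef_comp, coef_const _ hx' hy, coef_comp] at h
    by_contra hy'
    exact h (by rw [coef_eq_zero_right g hy', zero_mul])

/-- The projection to one summand is an endomorphism, hence a scalar. If the scalar is zero, that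
summand vanishes; otherwise the other one, on which the projection is zero, vanishes. -/
theorem M_indecomposable {x : Q.Vertex} (hx : Q.Between i j x) :
    (M k Q i j).Indecomposable := by
  refine ⟨M_not_isZero hx, fun A B ⟨e⟩ => ?_⟩
  let p : Hom (M k Q i j) (M k Q i j) := e.symm.hom.comp ((inl A B).comp ((fst A B).comp e.hom))
  have hp : ∀ y c, p.app y c = coef p x • c := by
    intro y c
    apply val_injective
    rw [val_app, map_smul, smul_eq_mul, mul_comm]
    by_cases hy : Q.Between i j y
    · rw [coef_const p hx hy]
    · rw [val_eq_zero c hy, mul_zero, mul_zero]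
  have key : ∀ y (m : (A.sum B).space y),
      coef p x • m = (inl A B).app y ((fst A B).app y m) := by
    intro y m
    have h := congrArg (e.app y) (hp y ((e.app y).symm m))
    rw [map_smul, LinearEquiv.apply_symm_apply] at h
    refine h.symm.trans ?_
    simp [p]
  by_cases h0 : coef p x = 0
  · left
    intro y
    refine subsingleton_of_forall_eq 0 fun m => ?_
    have h := congrArg ((fst A B).app y) (key y ((inl A B).app y m))
    rw [h0, zero_smul, map_zero] at h
    simpa using h.symm
  · right
    intro y
    refine subsingleton_of_forall_eq 0 fun m => ?_
    have h := congrArg ((snd A B).app y) (key y ((inr A B).app y m))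
    simpa [h0] using h

end Interval

end TypeAQuiver

namespace TypeAQuiver

open QuiverRep

variable {n : ℕ} {Q : TypeAQuiver n} {k : Type u} [Field k]

/-! ## Every nonzero representation has a summand `M(i, j)` -/

open Classical in
/-- The intervals `{a + 1, …, m}` with fixed `m` are ordered by this key: there is a morphism
`M(a + 1, m) → M(b + 1, m)` that is nonzero at `m` if and only if `startKey Q a ≤ startKey Q b`. -/
noncomputable def startKey (Q : TypeAQuiver n) (a : ℕ) : ℤ :=
  if ∃ l, Q.forward l = false ∧ l.val + 1 = a then a else -a

/-- With `neg_le_startKey` this bounds the key of `a` by `a` in absolute value, so of two different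
starts the larger one decides the comparison, by the direction of the arrow at its left boundary:
there the shorter interval is either a quotient or a subrepresentation of the longer one. -/
theorem startKey_le (a : ℕ) : Q.startKey a ≤ a := by
  rw [startKey]
  split_ifs <;> omega

theorem neg_le_startKey (a : ℕ) : -(a : ℤ) ≤ Q.startKey a := by
  rw [startKey]
  split_ifs <;> omega

theorem startKey_left {l : Fin (n + 1)} (h : Q.forward l = false) {a : ℕ} (ha : l.val + 1 = a) :
    Q.startKey a = a :=
  if_pos ⟨l, h, ha⟩

theorem startKey_right {l : Fin (n + 1)} (h : Q.forward l = true) {a : ℕ} (ha : l.val + 1 = a) :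
    Q.startKey a = -a := by
  refine if_neg ?_
  rintro ⟨l', h', ha'⟩
  obtain rfl : l' = l := Fin.ext (by omega)
  simp [h] at h'

theorem sum_linearMap_comp {ι : Type*} {U V W : Type*} [AddCommGroup U] [AddCommGroup V]
    [AddCommGroup W] [Module k U] [Module k V] [Module k W] (s : Finset ι) (f : ι → V →ₗ[k] W)
    (g : U →ₗ[k] V) : (∑ t ∈ s, f t) ∘ₗ g = ∑ t ∈ s, f t ∘ₗ g := by
  ext
  simp

/-- A decomposition of the restriction of `X` to the vertices at the positions `0, …, m` into
representations with support `{start t, …, m}`, given by basis vectors and dual linear forms. -/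
structure StringBasis (X : QuiverRep k Q.Vertex) (m : ℕ) where
  ι : Type
  [fintype : Fintype ι]
  [decEq : DecidableEq ι]
  start : ι → ℕ
  vec : ι → ∀ x, X.space x
  form : ι → ∀ x, X.space x →ₗ[k] k
  start_le : ∀ t, start t ≤ m
  vec_eq_zero : ∀ t x, pos x < start t → vec t x = 0
  form_eq_zero : ∀ t x, pos x < start t → form t x = 0
  form_vec : ∀ s t x, pos x ≤ m → start t ≤ pos x → form s x (vec t x) = if s = t then 1 else 0
  sum_eq : ∀ x, pos x ≤ m → ∀ v, ∑ t, form t x v • vec t x = v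
  vec_map : ∀ t {x y : Q.Vertex} (α : x ⟶ y), pos x ≤ m → pos y ≤ m → start t ≤ pos x →
    X.map α (vec t x) = vec t y
  form_map : ∀ t {x y : Q.Vertex} (α : x ⟶ y), pos x ≤ m → pos y ≤ m → start t ≤ pos y →
    form t y ∘ₗ X.map α = form t x

attribute [instance] StringBasis.fintype StringBasis.decEq

namespace StringBasis

variable {X : QuiverRep k Q.Vertex} {m : ℕ}

/-- A string basis of the restriction to the first vertex. -/
theorem nonempty_zero (X : QuiverRep k Q.Vertex) : Nonempty (StringBasis X 0) := by
  classical
  let x₀ := Q.vertex 0 (Nat.succ_pos _)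
  let b := Module.finBasis k (X.space x₀)
  have hx₀ : ∀ x : Q.Vertex, pos x ≤ 0 → x = x₀ := fun x hx => pos_injective (by simp [x₀]; omega)
  have hα : ∀ {x y : Q.Vertex} (α : x ⟶ y), pos x ≤ 0 → pos y ≤ 0 → False := by
    refine fun {x y} α => arrow_cases (P := fun x y _ => pos x ≤ 0 → pos y ≤ 0 → False) ?_ ?_ x y α
    · intro l h h1 h2
      simp at h2
    · intro l h h1 h2
      simp at h1
  refine ⟨⟨Fin (Module.finrank k (X.space x₀)), fun _ => 0, fun t => Function.update 0 x₀ (b t),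
    fun t => Function.update 0 x₀ (b.coord t), fun t => le_rfl, fun t x h => by omega,
    fun t x h => by omega, fun s t x hx _ => ?_, fun x hx v => ?_,
    fun t x y α hx hy => (hα α hx hy).elim, fun t x y α hx hy => (hα α hx hy).elim⟩⟩
  · obtain rfl := hx₀ x hx
    simp [Finsupp.single_apply, eq_comm]
  · obtain rfl := hx₀ x hx
    simp [b.sum_repr]

/-- A string basis can be extended to the next vertex if the arrow to or from that vertex is
the inclusion or the projection of a direct sum decomposition. -/
theorem extend (B : StringBasis X m) (hm : m < n + 1)
    (i : X.space (Q.before ⟨m, hm⟩) →ₗ[k] X.space (Q.after ⟨m, hm⟩))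
    (p : X.space (Q.after ⟨m, hm⟩) →ₗ[k] X.space (Q.before ⟨m, hm⟩))
    (hpi : ∀ v, p (i v) = v) (hi : ∀ h, X.map (Q.rightArrow ⟨m, hm⟩ h) = i)
    (hp : ∀ h, X.map (Q.leftArrow ⟨m, hm⟩ h) = p) : Nonempty (StringBasis X (m + 1)) := by
  classical
  let x₁ := Q.before ⟨m, hm⟩
  let x₂ := Q.after ⟨m, hm⟩
  -- The old strings are continued through `i`; a basis of the complement `K` of the image of `i`
  -- starts new strings at position `m + 1`, with `q` the projection to `K`.
  let K := LinearMap.ker p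
  let b := Module.finBasis k K
  have hq : ∀ v, v - i (p v) ∈ K := fun v => by simp [K, hpi]
  let q : X.space x₂ →ₗ[k] K := (LinearMap.id - i ∘ₗ p).codRestrict K hq
  have hqi : ∀ v, q (i v) = 0 := fun v => Subtype.ext (by simp [q, hpi])
  have hqK : ∀ v : K, q v = v := fun v => Subtype.ext (by simp [q])
  have hpK : ∀ v : K, p v = 0 := fun v => v.2
  have hx : ∀ x : Q.Vertex, pos x ≤ m + 1 → x = x₂ ∨ pos x ≤ m := fun x hx => by
    rcases Nat.lt_or_ge m (pos x) with h | h
    · exact Or.inl (pos_injective (by simp [x₂]; omega))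
    · exact Or.inr h
  have hne : ∀ x : Q.Vertex, pos x ≤ m → x ≠ x₂ := by
    rintro x hx rfl
    simp [x₂] at hx
  let vec : B.ι ⊕ Fin (Module.finrank k K) → ∀ x, X.space x := Sum.elim
    (fun t => Function.update (B.vec t) x₂ (i (B.vec t x₁))) (fun s => Function.update 0 x₂ (b s))
  let form : B.ι ⊕ Fin (Module.finrank k K) → ∀ x, X.space x →ₗ[k] k := Sum.elim
    (fun t => Function.update (B.form t) x₂ (B.form t x₁ ∘ₗ p))
    (fun s => Function.update 0 x₂ (b.coord s ∘ₗ q))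
  have v1 : ∀ t x, pos x ≤ m → vec (.inl t) x = B.vec t x := fun t x h => by simp [vec, hne x h]
  have v2 : ∀ t, vec (.inl t) x₂ = i (B.vec t x₁) := fun t => by simp [vec]
  have v3 : ∀ t x, pos x ≤ m → vec (.inr t) x = 0 := fun t x h => by simp [vec, hne x h]
  have v4 : ∀ t, vec (.inr t) x₂ = b t := fun t => by simp [vec]
  have f1 : ∀ t x, pos x ≤ m → form (.inl t) x = B.form t x := fun t x h => by
    simp [form, hne x h]
  have f2 : ∀ t, form (.inl t) x₂ = B.form t x₁ ∘ₗ p := fun t => by simp [form]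
  have f3 : ∀ t x, pos x ≤ m → form (.inr t) x = 0 := fun t x h => by simp [form, hne x h]
  have f4 : ∀ t, form (.inr t) x₂ = b.coord t ∘ₗ q := fun t => by simp [form]
  have hx₁ : pos x₁ ≤ m := le_rfl
  have hx₂ : pos x₂ = m + 1 := rfl
  -- An arrow among the positions up to `m + 1` is either an old one or the new arrow, in one of its
  -- two orientations.
  have hα : ∀ {P : ∀ x y : Q.Vertex, (x ⟶ y) → Prop},
      (∀ x y α, pos x ≤ m → pos y ≤ m → P x y α) → (∀ h, P _ _ (Q.rightArrow ⟨m, hm⟩ h)) →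
      (∀ h, P _ _ (Q.leftArrow ⟨m, hm⟩ h)) → ∀ {x y : Q.Vertex} (α : x ⟶ y),
      pos x ≤ m + 1 → pos y ≤ m + 1 → P x y α := by
    intro P h1 h2 h3 x y α
    refine arrow_cases (P := fun x y α => pos x ≤ m + 1 → pos y ≤ m + 1 → P x y α) ?_ ?_ x y α
    · intro l h hb ha
      rcases Nat.lt_or_ge l.val m with hl | hl
      · exact h1 _ _ _ (by simp; omega) (by simp; omega)
      · obtain rfl : l = ⟨m, hm⟩ := Fin.ext (by simp at ha ⊢; omega)
        exact h2 h
    · intro l h ha hb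
      rcases Nat.lt_or_ge l.val m with hl | hl
      · exact h1 _ _ _ (by simp; omega) (by simp; omega)
      · obtain rfl : l = ⟨m, hm⟩ := Fin.ext (by simp at ha ⊢; omega)
        exact h3 h
  refine ⟨⟨_, Sum.elim B.start fun _ => m + 1, vec, form, ?_, ?_, ?_, ?_, ?_, ?_, ?_⟩⟩
  · rintro (t | t)
    · exact (B.start_le t).trans (Nat.le_succ m)
    · exact le_rfl
  · rintro (t | t) x h
    · have := B.start_le t
      simp only [Sum.elim_inl] at h
      rw [v1 t x (by omega), B.vec_eq_zero t x h]
    · exact v3 t x (Nat.lt_succ_iff.1 h)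
  · rintro (t | t) x h
    · have := B.start_le t
      simp only [Sum.elim_inl] at h
      rw [f1 t x (by omega), B.form_eq_zero t x h]
    · exact f3 t x (Nat.lt_succ_iff.1 h)
  · intro s t x h ht
    rcases hx x h with rfl | hxm
    · have h1 := fun s t => B.form_vec s t x₁ hx₁ (B.start_le t)
      rcases s with s | s <;> rcases t with t | t
      · simp [f2, v2, hpi, h1]
      · simp [f2, v4, hpK]
      · simp [f4, v2, hqi]
      · simp [f4, v4, hqK, Finsupp.single_apply, eq_comm]
    · rcases t with t | t
      · rcases s with s | s
        · simpa [f1 s x hxm, v1 t x hxm] using B.form_vec s t x hxm ht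
        · simp [f3 s x hxm]
      · simp only [Sum.elim_inr] at ht
        omega
  · intro x h v
    rw [Fintype.sum_sum_type]
    rcases hx x h with rfl | hxm
    · simp only [f2, v2, f4, v4, LinearMap.comp_apply]
      have e1 : ∑ t, B.form t x₁ (p v) • i (B.vec t x₁) = i (p v) := by
        simp only [← map_smul, ← map_sum, B.sum_eq x₁ hx₁ (p v)]
      have e2 : ∑ s, b.coord s (q v) • (b s : X.space x₂) = v - i (p v) := by
        have := congrArg K.subtype (b.sum_repr (q v))
        rw [map_sum] at this
        exact this
      rw [e1, e2, add_sub_cancel]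
    · simpa [f1 _ x hxm, v1 _ x hxm, f3 _ x hxm, v3 _ x hxm] using B.sum_eq x hxm v
  · rintro (t | t) x y α hx hy
    · refine hα (P := fun x y α => B.start t ≤ pos x →
        X.map α (vec (Sum.inl t) x) = vec (Sum.inl t) y) ?_ ?_ ?_ α hx hy
      · intro x y α hx hy ht
        rw [v1 t x hx, v1 t y hy, B.vec_map t α hx hy ht]
      · intro h _
        rw [v1 t _ hx₁, hi h, v2]
      · intro h _
        rw [v1 t _ hx₁, hp h, v2, hpi]
    · refine hα (P := fun x y α => m + 1 ≤ pos x →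
        X.map α (vec (Sum.inr t) x) = vec (Sum.inr t) y) ?_ ?_ ?_ α hx hy
      · intro x y α hx hy ht
        omega
      · intro h ht
        simp at ht
      · intro h _
        rw [v3 t _ hx₁, hp h, v4, hpK]
  · rintro (t | t) x y α hx hy
    · refine hα (P := fun x y α => B.start t ≤ pos y →
        form (Sum.inl t) y ∘ₗ X.map α = form (Sum.inl t) x) ?_ ?_ ?_ α hx hy
      · intro x y α hx hy ht
        rw [f1 t x hx, f1 t y hy, B.form_map t α hx hy ht]
      · intro h _
        rw [f1 t _ hx₁, hi h, f2]
        ext v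
        simp [hpi]
      · intro h _
        rw [f1 t _ hx₁, hp h, f2]
    · refine hα (P := fun x y α => m + 1 ≤ pos y →
        form (Sum.inr t) y ∘ₗ X.map α = form (Sum.inr t) x) ?_ ?_ ?_ α hx hy
      · intro x y α hx hy ht
        omega
      · intro h _
        rw [f3 t _ hx₁, hi h, f4]
        ext v
        simp [hqi]
      · intro h ht
        simp at ht

/-- A combination of the basis vectors and a combination of the linear forms that split off the
representation with support `{start t₀, …, m}`. -/
theorem isRetract (B : StringBasis X m) (t₀ : B.ι) (c d : B.ι → k)
    (hc : ∀ t, c t ≠ 0 → Q.startKey (B.start t₀) ≤ Q.startKey (B.start t))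
    (hd : ∀ t, d t ≠ 0 → Q.startKey (B.start t) ≤ Q.startKey (B.start t₀))
    (h₀ : c t₀ * d t₀ = 1) (h : ∀ t, t ≠ t₀ → c t * d t = 0)
    (hright : ∀ l h, l.val = m → X.map (Q.rightArrow l h) (∑ t, c t • B.vec t (Q.before l)) = 0)
    (hleft : ∀ l h, l.val = m → (∑ t, d t • B.form t (Q.before l)) ∘ₗ X.map (Q.leftArrow l h) = 0) :
    (M k Q (B.start t₀ + 1) (m + 1)).IsRetract X := by
  have hb : ∀ x, Q.Between (B.start t₀ + 1) (m + 1) x ↔ B.start t₀ ≤ pos x ∧ pos x ≤ m :=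
    fun x => by
      rw [between_iff]
      omega
  -- The danger is a string starting exactly at `l + 1`, absent before the arrow and present after
  -- it. Its key would be `-(l + 1)`, smaller than every key of a start at most `l`, against `hc`.
  have hv : ∀ t l (h : Q.forward l = true), l.val + 1 ≤ m → B.start t₀ ≤ l.val → c t ≠ 0 →
      X.map (Q.rightArrow l h) (B.vec t (Q.before l)) = B.vec t (Q.after l) := by
    intro t l h hl hl' hct
    by_cases ht : B.start t ≤ l.val
    · exact B.vec_map t _ (by simp; omega) (by simp; omega) (by simpa)
    · rw [B.vec_eq_zero t _ (by simp; omega), map_zero, B.vec_eq_zero t _]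
      rw [pos_after]
      by_contra ht'
      have h1 := hc t hct
      rw [startKey_right h (by omega : l.val + 1 = B.start t)] at h1
      have := neg_le_startKey (Q := Q) (B.start t₀)
      omega
  -- At the left boundary of the interval the arrow leads out, so the vector has to die there. The
  -- key of `t₀` then equals its start, which forces all strings involved to start at or after that
  -- point.
  have hv' : ∀ t l (h : Q.forward l = false), l.val + 1 ≤ m → B.start t₀ ≤ l.val + 1 → c t ≠ 0 →
      X.map (Q.leftArrow l h) (B.vec t (Q.after l)) =
        if B.start t₀ ≤ l.val then B.vec t (Q.before l) else 0 := by
    intro t l h hl hl' hct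
    by_cases ht : B.start t ≤ l.val + 1
    · rw [B.vec_map t _ (by simp; omega) (by simp; omega) (by simpa)]
      split_ifs with h0
      · rfl
      · refine B.vec_eq_zero t _ ?_
        rw [pos_before]
        by_contra ht'
        have h1 := hc t hct
        rw [startKey_left h (by omega : l.val + 1 = B.start t₀)] at h1
        have := startKey_le (Q := Q) (B.start t)
        omega
    · rw [B.vec_eq_zero t _ (by simp; omega), map_zero, B.vec_eq_zero t _ (by simp; omega),
        ite_self]
  -- The same two arguments for the linear forms, with arrows and inequalities of keys reversed.
  have hf : ∀ t l (h : Q.forward l = false), l.val + 1 ≤ m → B.start t₀ ≤ l.val → d t ≠ 0 →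
      B.form t (Q.before l) ∘ₗ X.map (Q.leftArrow l h) = B.form t (Q.after l) := by
    intro t l h hl hl' hct
    by_cases ht : B.start t ≤ l.val
    · exact B.form_map t _ (by simp; omega) (by simp; omega) (by simpa)
    · rw [B.form_eq_zero t _ (by simp; omega), LinearMap.zero_comp, B.form_eq_zero t _]
      rw [pos_after]
      by_contra ht'
      have h1 := hd t hct
      rw [startKey_left h (by omega : l.val + 1 = B.start t)] at h1
      have := startKey_le (Q := Q) (B.start t₀)
      omega
  have hf' : ∀ t l (h : Q.forward l = true), l.val + 1 ≤ m → B.start t₀ ≤ l.val + 1 → d t ≠ 0 →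
      B.form t (Q.after l) ∘ₗ X.map (Q.rightArrow l h) =
        if B.start t₀ ≤ l.val then B.form t (Q.before l) else 0 := by
    intro t l h hl hl' hct
    by_cases ht : B.start t ≤ l.val + 1
    · rw [B.form_map t _ (by simp; omega) (by simp; omega) (by simpa)]
      split_ifs with h0
      · rfl
      · refine B.form_eq_zero t _ ?_
        rw [pos_before]
        by_contra ht'
        have h1 := hd t hct
        rw [startKey_right h (by omega : l.val + 1 = B.start t₀)] at h1
        have := neg_le_startKey (Q := Q) (B.start t)
        omega
    · rw [B.form_eq_zero t _ (by simp; omega), LinearMap.zero_comp,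
        B.form_eq_zero t _ (by simp; omega), ite_self]
  classical
  refine M_isRetract
    (fun x => if Q.Between (B.start t₀ + 1) (m + 1) x then ∑ t, c t • B.vec t x else 0)
    (fun x hx => if_neg hx) ?_
    (fun x => if Q.Between (B.start t₀ + 1) (m + 1) x then ∑ t, d t • B.form t x else 0)
    (fun x hx => if_neg hx) ?_ ?_
  · refine fun {x y} α => arrow_cases (P := fun x y α => Q.Between (B.start t₀ + 1) (m + 1) x →
      X.map α (if Q.Between (B.start t₀ + 1) (m + 1) x then ∑ t, c t • B.vec t x else 0) =
        if Q.Between (B.start t₀ + 1) (m + 1) y then ∑ t, c t • B.vec t y else 0)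
      (fun l h hx => ?_) (fun l h hx => ?_) x y α
    · rw [if_pos hx]
      rw [hb, pos_before] at hx
      by_cases hy : l.val + 1 ≤ m
      · rw [if_pos ((hb _).2 ⟨by simp; omega, by simpa⟩), map_sum]
        refine Finset.sum_congr rfl fun t _ => ?_
        by_cases hct : c t = 0
        · simp [hct]
        · rw [map_smul, hv t l h hy hx.1 hct]
      · rw [if_neg fun h => hy ((hb (Q.after l)).1 h).2, hright l h (by omega)]
    · rw [if_pos hx]
      rw [hb, pos_after] at hx
      have e : ∀ t, X.map (Q.leftArrow l h) (c t • B.vec t (Q.after l)) =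
          if B.start t₀ ≤ l.val then c t • B.vec t (Q.before l) else 0 := by
        intro t
        by_cases hct : c t = 0
        · simp [hct]
        · rw [map_smul, hv' t l h hx.2 hx.1 hct, smul_ite, smul_zero]
      rw [map_sum, Finset.sum_congr rfl fun t _ => e t]
      by_cases hy : B.start t₀ ≤ l.val
      · rw [if_pos ((hb _).2 ⟨by simpa, by simp; omega⟩)]
        simp only [if_pos hy]
      · rw [if_neg fun h => hy ((hb (Q.before l)).1 h).1]
        simp only [if_neg hy, Finset.sum_const_zero]
  · refine fun {x y} α => arrow_cases (P := fun x y α => Q.Between (B.start t₀ + 1) (m + 1) y →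
      (if Q.Between (B.start t₀ + 1) (m + 1) y then ∑ t, d t • B.form t y else 0) ∘ₗ X.map α =
        if Q.Between (B.start t₀ + 1) (m + 1) x then ∑ t, d t • B.form t x else 0)
      (fun l h hy => ?_) (fun l h hy => ?_) x y α
    · rw [if_pos hy]
      rw [hb, pos_after] at hy
      have e : ∀ t, (d t • B.form t (Q.after l)) ∘ₗ X.map (Q.rightArrow l h) =
          if B.start t₀ ≤ l.val then d t • B.form t (Q.before l) else 0 := by
        intro t
        by_cases hct : d t = 0
        · simp [hct]
        · rw [LinearMap.smul_comp, hf' t l h hy.2 hy.1 hct, smul_ite, smul_zero]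
      rw [sum_linearMap_comp, Finset.sum_congr rfl fun t _ => e t]
      by_cases hx : B.start t₀ ≤ l.val
      · rw [if_pos ((hb _).2 ⟨by simpa, by simp; omega⟩)]
        simp only [if_pos hx]
      · rw [if_neg fun h => hx ((hb (Q.before l)).1 h).1]
        simp only [if_neg hx, Finset.sum_const_zero]
    · rw [if_pos hy]
      rw [hb, pos_before] at hy
      by_cases hx : l.val + 1 ≤ m
      · rw [if_pos ((hb _).2 ⟨by simp; omega, by simpa⟩), sum_linearMap_comp]
        refine Finset.sum_congr rfl fun t _ => ?_
        by_cases hct : d t = 0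
        · simp [hct]
        · rw [LinearMap.smul_comp, hf t l h hx hy.1 hct]
      · rw [if_neg fun h => hx ((hb (Q.after l)).1 h).2, hleft l h (by omega)]
  · intro x hx
    rw [if_pos hx, if_pos hx]
    rw [hb] at hx
    -- By duality of vectors and forms the pairing is the sum of `c t * d t` over the strings
    -- present at `x`, and only `t₀` contributes.
    rw [map_sum, ← Fintype.sum_ite_eq' t₀ fun _ => (1 : k)]
    refine Finset.sum_congr rfl fun t _ => ?_
    rw [map_smul, LinearMap.sum_apply, smul_eq_mul, Finset.mul_sum]
    by_cases ht : B.start t ≤ pos x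
    · simp only [LinearMap.smul_apply, B.form_vec _ t x hx.2 ht, smul_eq_mul, mul_ite, mul_one,
        mul_zero, Fintype.sum_ite_eq']
      split_ifs with h'
      · rw [h', h₀]
      · exact h t h'
    · rw [B.vec_eq_zero t x (by omega), if_neg]
      · simp
      · rintro rfl
        exact ht hx.1

/-- If the next map is injective (right arrow) or surjective (left arrow), it is split by linear
algebra and the strings continue. Otherwise a kernel vector, or a form vanishing on the image,
isolates a string that ends at `m`. -/
theorem exists_isRetract_or_extend (B : StringBasis X m) (hm : m < n + 1) :
    (∃ a, a ≤ m ∧ (M k Q (a + 1) (m + 1)).IsRetract X) ∨ Nonempty (StringBasis X (m + 1)) := by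
  classical
  have hne : ∀ {l : Fin (n + 1)}, l.val = m → l = ⟨m, hm⟩ := fun h => Fin.ext h
  rcases hl : Q.forward ⟨m, hm⟩ with _ | _
  · by_cases hs : Function.Surjective (X.map (Q.leftArrow _ hl))
    · right
      obtain ⟨i, hi⟩ := LinearMap.exists_rightInverse_of_surjective _ (LinearMap.range_eq_top.2 hs)
      refine B.extend hm i (X.map (Q.leftArrow _ hl)) (fun v => LinearMap.congr_fun hi v)
        (fun h => ?_) fun h => rfl
      rw [hl] at h
      cases h
    · left
      obtain ⟨φ, hφ, hle⟩ := Submodule.exists_le_ker_of_lt_top _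
        (lt_top_iff_ne_top.2 fun h => hs (LinearMap.range_eq_top.1 h))
      -- The coordinates of `φ` in the dual basis.
      let d : B.ι → k := fun t => φ (B.vec t (Q.before ⟨m, hm⟩))
      have hsum : ∑ t, d t • B.form t (Q.before ⟨m, hm⟩) = φ := by
        ext v
        conv_rhs => rw [← B.sum_eq (Q.before ⟨m, hm⟩) le_rfl v]
        simp [d, mul_comm]
      obtain ⟨t₁, ht₁⟩ : ∃ t, d t ≠ 0 := by
        by_contra! h0
        exact hφ (by rw [← hsum]; simp [h0])
      -- Every string occurring in `φ` must map to the chosen one, hence the maximal key. The vector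
      -- side can then be the single string `t₀`, scaled to make the pairing 1.
      obtain ⟨t₀, ht₀, hmax⟩ := (Finset.univ.filter fun t => d t ≠ 0).exists_max_image
        (fun t => Q.startKey (B.start t)) ⟨t₁, by simpa⟩
      simp only [Finset.mem_filter, Finset.mem_univ, true_and] at ht₀ hmax
      refine ⟨B.start t₀, B.start_le t₀, B.isRetract t₀ (Pi.single t₀ (d t₀)⁻¹) d
        (fun t ht => ?_) hmax (by simp [ht₀]) (fun t ht => by simp [ht]) (fun l h hlm => ?_)
        fun l h hlm => ?_⟩
      · obtain rfl : t = t₀ := by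
          by_contra h
          exact ht (by simp [h])
        exact le_rfl
      · obtain rfl := hne hlm
        rw [hl] at h
        cases h
      · obtain rfl := hne hlm
        rw [hsum]
        ext v
        exact hle ⟨v, rfl⟩
  · by_cases hs : Function.Injective (X.map (Q.rightArrow _ hl))
    · right
      obtain ⟨p, hp⟩ := LinearMap.exists_leftInverse_of_injective _ (LinearMap.ker_eq_bot.2 hs)
      refine B.extend hm (X.map (Q.rightArrow _ hl)) p (fun v => LinearMap.congr_fun hp v)
        (fun h => rfl) fun h => ?_
      rw [hl] at h
      cases h
    · left
      rw [injective_iff_map_eq_zero] at hs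
      push Not at hs
      obtain ⟨z, hz, hz0⟩ := hs
      let c : B.ι → k := fun t => B.form t (Q.before ⟨m, hm⟩) z
      have hsum : ∑ t, c t • B.vec t (Q.before ⟨m, hm⟩) = z := B.sum_eq _ le_rfl z
      obtain ⟨t₁, ht₁⟩ : ∃ t, c t ≠ 0 := by
        by_contra! h0
        exact hz0 (by rw [← hsum]; simp [h0])
      -- Dually, the chosen string must map to all strings occurring in the kernel vector `z`, hence
      -- the minimal key.
      obtain ⟨t₀, ht₀, hmin⟩ := (Finset.univ.filter fun t => c t ≠ 0).exists_min_image
        (fun t => Q.startKey (B.start t)) ⟨t₁, by simpa⟩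
      simp only [Finset.mem_filter, Finset.mem_univ, true_and] at ht₀ hmin
      refine ⟨B.start t₀, B.start_le t₀, B.isRetract t₀ c (Pi.single t₀ (c t₀)⁻¹) hmin
        (fun t ht => ?_) (by simp [ht₀]) (fun t ht => by simp [ht]) (fun l h hlm => ?_)
        fun l h hlm => ?_⟩
      · obtain rfl : t = t₀ := by
          by_contra h
          exact ht (by simp [h])
        exact le_rfl
      · obtain rfl := hne hlm
        rw [hsum, hz]
      · obtain rfl := hne hlm
        rw [hl] at h
        cases h

end StringBasis

/-- Every nonzero representation of a quiver of type `A` has a summand `M(i, j)`. -/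
theorem exists_M_isRetract (X : QuiverRep k Q.Vertex) (hX : ¬ X.IsZero) :
    ∃ a m, a ≤ m ∧ m < n + 2 ∧ (M k Q (a + 1) (m + 1)).IsRetract X := by
  by_contra! hcon
  have key : ∀ m, m < n + 2 → Nonempty (StringBasis X m) := by
    intro m
    induction m with
    | zero => exact fun _ => StringBasis.nonempty_zero X
    | succ m ih =>
      intro hm
      obtain ⟨B⟩ := ih (by omega)
      refine (B.exists_isRetract_or_extend (by omega)).resolve_left ?_
      rintro ⟨a, ha, h⟩
      exact hcon a m ha (by omega) h
  -- The strings now cover the whole quiver. No arrow goes beyond the last vertex, so any single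
  -- string splits off; if there is none, `X` is zero.
  obtain ⟨B⟩ := key (n + 1) (by omega)
  rcases isEmpty_or_nonempty B.ι with h | ⟨⟨t⟩⟩
  · refine hX fun x => subsingleton_of_forall_eq 0 fun v => ?_
    rw [← B.sum_eq x (Nat.lt_succ_iff.1 (pos_lt x)) v]
    simp
  · have h1 : ∀ s, (Pi.single t 1 : B.ι → k) s ≠ 0 → s = t := fun s hs => by
      by_contra h
      exact hs (by simp [h])
    refine hcon (B.start t) (n + 1) (B.start_le t) (by omega) (B.isRetract t (Pi.single t 1)
      (Pi.single t 1) (fun s hs => ?_) (fun s hs => ?_) (by simp) (fun s hs => by simp [hs])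
      (fun l h hl => ?_) fun l h hl => ?_)
    · rw [h1 s hs]
    · rw [h1 s hs]
    · omega
    · omega

end TypeAQuiver

namespace TypeAQuiver

open QuiverRep

variable {n : ℕ} {Q : TypeAQuiver n} {k : Type u} [Field k]

/-! ## Decompositions into the representations `F(γ)` -/

/-- The vertex `x` of `Q` lies in the support of `F(γ)`. -/
abbrev Mem (x : Q.Vertex) (γ : Segment n) : Prop := Q.Between (γ.1.1 + 1) γ.1.2 x

theorem mem_iff {x : Q.Vertex} {γ : Segment n} :
    Mem x γ ↔ γ.1.1.val ≤ pos x ∧ pos x < γ.1.2.val := by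
  rw [Mem, between_iff]
  omega

theorem exists_mem (Q : TypeAQuiver n) (γ : Segment n) : ∃ x : Q.Vertex, Mem x γ := by
  have h : γ.1.1.val < γ.1.2.val := γ.2
  exact ⟨Q.vertex γ.1.1 (by omega), mem_iff.2 ⟨by simp, by simpa⟩⟩

theorem segment_eq_of_mem_iff {γ δ : Segment n} (h : ∀ x : Q.Vertex, Mem x γ ↔ Mem x δ) :
    γ = δ := by
  have hγ : γ.1.1.val < γ.1.2.val := γ.2
  have hδ : δ.1.1.val < δ.1.2.val := δ.2
  have h' : ∀ m, m < n + 2 →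
      (γ.1.1.val ≤ m ∧ m < γ.1.2.val ↔ δ.1.1.val ≤ m ∧ m < δ.1.2.val) := fun m hm => by
    have := h (Q.vertex m hm)
    rwa [mem_iff, mem_iff, pos_vertex] at this
  have h1 := h' γ.1.1 (by omega)
  have h2 := h' δ.1.1 (by omega)
  have h3 := h' (γ.1.2 - 1) (by omega)
  have h4 := h' (δ.1.2 - 1) (by omega)
  refine Subtype.ext (Prod.ext (Fin.ext ?_) (Fin.ext ?_)) <;> omega

/-- The representation `F(γ)`, reducibly. -/
abbrev segmentRep (k : Type u) [Field k] (Q : TypeAQuiver n) (γ : Segment n) :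
    QuiverRep k Q.Vertex :=
  M k Q (γ.1.1 + 1) γ.1.2

theorem FSet_eq (T : Finset (Segment n)) :
    FSet k Q T = directSum fun γ : T => segmentRep k Q γ := rfl

theorem segmentRep_indecomposable (γ : Segment n) : (segmentRep k Q γ).Indecomposable :=
  M_indecomposable (exists_mem Q γ).choose_spec

theorem exists_segmentRep_isRetract (X : QuiverRep k Q.Vertex) (hX : ¬ X.IsZero) :
    ∃ γ, (segmentRep k Q γ).IsRetract X := by
  obtain ⟨a, m, ham, hm, h⟩ := exists_M_isRetract X hX
  exact ⟨⟨(⟨a, by omega⟩, ⟨m + 1, by omega⟩), Nat.lt_succ_of_le ham⟩, h⟩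

/-- Gabriel's classification in type `A`: the interval summand of an indecomposable representation
is all of it. -/
theorem exists_isomorphic_segmentRep {X : QuiverRep k Q.Vertex} (hX : X.Indecomposable) :
    ∃ γ, X.Isomorphic (segmentRep k Q γ) := by
  obtain ⟨γ, h⟩ := exists_segmentRep_isRetract X hX.1
  exact ⟨γ, (h.isomorphic (segmentRep_indecomposable γ).1 hX).symm⟩

/-! ### Uniqueness of decompositions into interval representations -/

section DirectSum

variable {ι : Type} [Fintype ι] (c : ι → Segment n)

/-- Inserting the identity of the direct sum as the sum of inclusions after projections turns a
composite through it into a sum of products of scalars at one vertex. -/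
theorem val_app_app_directSum {γ δ : Segment n} (f : Hom (segmentRep k Q γ)
    (directSum fun i => segmentRep k Q (c i)))
    (g : Hom (directSum fun i => segmentRep k Q (c i)) (segmentRep k Q δ)) (x : Q.Vertex) :
    val (g.app x (f.app x (gen _ _ x))) =
      ∑ i, coef ((directSumProj (fun i => segmentRep k Q (c i)) i).comp f) x *
        coef (g.comp (directSumIncl (fun i => segmentRep k Q (c i)) i)) x := by
  conv_lhs => rw [← sum_directSumIncl_proj (fun i => segmentRep k Q (c i)) x (f.app x _)]
  rw [map_sum, map_sum]
  refine Finset.sum_congr rfl fun i _ => ?_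
  exact val_app (g.comp (directSumIncl (fun i => segmentRep k Q (c i)) i)) x _

theorem eq_of_coef_mul_coef_ne_zero {γ δ : Segment n}
    (f : Hom (segmentRep k Q γ) (segmentRep k Q δ)) (g : Hom (segmentRep k Q δ) (segmentRep k Q γ))
    {x : Q.Vertex} (h : coef f x * coef g x ≠ 0) : γ = δ :=
  segment_eq_of_mem_iff (between_iff_of_coef_ne_zero f g h)

/-- For a retract the scalars sum to 1, so some product is nonzero, and a nonzero round trip between
interval representations forces equal supports. -/
theorem segmentRep_isRetract_directSum_iff {γ : Segment n} :
    (segmentRep k Q γ).IsRetract (directSum fun i => segmentRep k Q (c i)) ↔ ∃ i, c i = γ := by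
  constructor
  · rintro ⟨f, g, h⟩
    obtain ⟨x, hx⟩ := exists_mem Q γ
    have e := val_app_app_directSum c f g x
    rw [h, val_gen hx] at e
    obtain ⟨i, -, hi⟩ := Finset.exists_ne_zero_of_sum_ne_zero (e.symm.trans_ne one_ne_zero)
    exact ⟨i, (eq_of_coef_mul_coef_ne_zero _ _ hi).symm⟩
  · rintro ⟨i, rfl⟩
    exact isRetract_directSum (fun i => segmentRep k Q (c i)) i

theorem segmentRep_isRetract_segmentRep_iff {γ δ : Segment n} :
    (segmentRep k Q γ).IsRetract (segmentRep k Q δ) ↔ γ = δ := by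
  constructor
  · intro h
    obtain ⟨-, h⟩ := (segmentRep_isRetract_directSum_iff fun _ : Unit => δ).1
      (h.trans (isRetract_directSum (fun _ : Unit => segmentRep k Q δ) ()))
    exact h.symm
  · rintro rfl
    exact (Isomorphic.refl _).isRetract

theorem isIndecSummand_directSum_iff {X : QuiverRep k Q.Vertex} :
    X.IsIndecSummand (directSum fun i => segmentRep k Q (c i)) ↔
      ∃ i, X.Isomorphic (segmentRep k Q (c i)) := by
  constructor
  · rintro ⟨hX, h⟩
    obtain ⟨γ, hγ⟩ := exists_isomorphic_segmentRep hX
    obtain ⟨i, rfl⟩ := (segmentRep_isRetract_directSum_iff c).1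
      (hγ.symm.isRetract.trans (isSummand_iff_isRetract.1 h))
    exact ⟨i, hγ⟩
  · rintro ⟨i, h⟩
    exact ⟨h.symm.indecomposable (segmentRep_indecomposable _), isSummand_iff_isRetract.2
      (h.isRetract.trans (isRetract_directSum (fun i => segmentRep k Q (c i)) i))⟩

/-- Two equal indices visibly give a repeated summand. Conversely, if each segment occurs once, a
repeated summand would factor a 2 × 2 identity matrix at a vertex through a single line. -/
theorem basic_directSum_iff :
    (directSum fun i => segmentRep k Q (c i)).Basic ↔ Function.Injective c := by
  classical
  constructor
  · intro h i j hij
    by_contra hne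
    -- Splitting off the index `i` leaves the equal summand at `j` in the complementary sum.
    have e := (directSum_isomorphic_of_equiv (Equiv.optionSubtypeNe i)
      (fun o => segmentRep k Q (c (Equiv.optionSubtypeNe i o)))
      (fun i => segmentRep k Q (c i)) fun _ => rfl).symm
    have h1 : (segmentRep k Q (c i)).IsRetract
        (directSum fun t => segmentRep k Q (c (Equiv.optionSubtypeNe i (some t)))) :=
      (segmentRep_isRetract_directSum_iff fun t => c (Equiv.optionSubtypeNe i (some t))).2
        ⟨⟨j, Ne.symm hne⟩, by simp [hij]⟩
    have h2 : (segmentRep k Q (c i)).IsRetract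
        (segmentRep k Q (c (Equiv.optionSubtypeNe i none))) :=
      segmentRep_isRetract_segmentRep_iff.2 (by simp)
    exact h (segmentRep k Q (c i)) (segmentRep_indecomposable _) (((h2.sum h1).trans
      (isomorphic_directSum_option fun o =>
        segmentRep k Q (c (Equiv.optionSubtypeNe i o))).symm.isRetract).trans
          e.symm.isRetract).isSummand
  · intro hc X hX hXX
    obtain ⟨γ, hγ⟩ := exists_isomorphic_segmentRep hX
    obtain ⟨f, g, h⟩ := (hγ.symm.isRetract.sum hγ.symm.isRetract).trans
      (isSummand_iff_isRetract.1 hXX)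
    obtain ⟨x, hx⟩ := exists_mem Q γ
    have e1 := val_app_app_directSum c (f.comp (inl _ _)) ((fst _ _).comp g) x
    have e2 := val_app_app_directSum c (f.comp (inl _ _)) ((snd _ _).comp g) x
    have e4 := val_app_app_directSum c (f.comp (inr _ _)) ((snd _ _).comp g) x
    simp only [Hom.comp_app, h, fst_app_inl, snd_app_inl, snd_app_inr, val_gen hx,
      map_zero] at e1 e2 e4
    by_cases hi : ∃ i, c i = γ
    · obtain ⟨i, rfl⟩ := hi
      have key : ∀ (f : Hom (segmentRep k Q (c i)) (directSum fun i => segmentRep k Q (c i)))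
          (g : Hom (directSum fun i => segmentRep k Q (c i)) (segmentRep k Q (c i)))
          (j : ι), j ≠ i →
          coef ((directSumProj (fun i => segmentRep k Q (c i)) j).comp f) x *
            coef (g.comp (directSumIncl (fun i => segmentRep k Q (c i)) j)) x = 0 := by
        intro f g j hj
        by_contra hne
        exact hj (hc (eq_of_coef_mul_coef_ne_zero _ _ hne)).symm
      rw [Fintype.sum_eq_single i (key _ _)] at e1 e2 e4
      -- The off-diagonal entry is a product of a factor of the first diagonal entry and a factor of
      -- the second; it is 0 while both diagonal entries are 1.
      rcases mul_eq_zero.1 e2.symm with h0 | h0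
      · rw [h0, zero_mul] at e1
        exact one_ne_zero e1
      · rw [h0, mul_zero] at e4
        exact one_ne_zero e4
    · obtain ⟨i, -, hne⟩ := Finset.exists_ne_zero_of_sum_ne_zero (e1.symm.trans_ne one_ne_zero)
      exact hi ⟨i, (eq_of_coef_mul_coef_ne_zero _ _ hne).symm⟩

end DirectSum

/-- Every representation is a direct sum of representations `F(γ)`. -/
theorem exists_isomorphic_directSum (X : QuiverRep k Q.Vertex) :
    ∃ (ι : Type) (_ : Fintype ι) (c : ι → Segment n),
      X.Isomorphic (directSum fun i => segmentRep k Q (c i)) := by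
  -- Strong induction on the total dimension, which drops when an interval summand is split off.
  suffices h : ∀ d (X : QuiverRep k Q.Vertex),
      ∑ m : Fin (n + 2), Module.finrank k (X.space (Q.vertex m m.2)) = d →
      ∃ (ι : Type) (_ : Fintype ι) (c : ι → Segment n),
        X.Isomorphic (directSum fun i => segmentRep k Q (c i)) from h _ X rfl
  intro d
  induction d using Nat.strong_induction_on with
  | _ d ih =>
  intro X hd
  by_cases hX : X.IsZero
  · refine ⟨Empty, inferInstance, Empty.elim, ⟨Iso.ofBijective ⟨fun x => 0, fun a => ?_⟩ ?_⟩⟩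
    · simp
    · intro x
      have := hX x
      have := isZero_directSum_of_isEmpty (fun i : Empty => segmentRep k Q (Empty.elim i)) x
      exact ⟨Function.injective_of_subsingleton _, fun m => ⟨0, Subsingleton.elim _ _⟩⟩
  · obtain ⟨γ, h⟩ := exists_segmentRep_isRetract X hX
    obtain ⟨Y, ⟨e⟩⟩ := h.isSummand
    have hdim : ∀ x, Module.finrank k (X.space x) =
        Module.finrank k ((segmentRep k Q γ).space x) + Module.finrank k (Y.space x) := fun x =>
      (e.app x).finrank_eq.trans Module.finrank_prod
    obtain ⟨x, hx⟩ := exists_mem Q γ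
    obtain ⟨m, hm, rfl⟩ := exists_eq_vertex x
    have hpos : 0 < Module.finrank k ((segmentRep k Q γ).space (Q.vertex m hm)) :=
      Module.finrank_pos_iff_exists_ne_zero.2 ⟨gen _ _ _, fun h0 => by
        have := val_gen (k := k) hx
        rw [h0, map_zero] at this
        exact zero_ne_one this⟩
    obtain ⟨ι, _, c, hc⟩ := ih _ (by
      rw [← hd]
      refine Finset.sum_lt_sum (fun i _ => ?_) ⟨⟨m, hm⟩, Finset.mem_univ _, ?_⟩
      · rw [hdim]
        exact Nat.le_add_left _ _
      · rw [hdim]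
        exact Nat.lt_add_of_pos_left hpos) Y rfl
    exact ⟨Option ι, inferInstance, fun o => o.elim γ c, (Isomorphic.trans ⟨e⟩
      ((Isomorphic.refl _).sum hc)).trans
      (isomorphic_directSum_option fun o => segmentRep k Q (o.elim γ c)).symm⟩

/-- A basic representation is determined by its indecomposable summands. -/
theorem isomorphic_FSet_of_basic {X : QuiverRep k Q.Vertex} (hX : X.Basic) (T : Finset (Segment n))
    (h : ∀ γ, (segmentRep k Q γ).IsRetract X ↔ γ ∈ T) : X.Isomorphic (FSet k Q T) := by
  obtain ⟨ι, _, c, hc⟩ := exists_isomorphic_directSum X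
  have hinj := (basic_directSum_iff c).1 (hX.of_isRetract hc.symm.isRetract)
  have hT : ∀ γ, γ ∈ T ↔ ∃ i, c i = γ := fun γ => by
    rw [← h, ← segmentRep_isRetract_directSum_iff (k := k) (Q := Q) c]
    exact ⟨fun h => h.trans hc.isRetract, fun h => h.trans hc.symm.isRetract⟩
  refine hc.trans (directSum_isomorphic_of_equiv (Equiv.ofBijective
    (fun i => (⟨c i, (hT _).2 ⟨i, rfl⟩⟩ : T)) ⟨fun i j hij => ?_, fun γ => ?_⟩) _ _ fun _ => rfl)
  · exact hinj (congrArg Subtype.val hij)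
  · obtain ⟨i, hi⟩ := (hT γ).1 γ.2
    exact ⟨i, Subtype.ext hi⟩

theorem isIndecSummand_FSet_iff {X : QuiverRep k Q.Vertex} {T : Finset (Segment n)} :
    X.IsIndecSummand (FSet k Q T) ↔ ∃ γ ∈ T, X.Isomorphic (segmentRep k Q γ) := by
  rw [FSet_eq, isIndecSummand_directSum_iff]
  simp

theorem basic_FSet (T : Finset (Segment n)) : (FSet k Q T).Basic :=
  (basic_directSum_iff _).2 Subtype.val_injective

end TypeAQuiver

namespace QuiverRep

section Compatible

variable {k : Type u} [Field k] {V : Type v} [Quiver.{w} V]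

/-! ## The condition on `Ext¹` in the definition of almost rigid representations -/

/-- `Ext(A, B)` is zero, or one-dimensional and generated by a short exact sequence with
indecomposable middle term. -/
def ExtCompatible (A B : QuiverRep k V) : Prop :=
  Subsingleton (Ext A B) ∨
    (Module.finrank k (Ext A B) = 1 ∧
      ∃ (E : QuiverRep k V) (f : Hom B E) (g : Hom E A) (ξ : Ext A B),
        IsExtClass f g ξ ∧ Submodule.span k {ξ} = ⊤ ∧ E.Indecomposable)

variable {A B A' B' : QuiverRep k V}

/-- The action of isomorphisms on families of maps along the arrows. -/
def cocycleEquiv (e : Iso A A') (e' : Iso B B') :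
    (∀ x y : V, (x ⟶ y) → (A.space x →ₗ[k] B.space y)) ≃ₗ[k]
      (∀ x y : V, (x ⟶ y) → (A'.space x →ₗ[k] B'.space y)) :=
  LinearEquiv.piCongrRight fun x => LinearEquiv.piCongrRight fun y =>
    LinearEquiv.piCongrRight fun _ => LinearEquiv.arrowCongr (e.app x) (e'.app y)

theorem cocycleEquiv_apply (e : Iso A A') (e' : Iso B B')
    (c : ∀ x y : V, (x ⟶ y) → (A.space x →ₗ[k] B.space y)) (x y : V) (a : x ⟶ y)
    (m : A'.space x) :
    cocycleEquiv e e' c x y a m = e'.app y (c x y a ((e.app x).symm m)) := rfl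

/-- Conjugating a coboundary gives the coboundary of the conjugated family. The reverse inclusion is
this statement for the inverse isomorphisms. -/
theorem map_range_extDifferential_le (e : Iso A A') (e' : Iso B B') :
    (LinearMap.range (extDifferential A B)).map (cocycleEquiv e e').toLinearMap ≤
      LinearMap.range (extDifferential A' B') := by
  rintro _ ⟨_, ⟨h, rfl⟩, rfl⟩
  refine ⟨fun x => (e'.app x).toLinearMap ∘ₗ h x ∘ₗ (e.app x).symm.toLinearMap, ?_⟩
  funext x y a
  ext m
  have h1 := e.symm.comm a m
  simp only [Iso.symm_app] at h1
  change B'.map a (e'.app x (h x ((e.app x).symm m))) - e'.app y (h y ((e.app y).symm (A'.map a m)))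
    = e'.app y (B.map a (h x ((e.app x).symm m)) - h y (A.map a ((e.app x).symm m)))
  rw [map_sub, e'.comm, h1]

/-- `Ext` is invariant under isomorphisms. -/
def extEquiv (e : Iso A A') (e' : Iso B B') : Ext A B ≃ₗ[k] Ext A' B' :=
  Submodule.Quotient.equiv _ _ (cocycleEquiv e e') <|
    le_antisymm (map_range_extDifferential_le e e') fun c hc =>
      ⟨(cocycleEquiv e e').symm c, map_range_extDifferential_le e.symm e'.symm ⟨c, hc, rfl⟩,
        LinearEquiv.apply_symm_apply _ _⟩

/-- The middle term stays the same and only the end maps are composed with isomorphisms, so its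
indecomposability is preserved. -/
theorem IsExtClass.of_iso {E : QuiverRep k V} {f : Hom B E} {g : Hom E A} {ξ : Ext A B}
    (h : IsExtClass f g ξ) (e : Iso A A') (e' : Iso B B') :
    IsExtClass (f.comp e'.symm.hom) (e.hom.comp g) (extEquiv e e' ξ) := by
  obtain ⟨hs, s, c, h1, h2, rfl⟩ := h
  refine ⟨fun x => ⟨?_, ?_, ?_⟩, fun x => s x ∘ₗ (e.app x).symm.toLinearMap,
    cocycleEquiv e e' c, fun x => ?_, fun x y a => ?_, rfl⟩
  · exact (hs x).1.comp (e'.app x).symm.injective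
  · exact (e.app x).surjective.comp (hs x).2.1
  · ext m
    have h3 := SetLike.ext_iff.1 (hs x).2.2 m
    rw [LinearMap.mem_range, LinearMap.mem_ker] at h3 ⊢
    refine Iff.trans ⟨?_, ?_⟩ (h3.trans (e.app x).map_eq_zero_iff.symm)
    · rintro ⟨b, rfl⟩
      exact ⟨_, rfl⟩
    · rintro ⟨b, rfl⟩
      exact ⟨e'.app x b, by simp⟩
  · ext m
    have := LinearMap.congr_fun (h1 x) ((e.app x).symm m)
    simp only [LinearMap.comp_apply, LinearMap.id_apply] at this
    simp [this]
  · ext m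
    have h3 := LinearMap.congr_fun (h2 x y a) ((e.app x).symm m)
    have h4 := e.symm.comm a m
    simp only [LinearMap.comp_apply, LinearMap.sub_apply, Iso.symm_app] at h3 h4
    simp [cocycleEquiv_apply, h3, h4]

theorem ExtCompatible.of_isomorphic (h : ExtCompatible A B) (hA : A.Isomorphic A')
    (hB : B.Isomorphic B') : ExtCompatible A' B' := by
  obtain ⟨e⟩ := hA
  obtain ⟨e'⟩ := hB
  rcases h with h | ⟨h, E, f, g, ξ, h1, h2, h3⟩
  · exact Or.inl (extEquiv e e').symm.injective.subsingleton
  · refine Or.inr ⟨(extEquiv e e').finrank_eq.symm.trans h, E, _, _, _, h1.of_iso e e', ?_, h3⟩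
    have := congrArg (Submodule.map (extEquiv e e').toLinearMap) h2
    rw [Submodule.map_span, Set.image_singleton, Submodule.map_top,
      LinearMap.range_eq_top.2 (extEquiv e e').surjective] at this
    exact this

theorem subsingleton_ext_iff :
    Subsingleton (Ext A B) ↔ Function.Surjective (extDifferential A B) := by
  rw [Submodule.Quotient.subsingleton_iff, LinearMap.range_eq_top]

end Compatible

end QuiverRep

namespace TypeAQuiver

open QuiverRep

variable {n : ℕ}

/-! ## Crossing segments -/

/-- The segments `γ` and `δ` cross, and `γ` is below `δ` on the left of the crossing point, for a
convex polygon with the upper vertices `up` and the lower vertices `low`. -/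
def CrossUp (up low : Fin (n + 3) → Prop) (γ δ : Segment n) : Prop :=
  max γ.1.1 δ.1.1 < min γ.1.2 δ.1.2 ∧
    (γ.1.1 < δ.1.1 ∧ up δ.1.1 ∨ δ.1.1 < γ.1.1 ∧ low γ.1.1) ∧
    (γ.1.2 < δ.1.2 ∧ up γ.1.2 ∨ δ.1.2 < γ.1.2 ∧ low δ.1.2)

/-- The upper-barred vertices of `P(Q)`. -/
def IsUpper (Q : TypeAQuiver n) (v : Fin (n + 3)) : Prop :=
  ∃ l, Q.forward l = true ∧ polygonVertex l = v

/-- The lower-barred vertices of `P(Q)`. -/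
def IsLower (Q : TypeAQuiver n) (v : Fin (n + 3)) : Prop :=
  ∃ l, Q.forward l = false ∧ polygonVertex l = v

theorem polygonVertex_val (l : Fin (n + 1)) : (polygonVertex l : ℕ) = l.val + 1 := rfl

variable {Q : TypeAQuiver n}

theorem isUpper_of_val {l : Fin (n + 1)} (h : Q.forward l = true) {v : Fin (n + 3)}
    (hv : v.val = l.val + 1) : Q.IsUpper v :=
  ⟨l, h, Fin.ext (by rw [polygonVertex_val, hv])⟩

theorem isLower_of_val {l : Fin (n + 1)} (h : Q.forward l = false) {v : Fin (n + 3)}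
    (hv : v.val = l.val + 1) : Q.IsLower v :=
  ⟨l, h, Fin.ext (by rw [polygonVertex_val, hv])⟩

/-! ## `Ext` between the representations `F(γ)` -/

variable {k : Type u} [Field k]

section Interval

variable {i j a b : ℕ}

/-- The differential in coordinates. -/
theorem val_extDifferential (h : ∀ x, (M k Q i j).space x →ₗ[k] (M k Q a b).space x)
    {x y : Q.Vertex} (α : x ⟶ y) (hx : Q.Between i j x) (hy : Q.Between a b y) :
    val (extDifferential _ _ h x y α (gen i j x)) =
      val (h x (gen i j x)) - val (h y (gen i j y)) := by
  change val ((M k Q a b).map α (h x (gen i j x)) - h y ((M k Q i j).map α (gen i j x))) = _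
  rw [map_sub, map_gen α hx, val_map]
  by_cases hx' : Q.Between a b x
  · rw [if_pos ⟨hx', hy⟩]
  · rw [if_neg fun h => hx' h.1, val_eq_zero _ hx']

theorem val_hom_eq_zero {x y : Q.Vertex} (h : (M k Q i j).space x →ₗ[k] (M k Q a b).space y)
    (hx : ¬ (Q.Between i j x ∧ Q.Between a b y)) : val (h (gen i j x)) = 0 := by
  by_cases h1 : Q.Between i j x
  · exact val_eq_zero _ fun h2 => hx ⟨h1, h2⟩
  · rw [eq_zero_of_not (gen i j x) h1, map_zero, map_zero]

theorem linearMap_ext_gen {x y : Q.Vertex} {f g : (M k Q i j).space x →ₗ[k] (M k Q a b).space y}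
    (h : Q.Between i j x → Q.Between a b y → val (f (gen i j x)) = val (g (gen i j x))) :
    f = g := by
  ext c
  rw [← val_smul_gen c, map_smul, map_smul]
  congr 1
  apply val_injective
  by_cases hxy : Q.Between i j x ∧ Q.Between a b y
  · exact h hxy.1 hxy.2
  · rw [val_hom_eq_zero f hxy, val_hom_eq_zero g hxy]

/-- At each vertex the linear maps form a line or zero, so a family of them amounts to a scalar
function supported on the common vertices, and being a coboundary becomes an equation in `k`. -/
theorem mem_range_extDifferential
    (c : ∀ x y : Q.Vertex, (x ⟶ y) → ((M k Q i j).space x →ₗ[k] (M k Q a b).space y))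
    (η : Q.Vertex → k) (hη : ∀ x, ¬ (Q.Between i j x ∧ Q.Between a b x) → η x = 0)
    (h : ∀ {x y : Q.Vertex} (α : x ⟶ y), Q.Between i j x → Q.Between a b y →
      η x - η y = val (c x y α (gen i j x))) :
    c ∈ LinearMap.range (extDifferential (M k Q i j) (M k Q a b)) := by
  let H : ∀ x, (M k Q i j).space x →ₗ[k] (M k Q a b).space x :=
    fun x => η x • LinearMap.toSpanSingleton k _ (gen a b x) ∘ₗ val
  have hH : ∀ x, val (H x (gen i j x)) = η x := by
    intro x
    by_cases hx : Q.Between i j x ∧ Q.Between a b x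
    · simp [H, val_gen hx.1, val_gen hx.2]
    · rw [val_hom_eq_zero _ hx, hη x hx]
  refine ⟨H, ?_⟩
  funext x y α
  refine linearMap_ext_gen fun hx hy => ?_
  rw [val_extDifferential H α hx hy, hH, hH, h α hx hy]

end Interval

/-- Every function on the arrows is a difference of values of a function on the vertices. -/
theorem exists_potential (c : ∀ x y : Q.Vertex, (x ⟶ y) → k) :
    ∃ G : ℕ → k, ∀ {x y : Q.Vertex} (α : x ⟶ y), G (pos x) - G (pos y) = c x y α := by
  let s : Fin (n + 1) → k := fun l =>
    if h : Q.forward l = true then c _ _ (Q.rightArrow l h)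
    else -c _ _ (Q.leftArrow l (by simpa using h))
  -- The underlying graph is a path, so summing along it gives a potential. Past the last arrow the
  -- increment is zero.
  let G : ℕ → k := Nat.rec 0 fun m g => g - if h : m < n + 1 then s ⟨m, h⟩ else 0
  have hG : ∀ l : Fin (n + 1), G (l.val + 1) = G l.val - s l := fun l => by
    change G l.val - (if h : l.val < n + 1 then s ⟨l.val, h⟩ else 0) = _
    rw [dif_pos l.2]
  refine ⟨G, fun {x y} α => arrow_cases (P := fun x y α => G (pos x) - G (pos y) = c x y α)
    (fun l h => ?_) (fun l h => ?_) x y α⟩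
  · rw [pos_before, pos_after, hG]
    simp [s, h]
  · rw [pos_before, pos_after, hG]
    simp [s, h]

/-- The polygon vertex numbered by the right-hand position of an arrow carries the label of that
arrow, so the orientation says whether it is upper or lower. -/
theorem adjacent {x y : Q.Vertex} (α : x ⟶ y) :
    (pos y = pos x + 1 ∧ ∀ v : Fin (n + 3), v.val = pos y → Q.IsUpper v) ∨
      (pos x = pos y + 1 ∧ ∀ v : Fin (n + 3), v.val = pos x → Q.IsLower v) :=
  arrow_cases (P := fun x y _ => (pos y = pos x + 1 ∧ ∀ v : Fin (n + 3), v.val = pos y →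
    Q.IsUpper v) ∨ (pos x = pos y + 1 ∧ ∀ v : Fin (n + 3), v.val = pos x → Q.IsLower v))
    (fun _ h => Or.inl ⟨rfl, fun _ hv => isUpper_of_val h hv⟩)
    (fun _ h => Or.inr ⟨rfl, fun _ hv => isLower_of_val h hv⟩) x y α

variable {γ δ ε : Segment n}

/-- A cocycle is the difference of a potential `G`. Cutting `G - C` off outside the common support
is harmless if `G = C` at the boundary positions reached by an arrow from `γ` to `δ`. If one end
imposes no such condition, the constant `C` can be fitted to the other end. -/
theorem subsingleton_ext_of_not (h : ¬ ((γ.1.1 < δ.1.1 ∧ Q.IsUpper δ.1.1 ∨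
      δ.1.1 < γ.1.1 ∧ Q.IsLower γ.1.1) ∧ (γ.1.2 < δ.1.2 ∧ Q.IsUpper γ.1.2 ∨
      δ.1.2 < γ.1.2 ∧ Q.IsLower δ.1.2))) :
    Subsingleton (Ext (segmentRep k Q γ) (segmentRep k Q δ)) := by
  classical
  rw [subsingleton_ext_iff]
  intro c
  obtain ⟨G, hG⟩ := exists_potential fun x y α => val (c x y α (gen _ _ x))
  obtain ⟨C, hC⟩ : ∃ C : k, ∀ {x y : Q.Vertex} (α : x ⟶ y), Mem x γ → Mem y δ →
      (¬ Mem y γ → G (pos y) = C) ∧ (¬ Mem x δ → G (pos x) = C) := by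
    rcases not_and_or.1 h with h | h
    -- The left end is free; `C` is the potential at the first position past the right end of the
    -- overlap.
    · refine ⟨G (min γ.1.2.val δ.1.2.val), fun {x y} α hx hy => ⟨fun hyγ => ?_, fun hxδ => ?_⟩⟩ <;>
        congr 1 <;> by_contra hne <;> apply h <;> rw [mem_iff] at * <;>
        simp only [Fin.lt_def] at * <;> rcases adjacent α with ⟨ha, ha'⟩ | ⟨ha, ha'⟩
      · omega
      · exact Or.inr ⟨by omega, ha' _ (by omega)⟩
      · exact Or.inl ⟨by omega, ha' _ (by omega)⟩
      · omega
    -- The right end is free; `C` is the potential just before the left end. The truncated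
    -- difference is harmless: if the maximum is 0, no position lies before it.
    · refine ⟨G (max γ.1.1.val δ.1.1.val - 1),
        fun {x y} α hx hy => ⟨fun hyγ => ?_, fun hxδ => ?_⟩⟩ <;>
        congr 1 <;> by_contra hne <;> apply h <;> rw [mem_iff] at * <;>
        simp only [Fin.lt_def] at * <;> rcases adjacent α with ⟨ha, ha'⟩ | ⟨ha, ha'⟩
      · exact Or.inl ⟨by omega, ha' _ (by omega)⟩
      · omega
      · omega
      · exact Or.inr ⟨by omega, ha' _ (by omega)⟩
  refine mem_range_extDifferential c (fun x => if Mem x γ ∧ Mem x δ then G (pos x) - C else 0)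
    (fun x hx => if_neg hx) fun {x y} α hx hy => ?_
  obtain ⟨h1, h2⟩ := hC α hx hy
  rw [← hG α]
  by_cases hxδ : Mem x δ <;> by_cases hyγ : Mem y γ
  · rw [if_pos ⟨hx, hxδ⟩, if_pos ⟨hyγ, hy⟩, sub_sub_sub_cancel_right]
  · rw [if_pos ⟨hx, hxδ⟩, if_neg fun h => hyγ h.1, h1 hyγ, sub_zero]
  · rw [if_neg fun h => hxδ h.2, if_pos ⟨hyγ, hy⟩, h2 hxδ, zero_sub, neg_sub]
  · rw [if_neg fun h => hxδ h.2, if_neg fun h => hyγ h.1, h1 hyγ, h2 hxδ, sub_self, sub_self]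

/-- Two adjacent intervals with an arrow between them. -/
theorem extCompatible_of_adjacent (hε : ∀ x : Q.Vertex, Mem x ε ↔ Mem x γ ∨ Mem x δ)
    (hdisj : ∀ x : Q.Vertex, Mem x γ → ¬ Mem x δ)
    (hδγ : ∀ {x y : Q.Vertex}, (x ⟶ y) → Mem x δ → ¬ Mem y γ)
    {x₀ y₀ : Q.Vertex} (α₀ : x₀ ⟶ y₀) (hx₀ : Mem x₀ γ) (hy₀ : Mem y₀ δ)
    (huniq : ∀ {x y : Q.Vertex}, (x ⟶ y) → Mem x γ → Mem y δ → x = x₀ ∧ y = y₀) :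
    ExtCompatible (segmentRep k Q γ) (segmentRep k Q δ) := by
  classical
  -- No arrow leads from `δ` to `γ`, so inside the merged interval `ε` the part on `δ` is a
  -- subrepresentation with quotient `F γ`.
  let f : Hom (segmentRep k Q δ) (segmentRep k Q ε) :=
    homOfVectors _ _ (fun x => if Mem x δ then gen _ _ x else 0) (fun x hx => if_neg hx) <| by
      intro x y α hx
      rw [if_pos hx, map_gen α ((hε x).2 (Or.inr hx))]
      split_ifs with hy
      · rfl
      · exact eq_zero_of_not _ fun h => ((hε y).1 h).elim (hδγ α hx) hy
  let g : Hom (segmentRep k Q ε) (segmentRep k Q γ) :=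
    homOfForms _ _ (fun x => if Mem x γ then val else 0) (fun x hx => if_neg hx) <| by
      intro x y α hy
      ext c
      rw [if_pos hy, LinearMap.comp_apply, val_map]
      by_cases hx : Mem x γ
      · rw [if_pos hx, if_pos ⟨(hε x).2 (Or.inl hx), (hε y).2 (Or.inl hy)⟩]
      · rw [if_neg hx, if_neg fun h => ((hε x).1 h.1).elim hx fun h' => hδγ α h' hy]
        rfl
  have hf : ∀ x (c : (segmentRep k Q δ).space x), Mem x δ → val (f.app x c) = val c := by
    intro x c hx
    change val (val c • (if Mem x δ then gen (k := k) _ _ x else 0)) = val c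
    rw [if_pos hx, map_smul, val_gen ((hε x).2 (Or.inr hx)), smul_eq_mul, mul_one]
  have hg : ∀ x (c : (segmentRep k Q ε).space x), Mem x γ → val (g.app x c) = val c := by
    intro x c hx
    change (if Mem x γ then (val : (segmentRep k Q ε).space x →ₗ[k] k) else 0) c = val c
    rw [if_pos hx]
  let s : ∀ x, (segmentRep k Q γ).space x →ₗ[k] (segmentRep k Q ε).space x :=
    fun x => LinearMap.toSpanSingleton k _ (gen _ _ x) ∘ₗ val
  let c : ∀ x y : Q.Vertex, (x ⟶ y) → ((segmentRep k Q γ).space x →ₗ[k]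
      (segmentRep k Q δ).space y) :=
    fun x y _ => LinearMap.toSpanSingleton k _ (gen _ _ y) ∘ₗ val
  have hs : ∀ x (m : (segmentRep k Q γ).space x), val (s x m) = val m := by
    intro x m
    by_cases hx : Mem x γ
    · simp [s, val_gen ((hε x).2 (Or.inl hx))]
    · rw [eq_zero_of_not m hx, map_zero, map_zero, map_zero]
  have hc : ∀ x y α, Mem x γ → Mem y δ → val (c x y α (gen _ _ x)) = 1 := by
    intro x y α hx hy
    simp [c, val_gen hx, val_gen hy]
  have hfg : IsExtClass f g (Submodule.Quotient.mk c) := by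
    refine ⟨fun x => ?_, s, c, fun x => ?_, fun x y α => ?_, rfl⟩
    · by_cases hγ : Mem x γ
      · have hδ := hdisj x hγ
        refine ⟨fun a b _ => (eq_zero_of_not a hδ).trans (eq_zero_of_not b hδ).symm,
          fun m => ⟨s x m, val_injective (by rw [hg x _ hγ, hs])⟩, ?_⟩
        ext m
        rw [LinearMap.mem_range, LinearMap.mem_ker]
        constructor
        · rintro ⟨b, rfl⟩
          rw [eq_zero_of_not b hδ, map_zero, map_zero]
        · intro h0
          refine ⟨0, val_injective ?_⟩
          rw [map_zero, map_zero, ← hg x m hγ, h0, map_zero]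
      · refine ⟨fun a b hab => val_injective ?_,
          fun m => ⟨0, (map_zero _).trans (eq_zero_of_not m hγ).symm⟩, ?_⟩
        · by_cases hδ : Mem x δ
          · rw [← hf x a hδ, hab, hf x b hδ]
          · rw [val_eq_zero a hδ, val_eq_zero b hδ]
        · ext m
          refine ⟨fun _ => eq_zero_of_not _ hγ, fun _ => ?_⟩
          refine ⟨val m • gen _ _ x, val_injective ?_⟩
          by_cases hδ : Mem x δ
          · rw [hf x _ hδ, map_smul, val_gen hδ, smul_eq_mul, mul_one]
          · have : ¬ Mem x ε := fun h => ((hε x).1 h).elim hγ hδ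
            rw [val_eq_zero _ this, val_eq_zero m this]
    · ext m
      apply val_injective
      by_cases hγ : Mem x γ
      · rw [LinearMap.comp_apply, hg x _ hγ, hs, LinearMap.id_apply]
      · rw [val_eq_zero _ hγ, val_eq_zero _ hγ]
    · refine linearMap_ext_gen fun hx hy => ?_
      change val (f.app y (c x y α (gen _ _ x))) = val ((segmentRep k Q ε).map α (s x (gen _ _ x)) -
        s y ((segmentRep k Q γ).map α (gen _ _ x)))
      rw [map_sub, hs, map_gen α hx, val_map, hs, val_gen hx,
        if_pos ⟨(hε x).2 (Or.inl hx), hy⟩]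
      rcases (hε y).1 hy with hy' | hy'
      · rw [val_gen hy', sub_self, eq_zero_of_not (c x y α _) (hdisj y hy'), map_zero, map_zero]
      · rw [hf y _ hy', hc x y α hx hy', val_eq_zero _ fun h => hdisj y h hy', sub_zero]
  -- The supports are disjoint, so all coboundaries vanish, whereas the cocycle takes the value 1 on
  -- `α₀`.
  have hne : (Submodule.Quotient.mk c : Ext (segmentRep k Q γ) (segmentRep k Q δ)) ≠ 0 := by
    rw [Ne, Submodule.Quotient.mk_eq_zero]
    rintro ⟨h, hh⟩
    have h1 := hc x₀ y₀ α₀ hx₀ hy₀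
    rw [← hh, val_extDifferential h α₀ hx₀ hy₀, val_hom_eq_zero _ fun h => hdisj _ h.1 h.2,
      val_hom_eq_zero _ fun h => hdisj _ h.1 h.2, sub_zero] at h1
    exact zero_ne_one h1
  have hspan : ∀ ξ : Ext (segmentRep k Q γ) (segmentRep k Q δ),
      ∃ r : k, r • Submodule.Quotient.mk c = ξ := by
    intro ξ
    obtain ⟨c', rfl⟩ := Submodule.Quotient.mk_surjective _ ξ
    obtain ⟨G, hG⟩ := exists_potential fun x y α => val (c' x y α (gen _ _ x))
    -- This is the value of `c'` on `α₀`, the only arrow from `γ` to `δ`.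
    refine ⟨G (pos x₀) - G (pos y₀), ?_⟩
    rw [← Submodule.Quotient.mk_smul, Submodule.Quotient.eq]
    refine mem_range_extDifferential _ (fun _ => 0) (fun _ _ => rfl) fun {x y} α hx hy => ?_
    obtain ⟨rfl, rfl⟩ := huniq α hx hy
    change _ = val (((G (pos x) - G (pos y)) • c x y α - c' x y α) (gen _ _ x))
    rw [LinearMap.sub_apply, LinearMap.smul_apply, map_sub, map_smul, hc x y α hx hy, ← hG α]
    simp
  exact Or.inr ⟨finrank_eq_one _ hne hspan, _, f, g, _, hfg,
    (Submodule.span_singleton_eq_top_iff k _).2 hspan, segmentRep_indecomposable ε⟩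

theorem vertex_eq_polygonVertex {v : Fin (n + 3)} (h : Q.IsUpper v ∨ Q.IsLower v) :
    ∃ l : Fin (n + 1), v.val = l.val + 1 ∧
      (Q.IsUpper v → Q.forward l = true) ∧ (Q.IsLower v → Q.forward l = false) := by
  obtain ⟨l, rfl⟩ : ∃ l, polygonVertex l = v := h.elim (fun ⟨l, _, h⟩ => ⟨l, h⟩)
    fun ⟨l, _, h⟩ => ⟨l, h⟩
  have hinj : ∀ l' : Fin (n + 1), polygonVertex l' = polygonVertex l → l' = l := fun l' h =>
    Fin.ext (Nat.succ.inj (congrArg Fin.val h))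
  refine ⟨l, rfl, ?_, ?_⟩
  · rintro ⟨l', h, h'⟩
    rwa [hinj l' h'] at h
  · rintro ⟨l', h, h'⟩
    rwa [hinj l' h'] at h

theorem not_isUpper_and_isLower {v : Fin (n + 3)} (h : Q.IsUpper v) : ¬ Q.IsLower v := by
  intro h'
  obtain ⟨l, -, h1, h2⟩ := vertex_eq_polygonVertex (Or.inl h)
  have := (h1 h).symm.trans (h2 h')
  cases this

/-- Either a boundary condition fails and `Ext` vanishes, or the supports do not overlap. In the
latter case they are adjacent, with the merged interval as middle term, or separated by a gap that
no arrow bridges. -/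
theorem extCompatible_of_not_crossUp (h : ¬ CrossUp Q.IsUpper Q.IsLower γ δ) :
    ExtCompatible (segmentRep k Q γ) (segmentRep k Q δ) := by
  have hγ := Fin.lt_def.1 γ.2
  have hδ := Fin.lt_def.1 δ.2
  rw [CrossUp, not_and'] at h
  by_cases hb : (γ.1.1 < δ.1.1 ∧ Q.IsUpper δ.1.1 ∨
      δ.1.1 < γ.1.1 ∧ Q.IsLower γ.1.1) ∧ (γ.1.2 < δ.1.2 ∧ Q.IsUpper γ.1.2 ∨
      δ.1.2 < γ.1.2 ∧ Q.IsLower δ.1.2)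
  · have hd := h hb
    rw [not_lt, min_le_iff, le_max_iff, le_max_iff] at hd
    simp only [Fin.lt_def, Fin.le_def] at hb hd
    by_cases h1 : γ.1.2.val = δ.1.1.val
    · have hup : Q.IsUpper δ.1.1 := by
        rcases hb.1 with h | h
        · exact h.2
        · omega
      obtain ⟨l, hl, hl', -⟩ := vertex_eq_polygonVertex (Or.inl hup)
      refine extCompatible_of_adjacent (ε := ⟨(γ.1.1, δ.1.2), Fin.lt_def.2 (by simp; omega)⟩)
        (fun x => ?_) (fun x => ?_) (fun {x y} α => ?_) (Q.rightArrow l (hl' hup)) ?_ ?_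
        fun {x y} α hx hy => ?_
      · simp only [mem_iff]
        omega
      · simp only [mem_iff]
        omega
      · simp only [mem_iff]
        rcases adjacent α with ⟨ha, -⟩ | ⟨ha, ha'⟩
        · omega
        · intro h3 h4
          exact not_isUpper_and_isLower hup (ha' _ (by omega))
      · rw [mem_iff, pos_before]
        omega
      · rw [mem_iff, pos_after]
        omega
      · rw [mem_iff] at hx hy
        rcases adjacent α with ⟨ha, -⟩ | ⟨ha, -⟩
        · exact ⟨pos_injective (by rw [pos_before]; omega),
            pos_injective (by rw [pos_after]; omega)⟩
        · omega
    by_cases h2 : δ.1.2.val = γ.1.1.val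
    · have hlow : Q.IsLower γ.1.1 := by
        rcases hb.1 with h | h
        · omega
        · exact h.2
      obtain ⟨l, hl, -, hl'⟩ := vertex_eq_polygonVertex (Or.inr hlow)
      refine extCompatible_of_adjacent (ε := ⟨(δ.1.1, γ.1.2), Fin.lt_def.2 (by simp; omega)⟩)
        (fun x => ?_) (fun x => ?_) (fun {x y} α => ?_) (Q.leftArrow l (hl' hlow)) ?_ ?_
        fun {x y} α hx hy => ?_
      · simp only [mem_iff]
        omega
      · simp only [mem_iff]
        omega
      · simp only [mem_iff]
        rcases adjacent α with ⟨ha, ha'⟩ | ⟨ha, -⟩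
        · intro h3 h4
          exact not_isUpper_and_isLower (ha' _ (by omega)) hlow
        · omega
      · rw [mem_iff, pos_after]
        omega
      · rw [mem_iff, pos_before]
        omega
      · rw [mem_iff] at hx hy
        rcases adjacent α with ⟨ha, -⟩ | ⟨ha, -⟩
        · omega
        · exact ⟨pos_injective (by rw [pos_after]; omega),
            pos_injective (by rw [pos_before]; omega)⟩
    · left
      rw [subsingleton_ext_iff]
      intro c
      refine mem_range_extDifferential c (fun _ => 0) (fun _ _ => rfl) fun {x y} α hx hy => ?_
      change Mem x γ at hx
      change Mem y δ at hy
      rw [mem_iff] at hx hy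
      rcases adjacent α with ⟨ha, -⟩ | ⟨ha, -⟩ <;> omega
  · exact Or.inl (subsingleton_ext_of_not hb)

/-- With conditions at both ends of the overlap `Ext` is nonzero, and a middle term has dimension 2
at a common vertex, whereas indecomposable representations have dimension at most 1 everywhere. -/
theorem not_extCompatible_of_crossUp (h : CrossUp Q.IsUpper Q.IsLower γ δ) :
    ¬ ExtCompatible (segmentRep k Q γ) (segmentRep k Q δ) := by
  obtain ⟨hlt, hl, hr⟩ := h
  have hlt' := Fin.lt_def.1 hlt
  have hmax : (max γ.1.1 δ.1.1).val = max γ.1.1.val δ.1.1.val :=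
    (Fin.val_strictMono.monotone).map_max
  have hmin : (min γ.1.2 δ.1.2).val = min γ.1.2.val δ.1.2.val :=
    (Fin.val_strictMono.monotone).map_min
  rw [hmax, hmin] at hlt'
  rintro (h | ⟨-, E, f, g, ξ, ⟨hfg, -⟩, -, hE⟩)
  · rw [subsingleton_ext_iff] at h
    -- The cocycle that is 1 on the arrow across the left end of the overlap and 0 on all others.
    let c : ∀ x y : Q.Vertex, (x ⟶ y) → ((segmentRep k Q γ).space x →ₗ[k]
        (segmentRep k Q δ).space y) := fun x y _ =>
      if max (pos x) (pos y) = max γ.1.1.val δ.1.1.val then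
        LinearMap.toSpanSingleton k _ (gen _ _ y) ∘ₗ val else 0
    obtain ⟨h, hh⟩ := h c
    have hc : ∀ {x y : Q.Vertex} (α : x ⟶ y), Mem x γ → Mem y δ →
        val (h x (gen _ _ x)) - val (h y (gen _ _ y)) =
          if max (pos x) (pos y) = max γ.1.1.val δ.1.1.val then 1 else 0 := by
      intro x y α hx hy
      rw [← val_extDifferential h α hx hy, hh]
      change val ((if _ then _ else _ : (segmentRep k Q γ).space x →ₗ[k] _) (gen _ _ x)) = _
      split_ifs
      · simp [val_gen hx, val_gen hy]
      · simp
    -- The scalar of `h` at position `m`, extended by zero. It vanishes on both sides of the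
    -- overlap, jumps at its left end and is constant from there to the right end, a contradiction.
    let N : ℕ → k := fun m => if hm : m < n + 2 then val (h (Q.vertex m hm) (gen _ _ _)) else 0
    have hN : ∀ l : Fin (n + 1), max γ.1.1.val δ.1.1.val ≤ l.val + 1 →
        l.val + 1 ≤ min γ.1.2.val δ.1.2.val →
        (l.val + 1 = max γ.1.1.val δ.1.1.val → N l.val - N (l.val + 1) ≠ 0) ∧
        (l.val + 1 ≠ max γ.1.1.val δ.1.1.val → N l.val = N (l.val + 1)) := by
      intro l h1 h2
      have e1 : N l.val = val (h (Q.before l) (gen _ _ _)) :=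
        dif_pos (l.2.trans (Nat.lt_succ_self _))
      have e2 : N (l.val + 1) = val (h (Q.after l) (gen _ _ _)) := dif_pos (Nat.succ_lt_succ l.2)
      rw [e1, e2]
      simp only [Fin.lt_def] at hl hr
      rcases hf : Q.forward l with _ | _
      · have hno : ∀ v : Fin (n + 3), v.val = l.val + 1 → ¬ Q.IsUpper v := fun v hv hup =>
          not_isUpper_and_isLower hup (isLower_of_val hf hv)
        have h3 : Mem (Q.after l) γ ∧ Mem (Q.before l) δ := by
          rw [mem_iff, mem_iff, pos_before, pos_after]
          have n1 := hno δ.1.1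
          have n2 := hno γ.1.2
          constructor <;> constructor <;> by_contra hcon <;> rcases hl with hl | hl <;>
            rcases hr with hr | hr <;>
            first | omega | exact n1 (by omega) hl.2 | exact n2 (by omega) hr.2
        have h4 := hc (Q.leftArrow l hf) h3.1 h3.2
        rw [pos_before, pos_after, max_eq_left (Nat.le_succ _)] at h4
        constructor
        · intro h5
          rw [if_pos h5] at h4
          rw [← neg_sub, h4]
          exact neg_ne_zero.2 one_ne_zero
        · intro h5
          rw [if_neg h5] at h4
          exact (sub_eq_zero.1 h4).symm
      · have hno : ∀ v : Fin (n + 3), v.val = l.val + 1 → ¬ Q.IsLower v := fun v hv hlow =>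
          not_isUpper_and_isLower (isUpper_of_val hf hv) hlow
        have h3 : Mem (Q.before l) γ ∧ Mem (Q.after l) δ := by
          rw [mem_iff, mem_iff, pos_before, pos_after]
          have n1 := hno γ.1.1
          have n2 := hno δ.1.2
          constructor <;> constructor <;> by_contra hcon <;> rcases hl with hl | hl <;>
            rcases hr with hr | hr <;>
            first | omega | exact n1 (by omega) hl.2 | exact n2 (by omega) hr.2
        have h4 := hc (Q.rightArrow l hf) h3.1 h3.2
        rw [pos_before, pos_after, max_eq_right (Nat.le_succ _)] at h4
        constructor
        · intro h5
          rw [if_pos h5] at h4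
          rw [h4]
          exact one_ne_zero
        · intro h5
          rw [if_neg h5] at h4
          exact sub_eq_zero.1 h4
    have hN0 : ∀ m, m < max γ.1.1.val δ.1.1.val ∨ min γ.1.2.val δ.1.2.val ≤ m → N m = 0 := by
      intro m hm
      by_cases h1 : m < n + 2
      · refine (dif_pos h1).trans (val_hom_eq_zero _ fun h2 => ?_)
        change Mem _ _ ∧ Mem _ _ at h2
        rw [mem_iff, mem_iff, pos_vertex] at h2
        omega
      · exact dif_neg h1
    simp only [Fin.lt_def] at hl hr
    have hlast : min γ.1.2.val δ.1.2.val ≤ n + 1 := by omega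
    have hconst : ∀ d m, m + d = min γ.1.2.val δ.1.2.val → max γ.1.1.val δ.1.1.val ≤ m →
        N m = 0 := by
      intro d
      induction d with
      | zero => exact fun m hm _ => hN0 m (Or.inr hm.ge)
      | succ d ih =>
        intro m hm hm'
        have h1 := (hN ⟨m, by omega⟩ (by simp only; omega) (by simp only; omega)).2
          (by simp only; omega)
        simp only at h1
        rw [h1]
        exact ih (m + 1) (by omega) (by omega)
    obtain ⟨p, hp⟩ : ∃ p, max γ.1.1.val δ.1.1.val = p + 1 :=
      Nat.exists_eq_succ_of_ne_zero (by omega)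
    refine (hN ⟨p, by omega⟩ (by simp only; omega) (by simp only; omega)).1 hp.symm ?_
    rw [hN0 p (Or.inl (by omega)), hconst _ (p + 1) (Nat.add_sub_cancel' (by omega)) hp.le,
      sub_self]
  -- At the first common vertex `E` is a line, so a preimage `m` of the generator is a multiple of
  -- the image of `f`, on which `g` vanishes.
  · obtain ⟨ε, ⟨e⟩⟩ := exists_isomorphic_segmentRep hE
    have hlt'' : max γ.1.1.val δ.1.1.val < n + 2 := by omega
    let x := Q.vertex (max γ.1.1.val δ.1.1.val) hlt''
    have hxγ : Mem x γ := mem_iff.2 (by simp only [x, pos_vertex]; omega)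
    have hxδ : Mem x δ := mem_iff.2 (by simp only [x, pos_vertex]; omega)
    obtain ⟨h1, h2, h3⟩ := hfg x
    obtain ⟨m, hm⟩ := h2 (gen _ _ x)
    have hb : f.app x (gen _ _ x) ≠ 0 := by
      rw [Ne, LinearMap.map_eq_zero_iff _ h1]
      intro h0
      have := val_gen (k := k) hxδ
      rw [h0, map_zero] at this
      exact zero_ne_one this
    have hb' : val (e.app x (f.app x (gen _ _ x))) ≠ 0 := fun h0 => hb <|
      (e.app x).map_eq_zero_iff.1 (val_injective (h0.trans (map_zero _).symm))
    have hm' : m = (val (e.app x m) / val (e.app x (f.app x (gen _ _ x)))) •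
        f.app x (gen _ _ x) := by
      apply (e.app x).injective
      apply val_injective
      rw [map_smul, map_smul, smul_eq_mul, div_mul_cancel₀ _ hb']
    have h4 : g.app x (f.app x (gen _ _ x)) = 0 := by
      rw [← LinearMap.mem_ker, ← h3]
      exact ⟨_, rfl⟩
    rw [hm', map_smul, h4, smul_zero] at hm
    have := val_gen (k := k) hxγ
    rw [← hm, map_zero] at this
    exact zero_ne_one this

end TypeAQuiver

namespace TypeAQuiver

open QuiverRep

variable {n : ℕ} {Q : TypeAQuiver n}

/-! ## The combinatorics of the paths `λ_i(π)` -/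

theorem mem_upper {l : Fin (n + 1)} : l ∈ Q.upper ↔ Q.forward l = true := by simp [upper]

theorem mem_lower {l : Fin (n + 1)} : l ∈ Q.lower ↔ Q.forward l = false := by simp [lower]

theorem isUpper_polygonVertex {l : Fin (n + 1)} :
    Q.IsUpper (polygonVertex l) ↔ Q.forward l = true := by
  refine ⟨?_, fun h => ⟨l, h, rfl⟩⟩
  rintro ⟨l', h, h'⟩
  obtain rfl : l' = l := Fin.ext (Nat.succ.inj (congrArg Fin.val h'))
  exact h

theorem isLower_polygonVertex {l : Fin (n + 1)} :
    Q.IsLower (polygonVertex l) ↔ Q.forward l = false := by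
  refine ⟨?_, fun h => ⟨l, h, rfl⟩⟩
  rintro ⟨l', h, h'⟩
  obtain rfl : l' = l := Fin.ext (Nat.succ.inj (congrArg Fin.val h'))
  exact h

theorem exists_eq_polygonVertex {v : Fin (n + 3)} (h0 : 0 < v.val) (h1 : v.val < n + 2) :
    ∃ l : Fin (n + 1), polygonVertex l = v :=
  ⟨⟨v.val - 1, by omega⟩, Fin.ext (by rw [polygonVertex_val]; simp only; omega)⟩

theorem isUpper_or_isLower {v : Fin (n + 3)} (h0 : 0 < v.val) (h1 : v.val < n + 2) :
    Q.IsUpper v ∨ Q.IsLower v := by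
  obtain ⟨l, rfl⟩ := exists_eq_polygonVertex h0 h1
  rw [isUpper_polygonVertex, isLower_polygonVertex]
  cases Q.forward l <;> simp

/-- Each label is touched exactly once, at the step `π.symm l`: an upper one enters then, a lower
one leaves. This closed form replaces the recursion from here on. -/
theorem mem_pathSupport (π : Equiv.Perm (Fin (n + 1))) (t : Fin (n + 2)) (l : Fin (n + 1)) :
    l ∈ Q.pathSupport π t ↔
      (Q.forward l = true ∧ (π.symm l).val < t.val) ∨
        (Q.forward l = false ∧ t.val ≤ (π.symm l).val) := by
  induction t using Fin.induction with
  | zero =>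
    change l ∈ Q.lower ↔ _
    simp [mem_lower]
  | succ i ih =>
    rw [pathSupport] at ih ⊢
    rw [Fin.induction_succ]
    have hne : l ≠ π i → (π.symm l).val ≠ i.val := fun h h' =>
      h (by rw [← Fin.ext h', Equiv.apply_symm_apply])
    rw [Fin.val_castSucc] at ih
    rw [Fin.val_succ]
    by_cases hl : l = π i
    · subst hl
      rcases hf : Q.forward (π i) with _ | _ <;> simp [mem_upper, hf]
    · have := hne hl
      split_ifs
      · rw [Finset.mem_insert, or_iff_right hl, ih]
        constructor <;> rintro (⟨h1, h2⟩ | ⟨h1, h2⟩) <;>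
          first | exact Or.inl ⟨h1, by omega⟩ | exact Or.inr ⟨h1, by omega⟩
      · rw [Finset.mem_erase, and_iff_right hl, ih]
        constructor <;> rintro (⟨h1, h2⟩ | ⟨h1, h2⟩) <;>
          first | exact Or.inl ⟨h1, by omega⟩ | exact Or.inr ⟨h1, by omega⟩

/-- Path and representation are modified in opposite ways at each step, so the arrows carrying zero
are those whose labels are on the path. -/
theorem identityArrows_eq_compl (π : Equiv.Perm (Fin (n + 1))) (t : Fin (n + 2)) :
    Q.identityArrows π t = (Q.pathSupport π t)ᶜ := by
  induction t using Fin.induction with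
  | zero => rfl
  | succ i ih =>
    rw [identityArrows, pathSupport] at ih ⊢
    rw [Fin.induction_succ, Fin.induction_succ, ih]
    split_ifs
    · rw [Finset.compl_insert]
    · rw [Finset.compl_erase]

theorem mem_identityArrows (π : Equiv.Perm (Fin (n + 1))) (t : Fin (n + 2)) (l : Fin (n + 1)) :
    l ∈ Q.identityArrows π t ↔
      (Q.forward l = true ∧ t.val ≤ (π.symm l).val) ∨
        (Q.forward l = false ∧ (π.symm l).val < t.val) := by
  rw [identityArrows_eq_compl, Finset.mem_compl, mem_pathSupport]
  cases Q.forward l <;> simp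

theorem zero_mem_pathVertices (π : Equiv.Perm (Fin (n + 1))) (t : Fin (n + 2)) :
    0 ∈ Q.pathVertices π t := by simp [pathVertices]

theorem last_mem_pathVertices (π : Equiv.Perm (Fin (n + 1))) (t : Fin (n + 2)) :
    Fin.last (n + 2) ∈ Q.pathVertices π t := by simp [pathVertices]

theorem polygonVertex_injective : Function.Injective (polygonVertex (n := n)) := fun _ _ h =>
  Fin.ext (Nat.succ.inj (congrArg Fin.val h))

theorem polygonVertex_mem_pathVertices (π : Equiv.Perm (Fin (n + 1))) (t : Fin (n + 2))
    (l : Fin (n + 1)) : polygonVertex l ∈ Q.pathVertices π t ↔ l ∈ Q.pathSupport π t := by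
  have h0 : polygonVertex l ≠ 0 := fun h => by
    have := congrArg Fin.val h
    rw [polygonVertex_val] at this
    simp at this
  have h1 : polygonVertex l ≠ Fin.last (n + 2) := fun h => by
    have := congrArg Fin.val h
    rw [polygonVertex_val, Fin.val_last] at this
    omega
  rw [pathVertices, Finset.mem_union, Finset.mem_insert, Finset.mem_singleton,
    or_iff_right (by tauto), polygonVertex_injective.mem_finset_image]

theorem mem_path {π : Equiv.Perm (Fin (n + 1))} {t : Fin (n + 2)} {γ : Segment n} :
    γ ∈ Q.path π t ↔ γ.1.1 ∈ Q.pathVertices π t ∧ γ.1.2 ∈ Q.pathVertices π t ∧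
      ∀ c ∈ Q.pathVertices π t, ¬ (γ.1.1 < c ∧ c < γ.1.2) := by
  simp [path]

theorem mem_eta {π : Equiv.Perm (Fin (n + 1))} {γ : Segment n} :
    γ ∈ Q.eta π ↔ ∃ t, γ ∈ Q.path π t := by
  simp [eta]

theorem IsUpper.mem_pathVertices {π : Equiv.Perm (Fin (n + 1))} {s t : Fin (n + 2)} (hst : s ≤ t)
    {v : Fin (n + 3)} (hv : Q.IsUpper v) (h : v ∈ Q.pathVertices π s) :
    v ∈ Q.pathVertices π t := by
  obtain ⟨l, hl, rfl⟩ := hv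
  rw [polygonVertex_mem_pathVertices, mem_pathSupport] at h ⊢
  simp only [hl, true_and, Bool.true_eq_false, false_and, or_false] at h ⊢
  exact h.trans_le hst

theorem IsLower.mem_pathVertices {π : Equiv.Perm (Fin (n + 1))} {s t : Fin (n + 2)} (hst : s ≤ t)
    {v : Fin (n + 3)} (hv : Q.IsLower v) (h : v ∈ Q.pathVertices π t) :
    v ∈ Q.pathVertices π s := by
  obtain ⟨l, hl, rfl⟩ := hv
  rw [polygonVertex_mem_pathVertices, mem_pathSupport] at h ⊢
  simp only [hl, true_and, Bool.false_eq_true, false_and, false_or] at h ⊢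
  exact (Fin.le_def.1 hst).trans h

theorem CrossUp.lt {up low : Fin (n + 3) → Prop} {γ δ : Segment n} (h : CrossUp up low γ δ) :
    γ.1.1 < δ.1.2 ∧ δ.1.1 < γ.1.2 := by
  have := h.1
  rw [lt_min_iff, max_lt_iff, max_lt_iff] at this
  exact ⟨this.2.1, this.1.2⟩

/-- Reflection in the horizontal line, which is why `CrossUp` has the upper and lower vertices as
parameters. -/
theorem crossUp_swap {up low : Fin (n + 3) → Prop} {γ δ : Segment n} :
    CrossUp low up γ δ ↔ CrossUp up low δ γ := by
  rw [CrossUp, CrossUp, max_comm, min_comm]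
  tauto

/-- Upper vertices persist into later paths and lower ones come from earlier paths. The end point
witnessing a crossing would thus lie strictly inside the other segment while being a vertex of the
same path. -/
theorem not_crossUp_of_mem_path {π : Equiv.Perm (Fin (n + 1))} {s t : Fin (n + 2)} (hst : s ≤ t)
    {γ δ : Segment n} (hγ : γ ∈ Q.path π s) (hδ : δ ∈ Q.path π t) :
    ¬ CrossUp Q.IsUpper Q.IsLower γ δ ∧ ¬ CrossUp Q.IsUpper Q.IsLower δ γ := by
  obtain ⟨hγ1, hγ2, hγ⟩ := mem_path.1 hγ
  obtain ⟨hδ1, hδ2, hδ⟩ := mem_path.1 hδ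
  constructor
  · intro h
    rcases h.2.2 with ⟨h1, h2⟩ | ⟨h1, h2⟩
    · exact hδ _ (h2.mem_pathVertices hst hγ2) ⟨h.lt.2, h1⟩
    · exact hγ _ (h2.mem_pathVertices hst hδ2) ⟨h.lt.1, h1⟩
  · intro h
    rcases h.2.1 with ⟨h1, h2⟩ | ⟨h1, h2⟩
    · exact hδ _ (h2.mem_pathVertices hst hγ1) ⟨h1, h.lt.2⟩
    · exact hγ _ (h2.mem_pathVertices hst hδ1) ⟨h1, h.lt.1⟩

theorem not_crossUp_of_mem_eta {π : Equiv.Perm (Fin (n + 1))} {γ δ : Segment n}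
    (hγ : γ ∈ Q.eta π) (hδ : δ ∈ Q.eta π) : ¬ CrossUp Q.IsUpper Q.IsLower γ δ := by
  obtain ⟨s, hγ⟩ := mem_eta.1 hγ
  obtain ⟨t, hδ⟩ := mem_eta.1 hδ
  rcases le_total s t with h | h
  · exact (not_crossUp_of_mem_path h hγ hδ).1
  · exact (not_crossUp_of_mem_path h hδ hγ).2

/-- A path that is below the segment `γ` at `a` and above it at `b > a` crosses it upwards. -/
theorem exists_crossUp {up low V : Fin (n + 3) → Prop} (h0 : V 0) (hlast : V (Fin.last (n + 2)))
    (hul : ∀ v : Fin (n + 3), 0 < v.val → v.val < n + 2 → up v ∨ low v) (γ : Segment n)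
    {a b : Fin (n + 3)} (hab : a < b)
    (ha : (a = γ.1.1 ∨ a = γ.1.2) ∧ up a ∧ ¬ V a ∨ (γ.1.1 < a ∧ a < γ.1.2) ∧ low a ∧ V a)
    (hb : (b = γ.1.1 ∨ b = γ.1.2) ∧ low b ∧ ¬ V b ∨ (γ.1.1 < b ∧ b < γ.1.2) ∧ up b ∧ V b) :
    ∃ δ : Segment n, (V δ.1.1 ∧ V δ.1.2 ∧ ∀ c, V c → ¬ (δ.1.1 < c ∧ c < δ.1.2)) ∧
      CrossUp up low δ γ := by
  classical
  -- Induction on the distance of `a` and `b`: a path vertex `c` between them is upper or lower, so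
  -- the path is above or below `γ` there and `c` can replace `b` or `a`.
  obtain ⟨d, hd⟩ : ∃ d, b.val - a.val = d := ⟨_, rfl⟩
  induction d using Nat.strong_induction_on generalizing a b with
  | _ d ih =>
  have hγ := γ.2
  have hia : γ.1.1 ≤ a := by
    rcases ha with ⟨rfl | rfl, -⟩ | ⟨⟨h, -⟩, -⟩
    · exact le_rfl
    · exact hγ.le
    · exact h.le
  have hbj : b ≤ γ.1.2 := by
    rcases hb with ⟨rfl | rfl, -⟩ | ⟨⟨-, h⟩, -⟩
    · exact hγ.le
    · exact le_rfl
    · exact h.le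
  by_cases hc : ∃ c, V c ∧ a < c ∧ c < b
  · obtain ⟨c, hVc, hac, hcb⟩ := hc
    have hic := hia.trans_lt hac
    have hcj := hcb.trans_le hbj
    have hc := hul c (by rw [Fin.lt_def] at hic; omega) (by rw [Fin.lt_def] at hcj; omega)
    rw [Fin.lt_def] at hac hcb
    rcases hc with hc | hc
    · exact ih (c.val - a.val) (by omega) (Fin.lt_def.2 hac) ha (Or.inr ⟨⟨hic, hcj⟩, hc, hVc⟩) rfl
    · exact ih (b.val - c.val) (by omega) (Fin.lt_def.2 hcb) (Or.inr ⟨⟨hic, hcj⟩, hc, hVc⟩) hb rfl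
  -- With no path vertex in between, the crossing segment joins the last path vertex up to `a` to
  -- the first one from `b` on.
  · push Not at hc
    obtain ⟨p, hp, hpmax⟩ := (Finset.univ.filter fun c => V c ∧ c ≤ a).exists_max_image id
      ⟨0, by simp [h0]⟩
    obtain ⟨q, hq, hqmin⟩ := (Finset.univ.filter fun c => V c ∧ b ≤ c).exists_min_image id
      ⟨Fin.last _, by simp [hlast, Fin.le_last]⟩
    simp only [Finset.mem_filter, Finset.mem_univ, true_and, id, and_imp] at hp hpmax hq hqmin
    have hpq : p < q := hp.2.trans_lt (hab.trans_le hq.2)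
    refine ⟨⟨(p, q), hpq⟩, ⟨hp.1, hq.1, fun c hVc ⟨h1, h2⟩ => ?_⟩, ?_, ?_, ?_⟩
    · rcases le_or_gt c a with h | h
      · exact absurd (hpmax c hVc h) (not_le.2 h1)
      rcases lt_or_ge c b with h' | h'
      · exact absurd (hc c hVc h) (not_le.2 h')
      · exact absurd (hqmin c hVc h') (not_le.2 h2)
    · exact max_lt_iff.2 ⟨lt_min_iff.2 ⟨hpq, hp.2.trans_lt (hab.trans_le hbj)⟩,
        lt_min_iff.2 ⟨hia.trans_lt (hab.trans_le hq.2), hγ⟩⟩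
    · rcases ha with ⟨h, hup, hVa⟩ | ⟨⟨h, -⟩, hlow, hVa⟩
      · obtain rfl | rfl := h
        · exact Or.inl ⟨lt_of_le_of_ne hp.2 fun h => hVa (h ▸ hp.1), hup⟩
        · exact absurd hab (not_lt.2 hbj)
      · obtain rfl := le_antisymm hp.2 (hpmax a hVa le_rfl)
        exact Or.inr ⟨h, hlow⟩
    · rcases hb with ⟨h, hlow, hVb⟩ | ⟨⟨-, h⟩, hup, hVb⟩
      · obtain rfl | rfl := h
        · exact absurd hab (not_lt.2 hia)
        · exact Or.inr ⟨lt_of_le_of_ne hq.2 fun h => hVb (h ▸ hq.1), hlow⟩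
      · obtain rfl := le_antisymm hq.2 (hqmin b hVb le_rfl)
        exact Or.inl ⟨h, hup⟩

/-- A segment is on the path at time `t` if certain labels `A` have already changed status and
others, `B`, have not. Such a `t` exists once every `A` label changes before every `B` label; a pair
in the wrong order yields a path crossing the segment. -/
theorem mem_eta_of_not_crossUp {π : Equiv.Perm (Fin (n + 1))} {γ : Segment n}
    (h : ∀ δ ∈ Q.eta π, ¬ CrossUp Q.IsUpper Q.IsLower γ δ ∧ ¬ CrossUp Q.IsUpper Q.IsLower δ γ) :
    γ ∈ Q.eta π := by
  classical
  have hγ := γ.2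
  -- `A`: upper end points have to enter and lower vertices strictly inside have to leave. `B` is
  -- the same with upper and lower exchanged: these must not have changed yet.
  let A : Fin (n + 1) → Prop := fun l =>
    (polygonVertex l = γ.1.1 ∨ polygonVertex l = γ.1.2) ∧ Q.forward l = true ∨
      (γ.1.1 < polygonVertex l ∧ polygonVertex l < γ.1.2) ∧ Q.forward l = false
  let B : Fin (n + 1) → Prop := fun l =>
    (polygonVertex l = γ.1.1 ∨ polygonVertex l = γ.1.2) ∧ Q.forward l = false ∨
      (γ.1.1 < polygonVertex l ∧ polygonVertex l < γ.1.2) ∧ Q.forward l = true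
  have hul : ∀ v : Fin (n + 3), 0 < v.val → v.val < n + 2 → Q.IsUpper v ∨ Q.IsLower v :=
    fun v => isUpper_or_isLower
  have hAB : ∀ a b, A a → B b → (π.symm a).val < (π.symm b).val := by
    intro a b ha hb
    by_contra hlt
    have hne : a ≠ b := by
      rintro rfl
      have h1 : ∀ {x y : Fin (n + 3)}, (polygonVertex a = x ∨ polygonVertex a = y) →
          ¬ (x < polygonVertex a ∧ polygonVertex a < y) := by
        rintro x y (rfl | rfl) ⟨h, h'⟩
        · exact lt_irrefl _ h
        · exact lt_irrefl _ h'
      rcases ha with ⟨h2, h3⟩ | ⟨h2, h3⟩ <;> rcases hb with ⟨h4, h5⟩ | ⟨h4, h5⟩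
      · rw [h3] at h5
        cases h5
      · exact h1 h2 h4
      · exact h1 h4 h2
      · rw [h3] at h5
        cases h5
    have hne' : (π.symm a).val ≠ (π.symm b).val := fun h => hne (π.symm.injective (Fin.ext h))
    -- The path just before the step of `a`: here `a` has not changed yet, but `b` already has.
    have hVa := polygonVertex_mem_pathVertices (Q := Q) π (π.symm a).castSucc a
    have hVb := polygonVertex_mem_pathVertices (Q := Q) π (π.symm a).castSucc b
    rw [mem_pathSupport, Fin.val_castSucc] at hVa hVb
    set V : Fin (n + 3) → Prop := fun v => v ∈ Q.pathVertices π (π.symm a).castSucc with hV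
    have ha' : (polygonVertex a = γ.1.1 ∨ polygonVertex a = γ.1.2) ∧ Q.IsUpper (polygonVertex a) ∧
        ¬ V (polygonVertex a) ∨ (γ.1.1 < polygonVertex a ∧ polygonVertex a < γ.1.2) ∧
        Q.IsLower (polygonVertex a) ∧ V (polygonVertex a) := by
      rw [isUpper_polygonVertex, isLower_polygonVertex, hV]
      simp only [hVa]
      rcases ha with ⟨h2, h3⟩ | ⟨h2, h3⟩
      · exact Or.inl ⟨h2, h3, by simp [h3]⟩
      · exact Or.inr ⟨h2, h3, by simp [h3]⟩
    have hb' : (polygonVertex b = γ.1.1 ∨ polygonVertex b = γ.1.2) ∧ Q.IsLower (polygonVertex b) ∧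
        ¬ V (polygonVertex b) ∨ (γ.1.1 < polygonVertex b ∧ polygonVertex b < γ.1.2) ∧
        Q.IsUpper (polygonVertex b) ∧ V (polygonVertex b) := by
      rw [isUpper_polygonVertex, isLower_polygonVertex, hV]
      simp only [hVb]
      rcases hb with ⟨h2, h3⟩ | ⟨h2, h3⟩
      · exact Or.inl ⟨h2, h3, by simp only [h3]; simp; omega⟩
      · exact Or.inr ⟨h2, h3, by simp only [h3]; simp; omega⟩
    have h0 : V 0 := zero_mem_pathVertices π _
    have hl : V (Fin.last (n + 2)) := last_mem_pathVertices π _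
    -- The path is below `γ` at `a` and above it at `b`. If `b` comes first, the crossing is
    -- downwards, treated by reflection.
    rcases lt_or_gt_of_ne (polygonVertex_injective.ne hne) with hlt | hlt
    · obtain ⟨δ, hδ, hcr⟩ := exists_crossUp h0 hl hul γ hlt ha' hb'
      exact (h δ (mem_eta.2 ⟨_, mem_path.2 hδ⟩)).2 hcr
    · obtain ⟨δ, hδ, hcr⟩ := exists_crossUp h0 hl (fun v h h' => (hul v h h').symm) γ hlt hb' ha'
      exact (h δ (mem_eta.2 ⟨_, mem_path.2 hδ⟩)).1 (crossUp_swap.1 hcr)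
  obtain ⟨t, ht1, ht2⟩ : ∃ t : Fin (n + 2), (∀ a, A a → (π.symm a).val < t.val) ∧
      ∀ b, B b → t.val ≤ (π.symm b).val := by
    -- The time is right after the last change of an `A` label, or 0 if there is none.
    have hsup : (Finset.univ.filter A).sup (fun a => (π.symm a).val + 1) < n + 2 :=
      Nat.lt_succ_of_le (Finset.sup_le fun a _ => (π.symm a).2)
    refine ⟨⟨_, hsup⟩, fun a ha => ?_, fun b hb => ?_⟩
    · exact Nat.lt_of_succ_le (Finset.le_sup (f := fun a => (π.symm a).val + 1)
        (Finset.mem_filter.2 ⟨Finset.mem_univ a, ha⟩))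
    · change (Finset.univ.filter A).sup (fun a => (π.symm a).val + 1) ≤ _
      refine Finset.sup_le fun a ha => ?_
      exact hAB a b (Finset.mem_filter.1 ha).2 hb
  have hend : ∀ v, (v = γ.1.1 ∨ v = γ.1.2) → v ∈ Q.pathVertices π t := by
    intro v hv
    by_cases h0 : v = 0
    · rw [h0]
      exact zero_mem_pathVertices π t
    by_cases hl : v = Fin.last (n + 2)
    · rw [hl]
      exact last_mem_pathVertices π t
    obtain ⟨l, rfl⟩ := exists_eq_polygonVertex (v := v) (Nat.pos_of_ne_zero fun h => h0 (Fin.ext h))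
      (lt_of_le_of_ne (Nat.lt_succ_iff.1 v.2) fun h => hl (Fin.ext h))
    rw [polygonVertex_mem_pathVertices, mem_pathSupport]
    rcases hf : Q.forward l with _ | _
    · exact Or.inr ⟨rfl, ht2 l (Or.inl ⟨hv, hf⟩)⟩
    · exact Or.inl ⟨rfl, ht1 l (Or.inl ⟨hv, hf⟩)⟩
  refine mem_eta.2 ⟨t, mem_path.2 ⟨hend _ (Or.inl rfl), hend _ (Or.inr rfl), fun c hc hcγ => ?_⟩⟩
  have h1 := Fin.lt_def.1 hcγ.1
  have h2 := Fin.lt_def.1 hcγ.2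
  obtain ⟨l, rfl⟩ := exists_eq_polygonVertex (v := c) (by omega) (by omega)
  rw [polygonVertex_mem_pathVertices, mem_pathSupport] at hc
  rcases hf : Q.forward l with _ | _
  · have := ht1 l (Or.inr ⟨hcγ, hf⟩)
    simp only [hf, true_and, Bool.false_eq_true, false_and, false_or] at hc
    omega
  · have := ht2 l (Or.inr ⟨hcγ, hf⟩)
    simp only [hf, true_and, Bool.true_eq_false, false_and, or_false] at hc
    omega

end TypeAQuiver

namespace TypeAQuiver

variable {n : ℕ} {Q : TypeAQuiver n}

/-! ## The geometry of the polygon `P(Q)` -/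

/-- The height at `x` of the line through `p` and `q`. -/
noncomputable def lineHeight (p q : ℝ × ℝ) (x : ℝ) : ℝ :=
  p.2 + (q.2 - p.2) / (q.1 - p.1) * (x - p.1)

theorem lineHeight_left (p q : ℝ × ℝ) : lineHeight p q p.1 = p.2 := by simp [lineHeight]

theorem lineHeight_right {p q : ℝ × ℝ} (h : p.1 < q.1) : lineHeight p q q.1 = q.2 := by
  have : q.1 - p.1 ≠ 0 := (sub_pos.2 h).ne'
  rw [lineHeight, div_mul_cancel₀ _ this]
  ring

theorem lineHeight_combination (p q : ℝ × ℝ) {s t : ℝ} (h : s + t = 1) (x y : ℝ) :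
    lineHeight p q (s * x + t * y) = s * lineHeight p q x + t * lineHeight p q y := by
  obtain rfl : s = 1 - t := by linarith
  simp only [lineHeight]
  ring

theorem exists_combination {a b x : ℝ} (h1 : a < x) (h2 : x < b) :
    ∃ s t : ℝ, 0 < s ∧ 0 < t ∧ s + t = 1 ∧ s * a + t * b = x := by
  have h : 0 < b - a := by linarith
  refine ⟨(b - x) / (b - a), (x - a) / (b - a), div_pos (by linarith) h, div_pos (by linarith) h,
    ?_, ?_⟩
  · field_simp
    ring
  · field_simp
    ring

/-- An open segment is the graph of an affine function over an open interval, so crossings become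
comparisons of heights. -/
theorem mem_openSegment_iff {p q r : ℝ × ℝ} (h : p.1 < q.1) :
    r ∈ openSegment ℝ p q ↔ (p.1 < r.1 ∧ r.1 < q.1) ∧ r.2 = lineHeight p q r.1 := by
  have hcomb : ∀ {s t : ℝ}, s + t = 1 → lineHeight p q (s * p.1 + t * q.1) = s * p.2 + t * q.2 :=
    fun {s t} hst => by rw [lineHeight_combination p q hst, lineHeight_left, lineHeight_right h]
  constructor
  · rintro ⟨s, t, hs, ht, hst, rfl⟩
    change (p.1 < s * p.1 + t * q.1 ∧ s * p.1 + t * q.1 < q.1) ∧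
      s * p.2 + t * q.2 = lineHeight p q (s * p.1 + t * q.1)
    obtain rfl : s = 1 - t := by linarith
    exact ⟨⟨by nlinarith, by nlinarith⟩, (hcomb hst).symm⟩
  · rintro ⟨⟨h1, h2⟩, h3⟩
    obtain ⟨s, t, hs, ht, hst, hx⟩ := exists_combination h1 h2
    refine ⟨s, t, hs, ht, hst, Prod.ext hx ?_⟩
    rw [h3, ← hx, hcomb hst]
    rfl

namespace Polygon

variable (P : Q.Polygon)

/-- The height of the line through the end points of a segment. -/
noncomputable def height (γ : Segment n) (x : ℝ) : ℝ := lineHeight (P.pt γ.1.1) (P.pt γ.1.2) x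

theorem fst_lt_iff {u v : Fin (n + 3)} : (P.pt u).1 < (P.pt v).1 ↔ u < v :=
  P.left_to_right.lt_iff_lt

theorem height_left (γ : Segment n) : P.height γ (P.pt γ.1.1).1 = (P.pt γ.1.1).2 :=
  lineHeight_left _ _

theorem height_right (γ : Segment n) : P.height γ (P.pt γ.1.2).1 = (P.pt γ.1.2).2 :=
  lineHeight_right (P.fst_lt_iff.2 γ.2)

theorem point_mem_convexHull {s : Set (ℝ × ℝ)} {u v : Fin (n + 3)} (hu : P.pt u ∈ s)
    (hv : P.pt v ∈ s) {x : ℝ} (h1 : (P.pt u).1 < x) (h2 : x < (P.pt v).1) :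
    (x, lineHeight (P.pt u) (P.pt v) x) ∈ convexHull ℝ s := by
  have : (x, lineHeight (P.pt u) (P.pt v) x) ∈ openSegment ℝ (P.pt u) (P.pt v) :=
    (mem_openSegment_iff (h1.trans h2)).2 ⟨⟨h1, h2⟩, rfl⟩
  exact (convex_convexHull ℝ s).segment_subset (subset_convexHull ℝ s hu)
    (subset_convexHull ℝ s hv) (openSegment_subset_segment ℝ _ _ this)

/-- No vertex of a convex polygon lies between the line `L` and a line segment. -/
theorem not_between (γ : Segment n) {v : Fin (n + 3)} (h1 : γ.1.1 < v) (h2 : v < γ.1.2)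
    {s t : ℝ} (hs : 0 ≤ s) (ht : 0 ≤ t) (hst : s + t = 1) :
    (P.pt v).2 ≠ s * (P.pt 0).2 + t * P.height γ (P.pt v).1 := by
  intro h
  have hv0 : (0 : Fin (n + 3)) < v := (Fin.zero_le _).trans_lt h1
  have hvl : v < Fin.last (n + 2) := h2.trans_le (Fin.le_last _)
  -- Such a vertex would lie in the convex hull of the end points of `L` and of `γ`, none of which
  -- it is, against convex independence.
  let S : Set (Fin (n + 3)) := {0, Fin.last (n + 2), γ.1.1, γ.1.2}
  have hB := P.point_mem_convexHull (s := P.pt '' S) (u := 0) (v := Fin.last (n + 2))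
    ⟨_, by simp [S], rfl⟩ ⟨_, by simp [S], rfl⟩ (P.fst_lt_iff.2 hv0) (P.fst_lt_iff.2 hvl)
  have hA := P.point_mem_convexHull (s := P.pt '' S) (u := γ.1.1) (v := γ.1.2)
    ⟨_, by simp [S], rfl⟩ ⟨_, by simp [S], rfl⟩ (P.fst_lt_iff.2 h1) (P.fst_lt_iff.2 h2)
  have h0 : lineHeight (P.pt 0) (P.pt (Fin.last (n + 2))) (P.pt v).1 = (P.pt 0).2 := by
    simp [lineHeight, P.horizontal]
  rw [h0] at hB
  have hv := (convex_convexHull ℝ (P.pt '' S)) hB hA hs ht hst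
  have e : s • ((P.pt v).1, (P.pt 0).2) + t • ((P.pt v).1, lineHeight (P.pt γ.1.1) (P.pt γ.1.2)
      (P.pt v).1) = P.pt v := by
    refine Prod.ext ?_ h.symm
    change s * (P.pt v).1 + t * (P.pt v).1 = (P.pt v).1
    rw [← add_mul, hst, one_mul]
  rw [e] at hv
  rcases P.convex S v hv with rfl | rfl | rfl | rfl
  · exact lt_irrefl _ hv0
  · exact lt_irrefl _ hvl
  · exact lt_irrefl _ h1
  · exact lt_irrefl _ h2

/-- The vertex is above `L`, so if it were not above the segment it would lie between the two, which
`not_between` excludes. -/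
theorem height_lt (γ : Segment n) {v : Fin (n + 3)} (h1 : γ.1.1 < v) (h2 : v < γ.1.2)
    (hv : Q.IsUpper v) : P.height γ (P.pt v).1 < (P.pt v).2 := by
  by_contra! hle
  have h0 : (P.pt 0).2 < (P.pt v).2 := by
    obtain ⟨l, hl, rfl⟩ := hv
    exact P.above l (mem_upper.2 hl)
  rcases hle.eq_or_lt with h | h
  · exact P.not_between γ h1 h2 le_rfl zero_le_one (zero_add 1) (by rw [← h]; ring)
  · obtain ⟨s, t, hs, ht, hst, hx⟩ := exists_combination h0 h
    exact P.not_between γ h1 h2 hs.le ht.le hst hx.symm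

theorem lt_height (γ : Segment n) {v : Fin (n + 3)} (h1 : γ.1.1 < v) (h2 : v < γ.1.2)
    (hv : Q.IsLower v) : (P.pt v).2 < P.height γ (P.pt v).1 := by
  by_contra! hle
  have h0 : (P.pt v).2 < (P.pt 0).2 := by
    obtain ⟨l, hl, rfl⟩ := hv
    exact P.below l (mem_lower.2 hl)
  rcases hle.eq_or_lt with h | h
  · exact P.not_between γ h1 h2 le_rfl zero_le_one (zero_add 1) (by rw [← h]; ring)
  · obtain ⟨s, t, hs, ht, hst, hx⟩ := exists_combination h h0
    exact P.not_between γ h1 h2 ht.le hs.le (by rw [add_comm, hst]) (by rw [← hx]; ring)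

variable {P} {γ δ : Segment n}

/-- At the later of the two left end points one height is that of the vertex itself, and the vertex
is upper or lower relative to the other segment. -/
theorem height_left_lt (h1 : γ.1.1 < δ.1.2) (h2 : δ.1.1 < γ.1.2)
    (h : γ.1.1 < δ.1.1 ∧ Q.IsUpper δ.1.1 ∨ δ.1.1 < γ.1.1 ∧ Q.IsLower γ.1.1) :
    P.height γ (P.pt (max γ.1.1 δ.1.1)).1 < P.height δ (P.pt (max γ.1.1 δ.1.1)).1 := by
  rcases h with ⟨h, hv⟩ | ⟨h, hv⟩
  · rw [max_eq_right h.le, height_left]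
    exact P.height_lt γ h h2 hv
  · rw [max_eq_left h.le, height_left]
    exact P.lt_height δ h h1 hv

theorem height_right_lt (h1 : γ.1.1 < δ.1.2) (h2 : δ.1.1 < γ.1.2)
    (h : γ.1.2 < δ.1.2 ∧ Q.IsUpper γ.1.2 ∨ δ.1.2 < γ.1.2 ∧ Q.IsLower δ.1.2) :
    P.height δ (P.pt (min γ.1.2 δ.1.2)).1 < P.height γ (P.pt (min γ.1.2 δ.1.2)).1 := by
  rcases h with ⟨h, hv⟩ | ⟨h, hv⟩
  · rw [min_eq_left h.le, height_right]
    exact P.height_lt δ h2 h hv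
  · rw [min_eq_right h.le, height_right]
    exact P.lt_height γ h1 h hv

theorem height_combination (γ : Segment n) {s t : ℝ} (h : s + t = 1) (x y : ℝ) :
    P.height γ (s * x + t * y) = s * P.height γ x + t * P.height γ y :=
  lineHeight_combination _ _ h x y

theorem not_nonCrossing_of_crossUp (h : CrossUp Q.IsUpper Q.IsLower γ δ) :
    ¬ P.NonCrossing γ δ := by
  have hl := height_left_lt (P := P) h.lt.1 h.lt.2 h.2.1
  have hr := height_right_lt (P := P) h.lt.1 h.lt.2 h.2.2
  have hlt := P.fst_lt_iff.2 h.1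
  set a := (P.pt (max γ.1.1 δ.1.1)).1 with ha
  set b := (P.pt (min γ.1.2 δ.1.2)).1 with hb
  -- The difference of heights is negative at `a` and positive at `b`; the weights that combine
  -- these values to 0 locate the crossing point.
  obtain ⟨s, t, hs, ht, hst, h0⟩ := exists_combination (x := 0)
    (sub_neg.2 hl) (sub_pos.2 hr)
  have hx : P.height γ (s * a + t * b) = P.height δ (s * a + t * b) := by
    rw [height_combination γ hst, height_combination δ hst]
    linarith
  have h1 : a < s * a + t * b := by
    obtain rfl : s = 1 - t := by linarith
    nlinarith
  have h2 : s * a + t * b < b := by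
    obtain rfl : t = 1 - s := by linarith
    nlinarith
  have hγa : (P.pt γ.1.1).1 ≤ a := P.left_to_right.monotone (le_max_left _ _)
  have hδa : (P.pt δ.1.1).1 ≤ a := P.left_to_right.monotone (le_max_right _ _)
  have hγb : b ≤ (P.pt γ.1.2).1 := P.left_to_right.monotone (min_le_left _ _)
  have hδb : b ≤ (P.pt δ.1.2).1 := P.left_to_right.monotone (min_le_right _ _)
  rw [NonCrossing, Set.not_disjoint_iff]
  exact ⟨(s * a + t * b, P.height γ (s * a + t * b)),
    (mem_openSegment_iff (P.fst_lt_iff.2 γ.2)).2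
      ⟨⟨hγa.trans_lt h1, h2.trans_le hγb⟩, rfl⟩,
    (mem_openSegment_iff (P.fst_lt_iff.2 δ.2)).2
      ⟨⟨hδa.trans_lt h1, h2.trans_le hδb⟩, hx⟩⟩

/-- A common interior point is a zero of the affine difference of heights inside the overlap. So the
difference vanishes at both ends, making the segments equal, or has opposite signs there, which is
`CrossUp` in one direction. -/
theorem nonCrossing_of_not_crossUp (hne : γ ≠ δ) (h : ¬ CrossUp Q.IsUpper Q.IsLower γ δ)
    (h' : ¬ CrossUp Q.IsUpper Q.IsLower δ γ) : P.NonCrossing γ δ := by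
  rw [NonCrossing, Set.disjoint_iff_forall_ne]
  rintro r hrγ _ hrδ rfl
  obtain ⟨⟨h1, h2⟩, h3⟩ := (mem_openSegment_iff (P.fst_lt_iff.2 γ.2)).1 hrγ
  obtain ⟨⟨h4, h5⟩, h6⟩ := (mem_openSegment_iff (P.fst_lt_iff.2 δ.2)).1 hrδ
  have hγδ : γ.1.1 < δ.1.2 := P.fst_lt_iff.1 (h1.trans h5)
  have hδγ : δ.1.1 < γ.1.2 := P.fst_lt_iff.1 (h4.trans h2)
  have hov : max γ.1.1 δ.1.1 < min γ.1.2 δ.1.2 :=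
    max_lt_iff.2 ⟨lt_min_iff.2 ⟨γ.2, hγδ⟩, lt_min_iff.2 ⟨hδγ, δ.2⟩⟩
  have ha : (P.pt (max γ.1.1 δ.1.1)).1 < r.1 := by
    rcases max_choice γ.1.1 δ.1.1 with e | e <;> rwa [e]
  have hb : r.1 < (P.pt (min γ.1.2 δ.1.2)).1 := by
    rcases min_choice γ.1.2 δ.1.2 with e | e <;> rwa [e]
  obtain ⟨s, t, hs, ht, hst, hx⟩ := exists_combination ha hb
  have hz : P.height γ r.1 = P.height δ r.1 := h3.symm.trans h6
  rw [← hx, height_combination γ hst, height_combination δ hst] at hz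
  have hL : γ.1.1 = δ.1.1 ∨ (γ.1.1 < δ.1.1 ∧ Q.IsUpper δ.1.1 ∨ δ.1.1 < γ.1.1 ∧ Q.IsLower γ.1.1) ∨
      (δ.1.1 < γ.1.1 ∧ Q.IsUpper γ.1.1 ∨ γ.1.1 < δ.1.1 ∧ Q.IsLower δ.1.1) := by
    rw [Fin.lt_def] at hγδ hδγ
    rcases lt_trichotomy γ.1.1 δ.1.1 with hlt | heq | hlt
    · have := isUpper_or_isLower (Q := Q) (v := δ.1.1) (by rw [Fin.lt_def] at hlt; omega) (by omega)
      tauto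
    · exact Or.inl heq
    · have := isUpper_or_isLower (Q := Q) (v := γ.1.1) (by rw [Fin.lt_def] at hlt; omega) (by omega)
      tauto
  have hR : γ.1.2 = δ.1.2 ∨ (γ.1.2 < δ.1.2 ∧ Q.IsUpper γ.1.2 ∨ δ.1.2 < γ.1.2 ∧ Q.IsLower δ.1.2) ∨
      (δ.1.2 < γ.1.2 ∧ Q.IsUpper δ.1.2 ∨ γ.1.2 < δ.1.2 ∧ Q.IsLower γ.1.2) := by
    rw [Fin.lt_def] at hγδ hδγ
    rcases lt_trichotomy γ.1.2 δ.1.2 with hlt | heq | hlt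
    · have := isUpper_or_isLower (Q := Q) (v := γ.1.2) (by omega) (by rw [Fin.lt_def] at hlt; omega)
      tauto
    · exact Or.inl heq
    · have := isUpper_or_isLower (Q := Q) (v := δ.1.2) (by omega) (by rw [Fin.lt_def] at hlt; omega)
      tauto
  have hov' := hov
  rw [max_comm, min_comm] at hov'
  have eL : γ.1.1 = δ.1.1 → P.height γ (P.pt (max γ.1.1 δ.1.1)).1 =
      P.height δ (P.pt (max γ.1.1 δ.1.1)).1 := fun e => by
    rw [e, max_self, P.height_left δ, ← e, P.height_left γ]
  have eR : γ.1.2 = δ.1.2 → P.height γ (P.pt (min γ.1.2 δ.1.2)).1 =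
      P.height δ (P.pt (min γ.1.2 δ.1.2)).1 := fun e => by
    rw [e, min_self, P.height_right δ, ← e, P.height_right γ]
  rcases hL with hL | hL | hL
  · rcases hR with hR | hR | hR
    · exact hne (Subtype.ext (Prod.ext hL hR))
    · have := height_right_lt (P := P) hγδ hδγ hR
      rw [eL hL] at hz
      nlinarith
    · have := height_right_lt (P := P) hδγ hγδ hR
      rw [min_comm] at this
      rw [eL hL] at hz
      nlinarith
  · have hl := height_left_lt (P := P) hγδ hδγ hL
    rcases hR with hR | hR | hR
    · rw [eR hR] at hz
      nlinarith
    · exact h ⟨hov, hL, hR⟩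
    · have := height_right_lt (P := P) hδγ hγδ hR
      rw [min_comm] at this
      nlinarith
  · have hl := height_left_lt (P := P) hδγ hγδ hL
    rw [max_comm] at hl
    rcases hR with hR | hR | hR
    · rw [eR hR] at hz
      nlinarith
    · have := height_right_lt (P := P) hγδ hδγ hR
      nlinarith
    · exact h' ⟨hov', hL, hR⟩

end Polygon

/-- `η_Q(π)` is a triangulation of `P(Q)`. -/
theorem eta_isTriangulation (P : Q.Polygon) (π : Equiv.Perm (Fin (n + 1))) :
    P.IsTriangulation (Q.eta π : Set (Segment n)) := by
  refine ⟨fun γ hγ δ hδ hne => Polygon.nonCrossing_of_not_crossUp hne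
    (not_crossUp_of_mem_eta hγ hδ) (not_crossUp_of_mem_eta hδ hγ), fun S hS hle γ hγ => ?_⟩
  refine mem_eta_of_not_crossUp fun δ hδ => ?_
  by_cases hne : γ = δ
  · subst hne
    exact ⟨not_crossUp_of_mem_eta hδ hδ, not_crossUp_of_mem_eta hδ hδ⟩
  · exact ⟨fun h => Polygon.not_nonCrossing_of_crossUp h (hS hγ (hle hδ) hne),
      fun h => Polygon.not_nonCrossing_of_crossUp h (hS (hle hδ) hγ (Ne.symm hne))⟩

end TypeAQuiver

namespace TypeAQuiver

open QuiverRep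

variable {n : ℕ} {Q : TypeAQuiver n} {k : Type u} [Field k]

/-! ## The representations `λ_i^rep(π)` -/

/-- The map of a thin representation on an arrow, as an endomorphism of `k`. -/
def thinMap (k : Type u) [Field k] (S : Finset (Fin (n + 1))) {x y : Q.Vertex} (α : x ⟶ y) :
    k →ₗ[k] k :=
  if Q.arrowIndex α ∈ S then LinearMap.id else 0

theorem thinMap_apply {S : Finset (Fin (n + 1))} {x y : Q.Vertex} (α : x ⟶ y) (m : k) :
    thinMap k S α m = if Q.arrowIndex α ∈ S then m else 0 := by
  rw [thinMap]
  split_ifs <;> rfl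

theorem thinMap_of_mem {S : Finset (Fin (n + 1))} {x y : Q.Vertex} {α : x ⟶ y}
    (h : Q.arrowIndex α ∈ S) (m : k) : thinMap k S α m = m := by
  rw [thinMap_apply, if_pos h]

theorem thinMap_of_not_mem {S : Finset (Fin (n + 1))} {x y : Q.Vertex} {α : x ⟶ y}
    (h : Q.arrowIndex α ∉ S) (m : k) : thinMap k S α m = 0 := by
  rw [thinMap_apply, if_neg h]

theorem arrow_pos {x y : Q.Vertex} (α : x ⟶ y) :
    (pos x = (Q.arrowIndex α).val ∧ pos y = (Q.arrowIndex α).val + 1 ∧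
      Q.forward (Q.arrowIndex α) = true) ∨
    (pos y = (Q.arrowIndex α).val ∧ pos x = (Q.arrowIndex α).val + 1 ∧
      Q.forward (Q.arrowIndex α) = false) :=
  arrow_cases (P := fun x y α => (pos x = (Q.arrowIndex α).val ∧
      pos y = (Q.arrowIndex α).val + 1 ∧ Q.forward (Q.arrowIndex α) = true) ∨
    (pos y = (Q.arrowIndex α).val ∧ pos x = (Q.arrowIndex α).val + 1 ∧
      Q.forward (Q.arrowIndex α) = false))
    (fun _ h => Or.inl ⟨rfl, rfl, h⟩) (fun _ h => Or.inr ⟨rfl, rfl, h⟩) x y α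

/-! ### Degenerations of thin representations -/

/-- A polynomial in linear forms that vanishes on a line except possibly at one point vanishes
at that point. -/
theorem eval_eq_zero_of_line [Infinite k] {W : Type*} [AddCommGroup W] [Module k W]
    (p : MvPolynomial (Module.Dual k W) k) (m d : W)
    (h : ∀ t : k, t ≠ 0 → MvPolynomial.eval (fun φ => φ (m + t • d)) p = 0) :
    MvPolynomial.eval (fun φ => φ m) p = 0 := by
  -- The restriction of `p` to the line is a polynomial in one variable with infinitely many roots,
  -- hence zero.
  let q : Polynomial k :=
    MvPolynomial.eval₂ Polynomial.C
      (fun φ => Polynomial.C (φ m) + Polynomial.X * Polynomial.C (φ d)) p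
  have hq : ∀ t, q.eval t = MvPolynomial.eval (fun φ => φ (m + t • d)) p := by
    intro t
    have := MvPolynomial.hom_eval₂ p Polynomial.C (Polynomial.evalRingHom t)
      (fun φ : Module.Dual k W => Polynomial.C (φ m) + Polynomial.X * Polynomial.C (φ d))
    rw [Polynomial.coe_evalRingHom] at this
    refine this.trans ?_
    have hC : (Polynomial.evalRingHom t).comp Polynomial.C = RingHom.id k := by
      ext
      simp
    rw [hC, MvPolynomial.eval₂_id]
    congr 2
    funext φ
    simp only [Polynomial.eval_add, Polynomial.eval_mul, Polynomial.eval_C, Polynomial.eval_X,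
      map_add, map_smul, smul_eq_mul]
  have h0 : q = 0 := by
    refine Polynomial.eq_zero_of_infinite_isRoot q
      ((Set.finite_singleton (0 : k)).infinite_compl.mono
      fun t ht => ?_)
    rw [Set.mem_ofPred_eq, Polynomial.IsRoot, hq]
    exact h t ht
  have := hq 0
  rw [h0, Polynomial.eval_zero, zero_smul, add_zero] at this
  exact this.symm

/-- Replacing the identity map on an arrow by zero is a degeneration. -/
theorem thinRep_erase_isDegenerationOf [Infinite k] {S : Finset (Fin (n + 1))} {l : Fin (n + 1)}
    (hl : l ∈ S) (hf : Q.forward l = true) :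
    (thinRep k Q (S.erase l)).IsDegenerationOf (thinRep k Q S) := by
  intro p hp
  -- The line puts the scalar `t` on the arrow `l`. For `t ≠ 0` it can be rescaled to 1 by
  -- multiplying all vertices to the right of the arrow by `t⁻¹`.
  let d : ∀ x y : Q.Vertex, (x ⟶ y) →
      ((thinRep k Q (S.erase l)).space x →ₗ[k] (thinRep k Q (S.erase l)).space y) :=
    fun x y α => if Q.arrowIndex α = l then (LinearMap.id : k →ₗ[k] k) else 0
  refine eval_eq_zero_of_line p _ d fun t ht => hp _ ?_
  let u : Q.Vertex → k := fun x => if pos x ≤ l.val then 1 else t⁻¹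
  have hu : ∀ x, u x ≠ 0 := fun x => by
    change (if pos x ≤ l.val then 1 else t⁻¹) ≠ 0
    split_ifs
    · exact one_ne_zero
    · exact inv_ne_zero ht
  refine ⟨⟨fun x => (LinearEquiv.smulOfNeZero k k (u x) (hu x) : k ≃ₗ[k] k),
    fun {x y} α (m : k) => ?_⟩⟩
  let D : k →ₗ[k] k := d x y α
  change thinMap k S α (u x • m) = u y • (thinMap k (S.erase l) α m + t • D m)
  have hpos := arrow_pos α
  by_cases hα : Q.arrowIndex α = l
  · have e1 : D m = m := by
      change (if Q.arrowIndex α = l then (LinearMap.id : k →ₗ[k] k) else 0) m = m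
      rw [if_pos hα]
      rfl
    rw [hα, hf] at hpos
    obtain ⟨h1, h2, -⟩ := hpos.resolve_right fun h => by cases h.2.2
    have hx : u x = 1 := if_pos h1.le
    have hy : u y = t⁻¹ := if_neg (by rw [h2]; exact Nat.not_succ_le_self _)
    rw [e1, thinMap_of_mem (hα ▸ hl), thinMap_of_not_mem (by simp [hα]), hx, hy, zero_add,
      one_smul, smul_smul, inv_mul_cancel₀ ht, one_smul]
  · have e1 : D m = 0 := by
      change (if Q.arrowIndex α = l then (LinearMap.id : k →ₗ[k] k) else 0) m = 0
      rw [if_neg hα]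
      rfl
    have hne : (Q.arrowIndex α).val ≠ l.val := fun h => hα (Fin.ext h)
    have huxy : u x = u y := by
      change (if pos x ≤ l.val then 1 else t⁻¹) = if pos y ≤ l.val then 1 else t⁻¹
      congr 1
      apply propext
      omega
    rw [e1, smul_zero, add_zero, huxy]
    by_cases hS : Q.arrowIndex α ∈ S
    · rw [thinMap_of_mem hS, thinMap_of_mem (by simp [hα, hS])]
    · rw [thinMap_of_not_mem hS, thinMap_of_not_mem (by simp [hS]), smul_zero]

/-! ### Extensions of thin representations -/

/-- The part of a thin representation that is supported on the vertices with the property `p`. -/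
def thinPart (k : Type u) [Field k] (Q : TypeAQuiver n) (S : Finset (Fin (n + 1)))
    (p : Q.Vertex → Prop) [DecidablePred p] : QuiverRep k Q.Vertex where
  space x := lineIf k (p x)
  map {x y} α := if Q.arrowIndex α ∈ S then lineMap k (p x) (p y) else 0

theorem coe_thinPart_map {S : Finset (Fin (n + 1))} {p : Q.Vertex → Prop} [DecidablePred p]
    {x y : Q.Vertex} (α : x ⟶ y) (c : lineIf k (p x)) :
    ((thinPart k Q S p).map α c : lineIf k (p y)).1 =
      if Q.arrowIndex α ∈ S ∧ p y then c.1 else 0 := by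
  change ((if Q.arrowIndex α ∈ S then lineMap k (p x) (p y) else 0) c).1 = _
  by_cases hS : Q.arrowIndex α ∈ S
  · rw [if_pos hS]
    change (if p x ∧ p y then c.1 else 0) = _
    by_cases hy : p y
    · by_cases hx : p x
      · rw [if_pos ⟨hx, hy⟩, if_pos ⟨hS, hy⟩]
      · rw [if_neg fun h => hx h.1, if_pos ⟨hS, hy⟩, c.2 hx]
    · rw [if_neg fun h => hy h.2, if_neg fun h => hy h.2]
  · rw [if_neg hS, if_neg fun h => hS h.1]
    rfl

/-- The map `k → lineIf p` that is the identity if `p` holds and `0` otherwise. -/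
def toLineIf (k : Type u) [Field k] (p : Prop) [Decidable p] : k →ₗ[k] lineIf k p :=
  (if p then LinearMap.id else 0 : k →ₗ[k] k).codRestrict (lineIf k p) fun c h => by simp [h]

theorem coe_toLineIf {p : Prop} [Decidable p] (c : k) :
    (toLineIf k p c).1 = if p then c else 0 := by
  change (if p then LinearMap.id else 0 : k →ₗ[k] k) c = _
  split_ifs <;> rfl

/-- Replacing the zero map on a left arrow by the identity map is an extension. -/
theorem thinRep_insert_isExtensionOf {S : Finset (Fin (n + 1))} {l : Fin (n + 1)}
    (hl : l ∉ S) (hf : Q.forward l = false) :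
    (thinRep k Q (insert l S)).IsExtensionOf (thinRep k Q S) := by
  -- The vertices to the left of `l` are closed under arrows because the arrow `l` points left. They
  -- carry the subrepresentation, and the map on `l`, zero before, is all that links it to the
  -- quotient.
  let p : Q.Vertex → Prop := fun x => pos x ≤ l.val
  have hp : ∀ {x y : Q.Vertex} (α : x ⟶ y), (p x → p y) ∧ (Q.arrowIndex α ≠ l → (p x ↔ p y)) ∧
      (Q.arrowIndex α = l → ¬ p x ∧ p y) := by
    intro x y α
    change (pos x ≤ l.val → pos y ≤ l.val) ∧ (_ → (pos x ≤ l.val ↔ pos y ≤ l.val)) ∧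
      (_ → ¬ pos x ≤ l.val ∧ pos y ≤ l.val)
    rcases arrow_pos α with ⟨h1, h2, h3⟩ | ⟨h1, h2, h3⟩
    · have hne : Q.arrowIndex α ≠ l := fun h => by
        rw [h, hf] at h3
        cases h3
      have hne' : (Q.arrowIndex α).val ≠ l.val := fun h => hne (Fin.ext h)
      exact ⟨by omega, fun _ => by omega, fun h => absurd h hne⟩
    · refine ⟨by omega, fun h => ?_, fun h => ?_⟩
      · have hne' : (Q.arrowIndex α).val ≠ l.val := fun h' => h (Fin.ext h')
        omega
      · rw [h] at h1 h2
        omega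
  have : DecidablePred p := fun x => inferInstanceAs (Decidable (pos x ≤ l.val))
  have hSl : ∀ {x y : Q.Vertex} (α : x ⟶ y), Q.arrowIndex α ≠ l →
      (Q.arrowIndex α ∈ insert l S ↔ Q.arrowIndex α ∈ S) := fun α h => by simp [h]
  refine ⟨thinPart k Q S p, thinPart k Q S fun x => ¬ p x,
    ⟨fun x => (lineIf k (p x)).subtype, fun {x y} α => ?_⟩,
    ⟨fun x => toLineIf k (¬ p x), fun {x y} α => ?_⟩, ?_, ?_, ?_⟩
  · apply LinearMap.ext
    intro (c : lineIf k (p x))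
    change thinMap k (insert l S) α c.1 =
      ((thinPart k Q S p).map α c : lineIf k (p y)).1
    rw [coe_thinPart_map]
    by_cases hx : p x
    · have hne : Q.arrowIndex α ≠ l := fun h => ((hp α).2.2 h).1 hx
      by_cases hS : Q.arrowIndex α ∈ S
      · rw [thinMap_of_mem ((hSl α hne).2 hS), if_pos ⟨hS, (hp α).1 hx⟩]
      · rw [thinMap_of_not_mem fun h => hS ((hSl α hne).1 h), if_neg fun h => hS h.1]
    · rw [c.2 hx, ite_self, map_zero]
  · apply LinearMap.ext
    intro (c : k)
    apply Subtype.ext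
    change ((thinPart k Q S fun x => ¬ p x).map α (toLineIf k (¬ p x) c) : lineIf k (¬ p y)).1 =
      (toLineIf k (¬ p y) (thinMap k (insert l S) α c)).1
    rw [coe_thinPart_map, coe_toLineIf, coe_toLineIf]
    by_cases hy : p y
    · rw [if_neg fun h => h.2 hy, if_neg fun h => h hy]
    · have hne : Q.arrowIndex α ≠ l := fun h => hy ((hp α).2.2 h).2
      have hx : ¬ p x := fun h => hy ((hp α).1 h)
      rw [if_pos hx, if_pos hy]
      by_cases hS : Q.arrowIndex α ∈ S
      · rw [thinMap_of_mem ((hSl α hne).2 hS), if_pos ⟨hS, hy⟩]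
      · rw [thinMap_of_not_mem fun h => hS ((hSl α hne).1 h), if_neg fun h => hS h.1]
  · refine ⟨Iso.ofBijective ⟨fun x => (toLineIf k (p x)).prod (toLineIf k (¬ p x)),
      fun {x y} α => ?_⟩ fun x => ⟨?_, ?_⟩⟩
    · apply LinearMap.ext
      intro (c : k)
      have key : ∀ (q : Q.Vertex → Prop) [DecidablePred q],
          (Q.arrowIndex α ∈ S → (q x ↔ q y)) →
          ((thinPart k Q S q).map α (toLineIf k (q x) c) : lineIf k (q y)) =
            toLineIf k (q y) (thinMap k S α c) := by
        intro q _ hq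
        apply Subtype.ext
        rw [coe_thinPart_map, coe_toLineIf, coe_toLineIf]
        by_cases hS : Q.arrowIndex α ∈ S
        · rw [thinMap_of_mem hS]
          by_cases hx : q x
          · have hy := (hq hS).1 hx
            rw [if_pos hx, if_pos ⟨hS, hy⟩, if_pos hy]
          · have hy := mt (hq hS).2 hx
            rw [if_neg fun h => hy h.2, if_neg hy]
        · rw [thinMap_of_not_mem hS, if_neg fun h => hS h.1, ite_self]
      have hpS : Q.arrowIndex α ∈ S → (p x ↔ p y) := fun h =>
        (hp α).2.1 fun h' => hl (h' ▸ h)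
      exact Prod.ext (key p hpS) (key (fun x => ¬ p x) fun h => not_congr (hpS h))
    · intro (c : k) (c' : k) hc
      have h1 := congrArg Subtype.val (congrArg Prod.fst hc)
      have h2 := congrArg Subtype.val (congrArg Prod.snd hc)
      change (toLineIf k (p x) c).1 = (toLineIf k (p x) c').1 at h1
      change (toLineIf k (¬ p x) c).1 = (toLineIf k (¬ p x) c').1 at h2
      rw [coe_toLineIf, coe_toLineIf] at h1 h2
      by_cases hx : p x
      · rwa [if_pos hx, if_pos hx] at h1
      · rwa [if_pos hx, if_pos hx] at h2
    · intro (c : lineIf k (p x) × lineIf k (¬ p x))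
      refine ⟨(c.1.1 + c.2.1 : k), Prod.ext (Subtype.ext ?_) (Subtype.ext ?_)⟩
      · change (toLineIf k (p x) (c.1.1 + c.2.1)).1 = c.1.1
        rw [coe_toLineIf]
        split_ifs with hx
        · rw [c.2.2 (not_not.2 hx), add_zero]
        · exact (c.1.2 hx).symm
      · change (toLineIf k (¬ p x) (c.1.1 + c.2.1)).1 = c.2.1
        rw [coe_toLineIf]
        split_ifs with hx
        · exact (c.2.2 (not_not.2 hx)).symm
        · rw [c.1.2 hx, zero_add]
  · intro x
    refine ⟨Subtype.val_injective, fun (c : lineIf k (¬ p x)) => ⟨c.1, Subtype.ext ?_⟩, ?_⟩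
    · change (toLineIf k (¬ p x) c.1).1 = c.1
      rw [coe_toLineIf]
      split_ifs with hx
      · exact (c.2 (not_not.2 hx)).symm
      · rfl
    · ext (c : k)
      change c ∈ LinearMap.range (lineIf k (p x)).subtype ↔ toLineIf k (¬ p x) c = 0
      rw [Submodule.range_subtype, ← Subtype.val_injective.eq_iff, coe_toLineIf]
      change (¬ p x → c = 0) ↔ (if ¬ p x then c else 0) = 0
      split_ifs <;> simp_all
  -- The new identity map on the arrow `l` is injective, but naturality of a section makes it kill
  -- the lift of the generator, because its target is outside the quotient.
  · rintro ⟨s, hs⟩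
    let α := Q.leftArrow l hf
    have hb : p (Q.before l) := le_rfl
    have ha : ¬ p (Q.after l) := fun h => Nat.not_succ_le_self _ h
    let e : lineIf k (¬ p (Q.after l)) := ⟨1, fun h => absurd ha h⟩
    have h1 := s.comm_apply α e
    have h2 : (thinPart k Q S fun x => ¬ p x).map α e = 0 :=
      Subtype.ext ((coe_thinPart_map (p := fun x => ¬ p x) α e).trans (if_neg fun h => h.2 hb))
    rw [h2, map_zero] at h1
    let w : k := s.app (Q.after l) e
    have h3 : w = 0 :=
      (thinMap_of_mem (k := k) (α := α) (S := insert l S) (by simp [α]) _).symm.trans h1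
    have h4 := congrArg Subtype.val (LinearMap.congr_fun (hs (Q.after l)) e)
    change (toLineIf k (¬ p (Q.after l)) w).1 = 1 at h4
    rw [coe_toLineIf, if_pos ha] at h4
    exact zero_ne_one (h3.symm.trans h4)

/-! ### The decomposition of `lambdaRep` along the path -/

/-- With `eq_of_mem_path`, the supports of the segments of one path partition the vertices of the
quiver, matching the dimension vector `(1, …, 1)`. -/
theorem exists_mem_path (π : Equiv.Perm (Fin (n + 1))) (t : Fin (n + 2)) (x : Q.Vertex) :
    ∃ γ ∈ Q.path π t, Mem x γ := by
  have hx := pos_lt x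
  obtain ⟨p, hp, hpmax⟩ := ((Q.pathVertices π t).filter fun c => c.val ≤ pos x).exists_max_image id
    ⟨0, by simp [zero_mem_pathVertices]⟩
  obtain ⟨q, hq, hqmin⟩ := ((Q.pathVertices π t).filter fun c => pos x < c.val).exists_min_image id
    ⟨Fin.last _, by simp [last_mem_pathVertices, hx]⟩
  simp only [Finset.mem_filter, id, and_imp] at hp hpmax hq hqmin
  refine ⟨⟨(p, q), Fin.lt_def.2 (by simp only; omega)⟩, mem_path.2 ⟨hp.1, hq.1, fun c hc h => ?_⟩,
    mem_iff.2 ⟨hp.2, hq.2⟩⟩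
  rcases le_or_gt c.val (pos x) with hcx | hcx
  · exact absurd (hpmax c hc hcx) (not_le.2 h.1)
  · exact absurd (hqmin c hc hcx) (not_le.2 h.2)

theorem eq_of_mem_path {π : Equiv.Perm (Fin (n + 1))} {t : Fin (n + 2)} {x : Q.Vertex}
    {γ δ : Segment n} (hγ : γ ∈ Q.path π t) (hδ : δ ∈ Q.path π t) (hxγ : Mem x γ)
    (hxδ : Mem x δ) : γ = δ := by
  obtain ⟨hγ1, hγ2, hγ⟩ := mem_path.1 hγ
  obtain ⟨hδ1, hδ2, hδ⟩ := mem_path.1 hδ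
  rw [mem_iff] at hxγ hxδ
  have h1 := hγ _ hδ1
  have h2 := hγ _ hδ2
  have h3 := hδ _ hγ1
  have h4 := hδ _ hγ2
  rw [Fin.lt_def, Fin.lt_def] at h1 h2 h3 h4
  exact Subtype.ext (Prod.ext (Fin.ext (by omega)) (Fin.ext (by omega)))

/-- `λ_i^rep(π)` is the direct sum of the `F(γ)` for the segments `γ` of the path `λ_i(π)`. -/
theorem lambdaRep_isomorphic (π : Equiv.Perm (Fin (n + 1))) (t : Fin (n + 2)) :
    (Q.lambdaRep k π t).Isomorphic (FSet k Q (Q.path π t)) := by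
  classical
  -- An arrow into the support of `γ` comes from inside the support exactly when its label is not on
  -- the path, that is, when it carries the identity.
  have hcomm : ∀ (γ : Q.path π t) {x y : Q.Vertex} (α : x ⟶ y), Mem y γ.1 → ∀ c : k,
      thinMap k (Q.identityArrows π t) α c = if Mem x γ.1 then c else 0 := by
    rintro ⟨γ, hγ⟩ x y α hy c
    obtain ⟨hγ1, hγ2, hγ⟩ := mem_path.1 hγ
    have hv := polygonVertex_mem_pathVertices (Q := Q) π t (Q.arrowIndex α)
    have hval := polygonVertex_val (Q.arrowIndex α)
    rw [thinMap_apply, identityArrows_eq_compl]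
    have hα := arrow_pos α
    replace hy : Mem y γ := hy
    rw [mem_iff] at hy
    refine if_congr (Iff.trans (Finset.mem_compl.trans (not_congr hv.symm))
      ⟨fun h => ?_, fun hx h => ?_⟩) rfl rfl
    · by_contra hx
      replace hx : ¬ Mem x γ := hx
      rw [mem_iff] at hx
      have h1 : polygonVertex (Q.arrowIndex α) ≠ γ.1.1 := fun e => h (e ▸ hγ1)
      have h2 : polygonVertex (Q.arrowIndex α) ≠ γ.1.2 := fun e => h (e ▸ hγ2)
      rw [Ne, Fin.ext_iff, hval] at h1 h2
      omega
    · replace hx : Mem x γ := hx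
      rw [mem_iff] at hx
      refine hγ _ h ?_
      rw [Fin.lt_def, Fin.lt_def, hval]
      omega
  let f : ∀ γ : Q.path π t, Hom (Q.lambdaRep k π t) (segmentRep k Q γ.1) := fun γ =>
    homOfForms _ _ (fun x => (if Mem x γ.1 then LinearMap.id else 0 : k →ₗ[k] k))
      (fun x hx => if_neg hx) <| by
      intro x y α hy
      apply LinearMap.ext
      intro (c : k)
      change (if Mem y γ.1 then LinearMap.id else 0 : k →ₗ[k] k)
        (thinMap k (Q.identityArrows π t) α c) =
          (if Mem x γ.1 then LinearMap.id else 0 : k →ₗ[k] k) c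
      rw [if_pos hy, LinearMap.id_apply, hcomm γ α hy]
      split_ifs <;> rfl
  have hf : ∀ γ x (c : k), Mem x γ.1 → val ((f γ).app x c) = c := by
    intro γ x c hx
    change (if Mem x γ.1 then LinearMap.id else 0 : k →ₗ[k] k) c = c
    rw [if_pos hx, LinearMap.id_apply]
  refine ⟨Iso.ofBijective ⟨fun x => LinearMap.pi fun γ => (f γ).app x, fun {x y} α => ?_⟩
    fun x => ⟨fun (c : k) (c' : k) h => ?_, fun m => ?_⟩⟩
  · apply LinearMap.ext
    intro c
    funext γ
    exact (f γ).comm_apply α c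
  · obtain ⟨γ, hγ, hx⟩ := exists_mem_path π t x
    have h1 : val ((f ⟨γ, hγ⟩).app x c) = val ((f ⟨γ, hγ⟩).app x c') :=
      congrArg val (congrFun h ⟨γ, hγ⟩)
    exact (hf ⟨γ, hγ⟩ x c hx).symm.trans (h1.trans (hf ⟨γ, hγ⟩ x c' hx))
  · obtain ⟨γ, hγ, hx⟩ := exists_mem_path π t x
    let c : k := val (m ⟨γ, hγ⟩ : (segmentRep k Q γ).space x)
    refine ⟨c, funext fun δ => ?_⟩
    change ((f δ).app x c : (segmentRep k Q δ.1).space x) = m δ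
    apply val_injective
    by_cases hδ : Mem x δ.1
    · obtain rfl : δ = ⟨γ, hγ⟩ := Subtype.ext (eq_of_mem_path δ.2 hγ hδ hx)
      exact hf _ x c hx
    · exact (val_eq_zero _ hδ).trans (val_eq_zero _ hδ).symm

theorem isIndecSummand_lambdaRep_iff {π : Equiv.Perm (Fin (n + 1))} {t : Fin (n + 2)}
    {X : QuiverRep k Q.Vertex} :
    X.IsIndecSummand (Q.lambdaRep k π t) ↔ ∃ γ ∈ Q.path π t, X.Isomorphic (F k Q γ) := by
  refine Iff.trans ?_ isIndecSummand_FSet_iff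
  exact ⟨fun h => h.of_isRetract (lambdaRep_isomorphic π t).isRetract,
    fun h => h.of_isRetract (lambdaRep_isomorphic π t).symm.isRetract⟩

/-- The indecomposable summands of `η_Q^rep(π)` are those of the `λ_i^rep(π)`. -/
theorem isIndecSummand_etaRep_iff {π : Equiv.Perm (Fin (n + 1))} {X : QuiverRep k Q.Vertex} :
    X.IsIndecSummand (Q.etaRep k π) ↔ ∃ i, X.IsIndecSummand (Q.lambdaRep k π i) := by
  rw [etaRep, isIndecSummand_FSet_iff]
  simp only [isIndecSummand_lambdaRep_iff, mem_eta]
  exact ⟨fun ⟨γ, ⟨t, hγ⟩, h⟩ => ⟨t, γ, hγ, h⟩, fun ⟨t, γ, hγ, h⟩ => ⟨γ, ⟨t, hγ⟩, h⟩⟩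

/-! ### Maximal almost rigid representations -/

theorem almostRigid_FSet {T : Finset (Segment n)}
    (h : ∀ γ ∈ T, ∀ δ ∈ T, ¬ CrossUp Q.IsUpper Q.IsLower γ δ) : (FSet k Q T).AlmostRigid := by
  refine ⟨basic_FSet T, fun A B hA hB => ?_⟩
  obtain ⟨γ, hγ, hA⟩ := isIndecSummand_FSet_iff.1 hA
  obtain ⟨δ, hδ, hB⟩ := isIndecSummand_FSet_iff.1 hB
  exact (extCompatible_of_not_crossUp (h γ hγ δ hδ)).of_isomorphic hA.symm hB.symm

/-- `η_Q^rep(π)` is a maximal almost rigid representation. -/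
theorem etaRep_maximalAlmostRigid (π : Equiv.Perm (Fin (n + 1))) :
    (Q.etaRep k π).MaximalAlmostRigid := by
  refine ⟨almostRigid_FSet fun γ hγ δ hδ => not_crossUp_of_mem_eta hγ hδ, fun X hX h => ?_⟩
  -- An interval summand of `X` is compatible with all of `η_Q(π)`, so its segment already belongs
  -- to it; then the summand is repeated, which a basic representation forbids.
  obtain ⟨γ, hγX⟩ := exists_segmentRep_isRetract X hX
  have hret : ∀ δ ∈ Q.eta π, (segmentRep k Q δ).IsRetract (Q.etaRep k π) := fun δ hδ =>
    isRetract_directSum (fun δ : Q.eta π => F k Q δ) ⟨δ, hδ⟩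
  have hcomp : ∀ δ ∈ Q.eta π, ExtCompatible (segmentRep k Q γ) (segmentRep k Q δ) ∧
      ExtCompatible (segmentRep k Q δ) (segmentRep k Q γ) := by
    intro δ hδ
    have h1 : (segmentRep k Q γ).IsIndecSummand ((Q.etaRep k π).sum X) :=
      ⟨segmentRep_indecomposable γ, (hγX.trans (isRetract_sum_right _ _)).isSummand⟩
    have h2 : (segmentRep k Q δ).IsIndecSummand ((Q.etaRep k π).sum X) :=
      ⟨segmentRep_indecomposable δ, ((hret δ hδ).trans (isRetract_sum_left _ _)).isSummand⟩
    exact ⟨h.2 _ _ h1 h2, h.2 _ _ h2 h1⟩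
  have hγ : γ ∈ Q.eta π := mem_eta_of_not_crossUp fun δ hδ =>
    ⟨fun hc => not_extCompatible_of_crossUp hc (hcomp δ hδ).1,
      fun hc => not_extCompatible_of_crossUp hc (hcomp δ hδ).2⟩
  exact h.1 _ (segmentRep_indecomposable γ) ((hret γ hγ).sum hγX).isSummand

/-- Almost rigid representations are basic, hence determined by their indecomposable summands. -/
theorem isomorphic_etaRep {π : Equiv.Perm (Fin (n + 1))} {T : QuiverRep k Q.Vertex}
    (hT : T.MaximalAlmostRigid)
    (h : ∀ X : QuiverRep k Q.Vertex,
      X.IsIndecSummand T ↔ ∃ i, X.IsIndecSummand (Q.lambdaRep k π i)) :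
    T.Isomorphic (Q.etaRep k π) := by
  refine isomorphic_FSet_of_basic hT.1.1 _ fun γ => ?_
  have h1 := (h (segmentRep k Q γ)).trans isIndecSummand_etaRep_iff.symm
  rw [etaRep, isIndecSummand_FSet_iff, IsIndecSummand, isSummand_iff_isRetract,
    and_iff_right (segmentRep_indecomposable γ)] at h1
  refine h1.trans ⟨?_, fun hγ => ⟨γ, hγ, Isomorphic.refl _⟩⟩
  rintro ⟨δ, hδ, hγδ⟩
  rwa [segmentRep_isRetract_segmentRep_iff.1 hγδ.isRetract]

theorem lambdaRep_succ_isDegenerationOf [Infinite k] {π : Equiv.Perm (Fin (n + 1))}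
    {i : Fin (n + 1)} (hi : π i ∈ Q.upper) :
    π i ∈ Q.identityArrows π i.castSucc ∧
      (Q.lambdaRep k π i.succ).IsDegenerationOf (Q.lambdaRep k π i.castSucc) := by
  have hf := mem_upper.1 hi
  have h1 : π i ∈ Q.identityArrows π i.castSucc := by
    simp [mem_identityArrows, hf]
  have h2 : Q.identityArrows π i.succ = (Q.identityArrows π i.castSucc).erase (π i) := by
    exact (Fin.induction_succ ..).trans (if_pos hi)
  refine ⟨h1, ?_⟩
  rw [lambdaRep, lambdaRep, h2]
  exact thinRep_erase_isDegenerationOf h1 hf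

theorem lambdaRep_succ_isExtensionOf {π : Equiv.Perm (Fin (n + 1))}
    {i : Fin (n + 1)} (hi : π i ∈ Q.lower) :
    π i ∉ Q.identityArrows π i.castSucc ∧
      (Q.lambdaRep k π i.succ).IsExtensionOf (Q.lambdaRep k π i.castSucc) := by
  have hf := mem_lower.1 hi
  have h1 : π i ∉ Q.identityArrows π i.castSucc := by
    simp [mem_identityArrows, hf]
  have h2 : Q.identityArrows π i.succ = insert (π i) (Q.identityArrows π i.castSucc) := by
    exact (Fin.induction_succ ..).trans (if_neg (by simp [mem_upper, hf]))
  refine ⟨h1, ?_⟩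
  rw [lambdaRep, lambdaRep, h2]
  exact thinRep_insert_isExtensionOf h1 hf

theorem identityArrows_last (π : Equiv.Perm (Fin (n + 1))) :
    Q.identityArrows π (Fin.last (n + 1)) = Q.lower := by
  ext l
  have := (π.symm l).2
  rw [mem_identityArrows, mem_lower, Fin.val_last]
  constructor
  · rintro (⟨-, h⟩ | ⟨h, -⟩)
    · omega
    · exact h
  · exact fun h => Or.inr ⟨h, this⟩

end TypeAQuiver

theorem mainTheorem7 (k : Type u) [Field k] [IsAlgClosed k] (n : ℕ) (Q : TypeAQuiver n)
    (π : Equiv.Perm (Fin (n + 1))) :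
    -- `η_Q(π)` is a triangulation of the polygon `P(Q)`
    (∀ P : Q.Polygon, P.IsTriangulation (Q.eta π : Set (TypeAQuiver.Segment n))) ∧
    -- the chain `λ_0^rep(π), …, λ_{n+1}^rep(π)`: its steps are degenerations and extensions
    (∀ i : Fin (n + 1), π i ∈ Q.upper →
      π i ∈ Q.identityArrows π i.castSucc ∧
      (Q.lambdaRep k π i.succ).IsDegenerationOf (Q.lambdaRep k π i.castSucc)) ∧
    (∀ i : Fin (n + 1), π i ∈ Q.lower →
      π i ∉ Q.identityArrows π i.castSucc ∧
      (Q.lambdaRep k π i.succ).IsExtensionOf (Q.lambdaRep k π i.castSucc)) ∧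
    -- it ends with the zero map on the upper-barred arrows and the identity on the lower-barred ones
    Q.identityArrows π (Fin.last (n + 1)) = Q.lower ∧
    -- `η_Q^rep(π)` is maximal almost rigid, its indecomposable summands are those of the chain
    (Q.etaRep k π).MaximalAlmostRigid ∧
    (∀ X : QuiverRep k Q.Vertex,
      X.IsIndecSummand (Q.etaRep k π) ↔ ∃ i, X.IsIndecSummand (Q.lambdaRep k π i)) ∧
    -- and it is the only one, up to isomorphism
    (∀ T : QuiverRep k Q.Vertex, T.MaximalAlmostRigid →
      (∀ X : QuiverRep k Q.Vertex,
        X.IsIndecSummand T ↔ ∃ i, X.IsIndecSummand (Q.lambdaRep k π i)) →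
      T.Isomorphic (Q.etaRep k π)) := by
  -- Algebraically closed fields are infinite; the degenerations need a line with infinitely many
  -- points.
  have : Infinite k := inferInstance
  exact ⟨fun P => TypeAQuiver.eta_isTriangulation P π,
    fun _ hi => TypeAQuiver.lambdaRep_succ_isDegenerationOf hi,
    fun _ hi => TypeAQuiver.lambdaRep_succ_isExtensionOf hi,
    TypeAQuiver.identityArrows_last π, TypeAQuiver.etaRep_maximalAlmostRigid π,
    fun _ => TypeAQuiver.isIndecSummand_etaRep_iff, fun _ hT h =>
      TypeAQuiver.isomorphic_etaRep hT h⟩
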